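/- All algebras are unital and over $\mathbb{C}$. Let $A$ be a Hopf algebra with coproduct $\Delta$, counit $\varepsilon$ and bijective antipode. For a subalgebra $B\subseteq A$ write $B^+ := B\cap\ker\varepsilon$. Call $B$ a \emph{quantum homogeneous $A$-space} if $\Delta(B)\subseteq A\otimes B$, $A$ is faithfully flat as a right $B$-module, and $B^+A=AB^+$. Then $B^+A$ is a Hopf ideal; let $\pi_B:A\to \pi_B(A):=A/B^+A$ be the projection onto the quotient Hopf algebra, and put $\Delta_{R,\pi_B}:=(\mathrm{id}\otimes\pi_B)\circ\Delta: A\to A\otimes\pi_B(A)$. A \emph{principal $A$-pair} $(B,P)$ consists of quantum homogeneous $A$-spaces $B\subseteq P\subseteq A$ such that $\pi_B(P)$ is a Hopf subalgebra of $\pi_B(A)$. For a Hopf algebra $H$ and a right $H$-comodule algebra $(P,\Delta_R)$, let $P^{\mathrm{co}(H)}:=\{p\in P\mid \Delta_R(p)=p\otimes 1\}$. The comodule algebra is called \emph{principal} if the canonical map $$\mathrm{can}=(m_P\otimes\mathrm{id})\circ(\mathrm{id}\otimes\Delta_R): P\otimes_{P^{\mathrm{co}(H)}}P\to P\otimes H$$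 is a bijection (that is, $P$ is a Hopf--Galois extension of $P^{\mathrm{co}(H)}$) and $P$ is faithfully flat both as a right and as a left $P^{\mathrm{co}(H)}$-module. \textbf{Proposition.} Let $(B,P)$ be a principal $A$-pair. Then $\pi_B(P)$ is a Hopf algebra with bijective antipode, and $\Delta_{R,\pi_B}$ restricts to a coaction $\Delta_{R,\pi_B}:P\to P\otimes\pi_B(P)$ which makes $P$ a right $\pi_B(P)$-comodule algebra with $P^{\mathrm{co}(\pi_B(P))}=B$. This comodule algebra $(P,\Delta_{R,\pi_B})$ is principal: $P$ is a Hopf--Galois extension of $B$, and $P$ is faithfully flat both as a right and as a left $B$-module. -/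

import Mathlib

open scoped TensorProduct MulOpposite

universe u

noncomputable section

/-! ### Tensor products over a noncommutative ring, and faithful flatness -/

section Balanced

variable (R : Type*) [Ring R] (M : Type*) [AddCommGroup M] [Module ℂ M] [Module Rᵐᵒᵖ M]
  (N : Type*) [AddCommGroup N] [Module ℂ N] [Module R N]

/-- The relations `m b ⊗ n = m ⊗ b n` that cut `M ⊗_R N` out of `M ⊗_ℂ N`. -/
def balancedRelations : Submodule ℂ (M ⊗[ℂ] N) :=
  Submodule.span ℂ {x | ∃ (m : M) (b : R) (n : N),
    x = (MulOpposite.op b • m) ⊗ₜ[ℂ] n - m ⊗ₜ[ℂ] (b • n)}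

/-- The tensor product `M ⊗_R N` of a right module `M` and a left module `N` over a
(not necessarily commutative) `ℂ`-algebra `R`. -/
abbrev BalancedTensor : Type _ := (M ⊗[ℂ] N) ⧸ balancedRelations R M N

variable {R M N}

/-- The map `id ⊗ f : M ⊗_R N → M ⊗_R N'` induced by a left `R`-linear map `f`. -/
def BalancedTensor.lTensor [Algebra ℂ R] [IsScalarTower ℂ R N]
    {N' : Type*} [AddCommGroup N'] [Module ℂ N'] [Module R N'] [IsScalarTower ℂ R N']
    (f : N →ₗ[R] N') : BalancedTensor R M N →ₗ[ℂ] BalancedTensor R M N' :=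
  Submodule.mapQ _ _ ((f.restrictScalars ℂ).lTensor M) <| by
    rw [balancedRelations, Submodule.span_le]
    rintro _ ⟨m, b, n, rfl⟩
    refine Submodule.subset_span ⟨m, b, f n, ?_⟩
    simp

/-- The map `f ⊗ id : M ⊗_R N → M' ⊗_R N` induced by a right `R`-linear map `f`. -/
def BalancedTensor.rTensor [Algebra ℂ R] [IsScalarTower ℂ Rᵐᵒᵖ M]
    {M' : Type*} [AddCommGroup M'] [Module ℂ M'] [Module Rᵐᵒᵖ M'] [IsScalarTower ℂ Rᵐᵒᵖ M']
    (f : M →ₗ[Rᵐᵒᵖ] M') : BalancedTensor R M N →ₗ[ℂ] BalancedTensor R M' N :=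
  Submodule.mapQ _ _ ((f.restrictScalars ℂ).rTensor N) <| by
    rw [balancedRelations, Submodule.span_le]
    rintro _ ⟨m, b, n, rfl⟩
    refine Submodule.subset_span ⟨f m, b, n, ?_⟩
    simp

end Balanced

/-- A right module `M` over a `ℂ`-algebra `R` is faithfully flat if `M ⊗_R -` preserves and
reflects exact sequences of left `R`-modules. -/
def IsFaithfullyFlatRight (R : Type u) [Ring R] [Algebra ℂ R]
    (M : Type u) [AddCommGroup M] [Module ℂ M] [Module Rᵐᵒᵖ M] [IsScalarTower ℂ Rᵐᵒᵖ M] : Prop :=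
  ∀ (N₁ N₂ N₃ : Type u) [AddCommGroup N₁] [AddCommGroup N₂] [AddCommGroup N₃]
    [Module ℂ N₁] [Module ℂ N₂] [Module ℂ N₃] [Module R N₁] [Module R N₂] [Module R N₃]
    [IsScalarTower ℂ R N₁] [IsScalarTower ℂ R N₂] [IsScalarTower ℂ R N₃]
    (f : N₁ →ₗ[R] N₂) (g : N₂ →ₗ[R] N₃),
    Function.Exact f g ↔
      Function.Exact (BalancedTensor.lTensor (M := M) f) (BalancedTensor.lTensor (M := M) g)

/-- A left module `M` over a `ℂ`-algebra `R` is faithfully flat if `- ⊗_R M` preserves and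
reflects exact sequences of right `R`-modules. -/
def IsFaithfullyFlatLeft (R : Type u) [Ring R] [Algebra ℂ R]
    (M : Type u) [AddCommGroup M] [Module ℂ M] [Module R M] [IsScalarTower ℂ R M] : Prop :=
  ∀ (N₁ N₂ N₃ : Type u) [AddCommGroup N₁] [AddCommGroup N₂] [AddCommGroup N₃]
    [Module ℂ N₁] [Module ℂ N₂] [Module ℂ N₃]
    [Module Rᵐᵒᵖ N₁] [Module Rᵐᵒᵖ N₂] [Module Rᵐᵒᵖ N₃]
    [IsScalarTower ℂ Rᵐᵒᵖ N₁] [IsScalarTower ℂ Rᵐᵒᵖ N₂] [IsScalarTower ℂ Rᵐᵒᵖ N₃]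
    (f : N₁ →ₗ[Rᵐᵒᵖ] N₂) (g : N₂ →ₗ[Rᵐᵒᵖ] N₃),
    Function.Exact f g ↔
      Function.Exact (BalancedTensor.rTensor (N := M) f) (BalancedTensor.rTensor (N := M) g)

/-- An algebra is a right module, by right multiplication, over each of its subalgebras. -/
instance Subalgebra.rightModule {A : Type*} [Ring A] [Algebra ℂ A] (B : Subalgebra ℂ A) :
    Module (↥B)ᵐᵒᵖ A :=
  Module.compHom A (B.val : ↥B →+* A).op

theorem Subalgebra.op_smul_eq {A : Type*} [Ring A] [Algebra ℂ A] (B : Subalgebra ℂ A)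
    (b : B) (a : A) : MulOpposite.op b • a = a * (b : A) := rfl

instance Subalgebra.rightModule_isScalarTower {A : Type*} [Ring A] [Algebra ℂ A]
    (B : Subalgebra ℂ A) : IsScalarTower ℂ (↥B)ᵐᵒᵖ A :=
  ⟨fun c b a => by
    induction b with
    | h b => exact mul_smul_comm c a (b : A)⟩

/-! ### Hopf subalgebras -/

section HopfSubalgebra

variable {Q : Type*} [Ring Q] [HopfAlgebra ℂ Q]

/-- A subalgebra `H` of a Hopf algebra is a Hopf subalgebra if `Δ(H) ⊆ H ⊗ H` and
`S(H) ⊆ H`. -/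
class Subalgebra.IsHopfSubalgebra (H : Subalgebra ℂ Q) : Prop where
  comul_mem : ∀ h ∈ H, Coalgebra.comul (R := ℂ) h ∈
    (Algebra.TensorProduct.map H.val H.val).range
  antipode_mem : ∀ h ∈ H, HopfAlgebra.antipode ℂ h ∈ H

namespace Subalgebra.IsHopfSubalgebra

theorem map_val_injective (H : Subalgebra ℂ Q) :
    Function.Injective (Algebra.TensorProduct.map H.val H.val) :=
  TensorProduct.map_injective_of_flat_flat H.val.toLinearMap H.val.toLinearMap
    Subtype.val_injective Subtype.val_injective

theorem map_map_val_injective (H : Subalgebra ℂ Q) :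
    Function.Injective
      (Algebra.TensorProduct.map H.val (Algebra.TensorProduct.map H.val H.val)) :=
  TensorProduct.map_injective_of_flat_flat H.val.toLinearMap
    (Algebra.TensorProduct.map H.val H.val).toLinearMap
    Subtype.val_injective (map_val_injective H)

variable (H : Subalgebra ℂ Q) [H.IsHopfSubalgebra]

/-- The restriction of the coproduct to a Hopf subalgebra. -/
def comulAlgHom : H →ₐ[ℂ] H ⊗[ℂ] H :=
  (AlgEquiv.ofInjective _ (map_val_injective H)).symm.toAlgHom.comp
    (((Bialgebra.comulAlgHom ℂ Q).comp H.val).codRestrict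
      (Algebra.TensorProduct.map H.val H.val).range (fun h => comul_mem h.1 h.2))

theorem map_comul (h : H) :
    Algebra.TensorProduct.map H.val H.val (comulAlgHom H h) = Coalgebra.comul (R := ℂ) (h : Q) :=
  congrArg Subtype.val
    ((AlgEquiv.ofInjective _ (map_val_injective H)).apply_symm_apply
      ⟨Coalgebra.comul (R := ℂ) (h : Q), comul_mem h.1 h.2⟩)

instance : Bialgebra ℂ H := by
  refine Bialgebra.ofAlgHom (comulAlgHom H) ((Bialgebra.counitAlgHom ℂ Q).comp H.val) ?_ ?_ ?_
  · apply AlgHom.ext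
    intro h
    apply map_map_val_injective H
    have key := Coalgebra.coassoc_apply (R := ℂ) (h : Q)
    rw [← map_comul H h] at key
    simp only [AlgHom.comp_apply]
    generalize comulAlgHom H h = x at key ⊢
    convert key using 1
    · clear key
      induction x with
      | zero => simp
      | add a b ha hb => simp only [map_add, ha, hb]
      | tmul a b =>
        simp only [Algebra.TensorProduct.map_tmul, LinearMap.rTensor_tmul, Subalgebra.coe_val,
          ← map_comul H a, AlgHom.id_apply]
        generalize comulAlgHom H a = y
        induction y with
        | zero => simp
        | add c d hc hd => simp only [map_add, TensorProduct.add_tmul, hc, hd]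
        | tmul c d => rfl
    · clear key
      induction x with
      | zero => simp
      | add a b ha hb => simp only [map_add, ha, hb]
      | tmul a b =>
        simp only [Algebra.TensorProduct.map_tmul, LinearMap.lTensor_tmul, Subalgebra.coe_val,
          ← map_comul H b, AlgHom.id_apply]
  · apply AlgHom.ext
    intro h
    have key := Coalgebra.rTensor_counit_comul (R := ℂ) (h : Q)
    rw [← map_comul H h] at key
    apply (Module.Flat.lTensor_preserves_injective_linearMap (M := ℂ) H.val.toLinearMap
      Subtype.val_injective)
    simp only [AlgHom.comp_apply]
    refine Eq.trans ?_ key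
    generalize comulAlgHom H h = x
    clear key
    induction x with
    | zero => simp
    | add a b ha hb => simp only [map_add, ha, hb]
    | tmul a b => rfl
  · apply AlgHom.ext
    intro h
    have key := Coalgebra.lTensor_counit_comul (R := ℂ) (h : Q)
    rw [← map_comul H h] at key
    apply (Module.Flat.rTensor_preserves_injective_linearMap (M := ℂ) H.val.toLinearMap
      Subtype.val_injective)
    simp only [AlgHom.comp_apply]
    refine Eq.trans ?_ key
    generalize comulAlgHom H h = x
    clear key
    induction x with
    | zero => simp
    | add a b ha hb => simp only [map_add, ha, hb]
    | tmul a b => rfl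

/-- A Hopf subalgebra is a Hopf algebra, with the restricted structure maps. -/
instance : HopfAlgebra ℂ H where
  antipode := (HopfAlgebra.antipode ℂ (A := Q)).restrict
    (p := Subalgebra.toSubmodule H) (q := Subalgebra.toSubmodule H) antipode_mem
  mul_antipode_rTensor_comul := by
    ext h
    have key := HopfAlgebra.mul_antipode_rTensor_comul_apply (R := ℂ) (h : Q)
    rw [← map_comul H h] at key
    refine Eq.trans ?_ key
    change H.val (LinearMap.mul' ℂ H (LinearMap.rTensor _ _ (comulAlgHom H h))) = _
    generalize comulAlgHom H h = x
    clear key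
    induction x with
    | zero => simp
    | add a b ha hb => simp only [map_add, ha, hb]
    | tmul a b => rfl
  mul_antipode_lTensor_comul := by
    ext h
    have key := HopfAlgebra.mul_antipode_lTensor_comul_apply (R := ℂ) (h : Q)
    rw [← map_comul H h] at key
    refine Eq.trans ?_ key
    change H.val (LinearMap.mul' ℂ H (LinearMap.lTensor _ _ (comulAlgHom H h))) = _
    generalize comulAlgHom H h = x
    clear key
    induction x with
    | zero => simp
    | add a b ha hb => simp only [map_add, ha, hb]
    | tmul a b => rfl

end Subalgebra.IsHopfSubalgebra

end HopfSubalgebra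

/-! ### Principal comodule algebras -/

/-- The structure of a right `H`-comodule algebra on an algebra `P`: a coassociative and counital
coaction `Δ_R : P → P ⊗ H` that is a map of algebras. -/
structure RightComoduleAlgebra (P H : Type*) [Ring P] [Algebra ℂ P] [Ring H]
    [HopfAlgebra ℂ H] where
  coaction : P →ₐ[ℂ] P ⊗[ℂ] H
  coassoc : ∀ p : P,
    TensorProduct.assoc ℂ P H H (coaction.toLinearMap.rTensor H (coaction p)) =
      (Coalgebra.comul (R := ℂ) (A := H)).lTensor P (coaction p)
  counit : ∀ p : P, (Coalgebra.counit (R := ℂ) (A := H)).lTensor P (coaction p) = p ⊗ₜ[ℂ] 1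

namespace RightComoduleAlgebra

section

variable {P H : Type*} [Ring P] [Algebra ℂ P] [Ring H] [HopfAlgebra ℂ H]
  (δ : RightComoduleAlgebra P H)

/-- The algebra of coinvariants `P^{co(H)} = {p | Δ_R(p) = p ⊗ 1}`. -/
def coinvariants : Subalgebra ℂ P :=
  AlgHom.equalizer δ.coaction Algebra.TensorProduct.includeLeft

/-- The map `(m_P ⊗ id) ∘ (id ⊗ Δ_R) : P ⊗ P → P ⊗ H`. -/
def preCan : P ⊗[ℂ] P →ₗ[ℂ] P ⊗[ℂ] H :=
  (LinearMap.mul' ℂ P).rTensor H ∘ₗ (TensorProduct.assoc ℂ P P H).symm.toLinearMap ∘ₗ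
    δ.coaction.toLinearMap.lTensor P

theorem preCan_tmul (p q : P) : δ.preCan (p ⊗ₜ q) = (p ⊗ₜ[ℂ] (1 : H)) * δ.coaction q := by
  change (LinearMap.mul' ℂ P).rTensor H ((TensorProduct.assoc ℂ P P H).symm
    (p ⊗ₜ[ℂ] δ.coaction q)) = _
  generalize δ.coaction q = x
  induction x with
  | zero => simp
  | add a b ha hb => simp only [map_add, TensorProduct.tmul_add, mul_add, ha, hb]
  | tmul a b => simp

/-- The canonical map `P ⊗_B P → P ⊗ H`, `p ⊗ q ↦ p q₍₀₎ ⊗ q₍₁₎`, for `B = P^{co(H)}`. -/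
def can : BalancedTensor δ.coinvariants P P →ₗ[ℂ] P ⊗[ℂ] H :=
  Submodule.liftQ _ δ.preCan <| by
    rw [balancedRelations, Submodule.span_le]
    rintro _ ⟨p, b, q, rfl⟩
    have hb : δ.coaction (b : P) = (b : P) ⊗ₜ[ℂ] (1 : H) := b.2
    simp [preCan_tmul, Subalgebra.op_smul_eq, Subalgebra.smul_def, hb, ← mul_assoc]

/-- `P` is a Hopf-Galois extension of `P^{co(H)}` if the canonical map is a bijection. -/
def IsHopfGalois : Prop := Function.Bijective δ.can

end

/-- A right comodule algebra is principal if it is a Hopf-Galois extension of its coinvariants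
and is faithfully flat over them, both as a right and as a left module. -/
structure IsPrincipal {P : Type u} {H : Type*} [Ring P] [Algebra ℂ P] [Ring H] [HopfAlgebra ℂ H]
    (δ : RightComoduleAlgebra P H) : Prop where
  hopfGalois : δ.IsHopfGalois
  faithfullyFlat_right : IsFaithfullyFlatRight δ.coinvariants P
  faithfullyFlat_left : IsFaithfullyFlatLeft δ.coinvariants P

end RightComoduleAlgebra

/-! ### Quantum homogeneous spaces and principal pairs -/

section QuantumHomogeneousSpace

variable {A : Type u} [Ring A] [HopfAlgebra ℂ A]

/-- `B⁺ = B ∩ ker ε`. -/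
def Subalgebra.augmentation (B : Subalgebra ℂ A) : Submodule ℂ A :=
  Subalgebra.toSubmodule B ⊓ LinearMap.ker (Coalgebra.counit (R := ℂ) (A := A))

/-- A quantum homogeneous `A`-space: a left coideal subalgebra `B` of `A` such that `A` is
faithfully flat as a right `B`-module and `B⁺A = AB⁺`. -/
class IsQuantumHomogeneousSpace (B : Subalgebra ℂ A) : Prop where
  comul_mem : ∀ b ∈ B, Coalgebra.comul (R := ℂ) b ∈
    (Algebra.TensorProduct.map (AlgHom.id ℂ A) B.val).range
  faithfullyFlat : IsFaithfullyFlatRight B A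
  augmentation_mul : B.augmentation * ⊤ = ⊤ * B.augmentation

/-- The left ideal `AB⁺` generated by `B⁺`. -/
def Subalgebra.augmentationIdeal (B : Subalgebra ℂ A) : Ideal A :=
  Ideal.span (B.augmentation : Set A)

theorem Subalgebra.restrictScalars_augmentationIdeal (B : Subalgebra ℂ A) :
    B.augmentationIdeal.restrictScalars ℂ = ⊤ * B.augmentation := by
  apply le_antisymm
  · intro x hx
    change x ∈ Submodule.span A (B.augmentation : Set A) at hx
    induction hx using Submodule.span_induction with
    | mem x hx => simpa using Submodule.mul_mem_mul (Submodule.mem_top (x := (1 : A))) hx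
    | zero => exact zero_mem _
    | add x y _ _ hx hy => exact add_mem hx hy
    | smul a x _ hx =>
      have h := Submodule.mul_mem_mul (Submodule.mem_top (x := a) (R := ℂ)) hx
      rw [← mul_assoc] at h
      exact (show ⊤ * ⊤ * B.augmentation ≤ ⊤ * B.augmentation from
        mul_le_mul' le_top le_rfl) h
  · rw [Submodule.mul_le]
    intro a _ b hb
    exact Ideal.mul_mem_left _ a (Ideal.subset_span hb)

theorem Subalgebra.sub_counit_mem (B : Subalgebra ℂ A) (b : B) :
    (b : A) - algebraMap ℂ A (Coalgebra.counit (R := ℂ) (b : A)) ∈ B.augmentation :=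
  ⟨sub_mem b.2 (B.algebraMap_mem _), by simp⟩

variable (B : Subalgebra ℂ A) [hB : IsQuantumHomogeneousSpace B]

instance IsQuantumHomogeneousSpace.isTwoSided : B.augmentationIdeal.IsTwoSided where
  mul_mem_of_left {x} y hx := by
    have h1 : x ∈ B.augmentationIdeal.restrictScalars ℂ := hx
    rw [B.restrictScalars_augmentationIdeal, ← hB.augmentation_mul] at h1
    have h2 := Submodule.mul_mem_mul h1 (Submodule.mem_top (x := y) (R := ℂ))
    rw [mul_assoc] at h2
    have h3 : x * y ∈ B.augmentation * ⊤ :=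
      (show B.augmentation * (⊤ * ⊤) ≤ B.augmentation * ⊤ from mul_le_mul' le_rfl le_top) h2
    rw [hB.augmentation_mul, ← B.restrictScalars_augmentationIdeal] at h3
    exact h3

theorem IsQuantumHomogeneousSpace.comul_sub_mem {b : A} (hb : b ∈ B.augmentation) :
    ∃ t : A ⊗[ℂ] B, Coalgebra.comul (R := ℂ) b =
        (Algebra.TensorProduct.map (AlgHom.id ℂ A) B.val) t ∧
      (LinearMap.mul' ℂ A ((HopfAlgebra.antipode ℂ (A := A)).rTensor A
        ((Algebra.TensorProduct.map (AlgHom.id ℂ A) B.val) t)) = 0) ∧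
      (Coalgebra.counit (R := ℂ) (A := A)).lTensor A
        ((Algebra.TensorProduct.map (AlgHom.id ℂ A) B.val) t) = b ⊗ₜ 1 := by
  obtain ⟨t, ht⟩ := hB.comul_mem b hb.1
  have hb0 : Coalgebra.counit (R := ℂ) b = 0 := hb.2
  refine ⟨t, ht.symm, ?_, ?_⟩
  · have h := HopfAlgebra.mul_antipode_rTensor_comul_apply (R := ℂ) b
    rw [hb0, map_zero, ← ht] at h
    exact h
  · have h := Coalgebra.lTensor_counit_comul (R := ℂ) b
    rw [← ht] at h
    exact h

theorem Subalgebra.mk_eq_counit (b : B) :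
    Ideal.Quotient.mk B.augmentationIdeal (b : A) =
      Ideal.Quotient.mk B.augmentationIdeal (algebraMap ℂ A (Coalgebra.counit (R := ℂ) (b : A))) :=
  Ideal.Quotient.eq.2 (Ideal.subset_span (Subalgebra.sub_counit_mem B b))

/-- `(π ⊗ π) ∘ Δ` vanishes on `AB⁺`, where `π` is the quotient map by `AB⁺`. -/
theorem IsQuantumHomogeneousSpace.map_mk_comul {x : A} (hx : x ∈ B.augmentationIdeal) :
    (Algebra.TensorProduct.map (Ideal.Quotient.mkₐ ℂ B.augmentationIdeal)
      (Ideal.Quotient.mkₐ ℂ B.augmentationIdeal)) (Coalgebra.comul (R := ℂ) x) = 0 := by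
  set F := (Algebra.TensorProduct.map (Ideal.Quotient.mkₐ ℂ B.augmentationIdeal)
      (Ideal.Quotient.mkₐ ℂ B.augmentationIdeal)).comp (Bialgebra.comulAlgHom ℂ A) with hF
  suffices B.augmentationIdeal ≤ RingHom.ker F from this hx
  refine Ideal.span_le.2 ?_
  intro b hb
  obtain ⟨t, ht, -, ht2⟩ := hB.comul_sub_mem B hb
  have key : ∀ t : A ⊗[ℂ] B,
      (Algebra.TensorProduct.map (Ideal.Quotient.mkₐ ℂ B.augmentationIdeal)
        (Ideal.Quotient.mkₐ ℂ B.augmentationIdeal))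
          ((Algebra.TensorProduct.map (AlgHom.id ℂ A) B.val) t) =
      (TensorProduct.map (Ideal.Quotient.mkₐ ℂ B.augmentationIdeal).toLinearMap
        (Algebra.linearMap ℂ (A ⧸ B.augmentationIdeal)))
        ((Coalgebra.counit (R := ℂ) (A := A)).lTensor A
          ((Algebra.TensorProduct.map (AlgHom.id ℂ A) B.val) t)) := by
    intro t
    induction t with
    | zero => simp
    | add a b ha hb => simp only [map_add, ha, hb]
    | tmul a b =>
      simp only [Algebra.TensorProduct.map_tmul, AlgHom.id_apply, Subalgebra.coe_val,
        Ideal.Quotient.mkₐ_eq_mk, LinearMap.lTensor_tmul, TensorProduct.map_tmul,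
        AlgHom.toLinearMap_apply, Algebra.linearMap_apply, Subalgebra.mk_eq_counit B b]
      rfl
  have hb0 : Ideal.Quotient.mk B.augmentationIdeal b = 0 :=
    Ideal.Quotient.eq_zero_iff_mem.2 (Ideal.subset_span hb)
  change (Algebra.TensorProduct.map (Ideal.Quotient.mkₐ ℂ B.augmentationIdeal)
      (Ideal.Quotient.mkₐ ℂ B.augmentationIdeal)) (Coalgebra.comul (R := ℂ) b) = 0
  rw [ht, key, ht2, TensorProduct.map_tmul]
  simp [hb0]

theorem IsQuantumHomogeneousSpace.antipode_mem_of_mem {b : A} (hb : b ∈ B.augmentation) :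
    HopfAlgebra.antipode ℂ b ∈ B.augmentationIdeal := by
  obtain ⟨t, -, ht, ht2⟩ := hB.comul_sub_mem B hb
  have key : ∀ t : A ⊗[ℂ] B,
      LinearMap.mul' ℂ A ((HopfAlgebra.antipode ℂ (A := A)).rTensor A
        ((Algebra.TensorProduct.map (AlgHom.id ℂ A) B.val) t)) -
      LinearMap.mul' ℂ A (TensorProduct.map (HopfAlgebra.antipode ℂ (A := A))
        (Algebra.linearMap ℂ A) ((Coalgebra.counit (R := ℂ) (A := A)).lTensor A
          ((Algebra.TensorProduct.map (AlgHom.id ℂ A) B.val) t))) ∈ B.augmentationIdeal := by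
    intro t
    induction t with
    | zero => simp
    | add a b ha hb =>
      simp only [map_add]
      rw [add_sub_add_comm]
      exact add_mem ha hb
    | tmul a b =>
      have h := Ideal.mul_mem_left B.augmentationIdeal (HopfAlgebra.antipode ℂ a)
        (Ideal.subset_span (Subalgebra.sub_counit_mem B b))
      rw [mul_sub] at h
      exact h
  have h := key t
  rw [ht, ht2] at h
  simpa using h

/-- `AB⁺ = B⁺A` is a Hopf ideal, so that `A ⧸ AB⁺` is a quotient Hopf algebra of `A`. -/
instance IsQuantumHomogeneousSpace.isHopfIdeal : B.augmentationIdeal.IsHopfIdeal ℂ where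
  counit_eq_zero x hx := by
    suffices B.augmentationIdeal ≤ RingHom.ker (Bialgebra.counitAlgHom ℂ A) from this hx
    rw [Subalgebra.augmentationIdeal, Ideal.span_le]
    exact fun b hb => hb.2
  map_mkQ_comul_eq_zero x hx := hB.map_mk_comul B hx
  antipode_mem x hx := by
    change x ∈ Submodule.span A (B.augmentation : Set A) at hx
    induction hx using Submodule.span_induction with
    | mem x hx => exact hB.antipode_mem_of_mem B hx
    | zero => simp
    | add x y _ _ hx hy => rw [map_add]; exact add_mem hx hy
    | smul a x _ hx =>
      rw [smul_eq_mul, HopfAlgebra.antipode_mul_antidistrib]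
      exact Ideal.mul_mem_right _ _ hx

/-- The Hopf algebra `π_B(A) = A ⧸ B⁺A`. -/
abbrev QuotientHopf : Type u := A ⧸ B.augmentationIdeal

/-- The projection `π_B : A → π_B(A)`. -/
abbrev quotientProj : A →ₐ[ℂ] QuotientHopf B := Ideal.Quotient.mkₐ ℂ B.augmentationIdeal

/-- The right `π_B(A)`-coaction `Δ_{R,π_B} = (id ⊗ π_B) ∘ Δ` on `A`. -/
def quotientCoaction : A →ₐ[ℂ] A ⊗[ℂ] QuotientHopf B :=
  (Algebra.TensorProduct.map (AlgHom.id ℂ A) (quotientProj B)).comp (Bialgebra.comulAlgHom ℂ A)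

/-- A principal `A`-pair: nested quantum homogeneous `A`-spaces `B ⊆ P` such that `π_B(P)` is a
Hopf subalgebra of `π_B(A)`. -/
class IsPrincipalPair (B P : Subalgebra ℂ A) [IsQuantumHomogeneousSpace B]
    [IsQuantumHomogeneousSpace P] : Prop where
  le : B ≤ P
  isHopfSubalgebra : (P.map (quotientProj B)).IsHopfSubalgebra

attribute [instance] IsPrincipalPair.isHopfSubalgebra

end QuantumHomogeneousSpace

end

/-! Write `C = A/B⁺A` and `D = A/P⁺A`, with projections `π`, `ρ` and induced map `f : C → D`. The
engine is the Galois isomorphism `A ⊗_B A ≅ A ⊗ C`, `x ⊗ y ↦ x y₁ ⊗ π(y₂)`. For `C = A` it is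
inverted by `x ⊗ y ↦ x S(y₁) ⊗ y₂`, and this inverse carries `A ⊗ B⁺A` into the relations defining
`A ⊗_B A` (`mem_balancedRelations_of_galoisMap`).

Since `A` is faithfully flat as a right `B`-module, the Galois isomorphism gives `A ⊗_B (A □_C V) ≅
A ⊗ V` for every left `C`-comodule `V`. Hence `A □_C -` preserves surjections (`cotensor_lift`), and
descent also yields `A^{co C} = B` (`mem_of_coactionAlong_eq`). Twisting by the antipode transfers
this to all Hopf modules over `(A, C)`: taking coinvariants preserves surjections
(`RelHopfModule.exists_coinvariant`), and every Hopf module is generated by its coinvariants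
(`RelHopfModule.mem_span_act`). Applied to the Hopf modules `N ⊗ A` and to kernels of maps out of
them, these two facts make `A` flat as a left `B`-module, with `N → N ⊗_B A` injective. The same
holds for `P` and `D`.

For the pair, `C` is a Hopf module over `(A, D)`, and lifting coinvariants along `A → C` shows
`C^{co D} = π(P)` (`mem_map_of_coactionAlong_eq`). Because `f` is the counit on the Hopf subalgebra
`π(P)`, the latter is also coinvariant on the left. Playing the two sides against each other shows
that `S(x) ∈ π(P)` forces `x ∈ π(P)`, which gives bijectivity of the antipode of `π(P)`; left
coinvariance together with `A^{co D} = P` shows that the coaction maps `P` into `P ⊗ π(P)`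
(`coactionAlong_mem_range`).

Finally `P` inherits its properties from `A`. The composite `P ⊗_B N → A ⊗_B N → A ⊗_P (P ⊗_B N)` is
`x ↦ 1 ⊗ x`, which is injective, so flatness of `A` over `B` descends to `P`. The canonical map of
`P` is a restriction of the Galois map of `A`, hence injective, and it becomes surjective after
applying `A ⊗_P -`, hence is surjective. -/

noncomputable section

/-! ### Flatness over a noncommutative ring, elementwise -/

section RightFlat

variable {R : Type u} [Ring R] [Algebra ℂ R]
  {M : Type u} [AddCommGroup M] [Module ℂ M] [Module Rᵐᵒᵖ M] [IsScalarTower ℂ Rᵐᵒᵖ M]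

theorem tmul_sub_tmul_mem_balancedRelations {R : Type*} [Ring R] {M : Type*} [AddCommGroup M]
    [Module ℂ M] [Module Rᵐᵒᵖ M] {N : Type*} [AddCommGroup N] [Module ℂ N] [Module R N]
    (m : M) (b : R) (n : N) :
    (MulOpposite.op b • m) ⊗ₜ[ℂ] n - m ⊗ₜ[ℂ] (b • n) ∈ balancedRelations R M N :=
  Submodule.subset_span ⟨m, b, n, rfl⟩

/-- A linear map between tensor products maps relations to relations if it does so on
generators. -/
theorem map_mem_of_mem_balancedRelations {R : Type*} [Ring R] {M : Type*} [AddCommGroup M]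
    [Module ℂ M] [Module Rᵐᵒᵖ M] {N : Type*} [AddCommGroup N] [Module ℂ N] [Module R N]
    {X : Type*} [AddCommGroup X] [Module ℂ X] (F : M ⊗[ℂ] N →ₗ[ℂ] X) (S : Submodule ℂ X)
    (h : ∀ (m : M) (b : R) (n : N),
      F ((MulOpposite.op b • m) ⊗ₜ[ℂ] n) - F (m ⊗ₜ[ℂ] (b • n)) ∈ S)
    {t : M ⊗[ℂ] N} (ht : t ∈ balancedRelations R M N) : F t ∈ S := by
  suffices balancedRelations R M N ≤ S.comap F from this ht
  rw [balancedRelations, Submodule.span_le]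
  rintro _ ⟨m, b, n, rfl⟩
  simpa using h m b n

variable (R M) in
/-- `M ⊗_R -` preserves injections. -/
def IsFlatRight : Prop :=
  ∀ (N N' : Type u) [AddCommGroup N] [AddCommGroup N'] [Module ℂ N] [Module ℂ N']
    [Module R N] [Module R N'] [IsScalarTower ℂ R N] [IsScalarTower ℂ R N'] (f : N →ₗ[R] N'),
    Function.Injective f → ∀ t : M ⊗[ℂ] N,
      (f.restrictScalars ℂ).lTensor M t ∈ balancedRelations R M N' → t ∈ balancedRelations R M N

/-- `N → M ⊗_R N`, `n ↦ e ⊗ n`, is injective for all left modules `N`. -/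
def IsPureRight (R : Type u) [Ring R] [Algebra ℂ R] {M : Type u} [AddCommGroup M] [Module ℂ M]
    [Module Rᵐᵒᵖ M] (e : M) : Prop :=
  ∀ (N : Type u) [AddCommGroup N] [Module ℂ N] [Module R N] [IsScalarTower ℂ R N] (n : N),
    e ⊗ₜ[ℂ] n ∈ balancedRelations R M N → n = 0

variable {N N' N'' : Type u} [AddCommGroup N] [AddCommGroup N'] [AddCommGroup N'']
  [Module ℂ N] [Module ℂ N'] [Module ℂ N''] [Module R N] [Module R N'] [Module R N'']
  [IsScalarTower ℂ R N] [IsScalarTower ℂ R N'] [IsScalarTower ℂ R N'']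

/-- If `N → N' → Q → 0` is exact and `j : Q → N''` is injective, then tensoring keeps
`N → N' → N''` exact. -/
theorem lTensor_exact_balanced_of_comp {Q : Type u} [AddCommGroup Q] [Module ℂ Q] [Module R Q]
    [IsScalarTower ℂ R Q] {f : N →ₗ[R] N'} {q : N' →ₗ[R] Q} {j : Q →ₗ[R] N''}
    (hfq : Function.Exact f q) (hq : Function.Surjective q) (hj : Function.Injective j)
    (hM : IsFlatRight R M) :
    Function.Exact (BalancedTensor.lTensor (M := M) f)
      (BalancedTensor.lTensor (M := M) (j ∘ₗ q)) := by
  have hcomp : ∀ t, ((j ∘ₗ q).restrictScalars ℂ).lTensor M t =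
      (j.restrictScalars ℂ).lTensor M ((q.restrictScalars ℂ).lTensor M t) := fun t => by
    rw [← LinearMap.comp_apply, ← LinearMap.lTensor_comp]; rfl
  have hex : Function.Exact ((f.restrictScalars ℂ).lTensor M) ((q.restrictScalars ℂ).lTensor M) :=
    lTensor_exact _ hfq hq
  intro y
  obtain ⟨t, rfl⟩ := Submodule.Quotient.mk_surjective _ y
  constructor
  · intro h
    have h1 : ((j ∘ₗ q).restrictScalars ℂ).lTensor M t ∈ balancedRelations R M N'' :=
      (Submodule.Quotient.mk_eq_zero _).1 h
    rw [hcomp] at h1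
    have h2 := hM Q N'' j hj _ h1
    -- Because `q` is onto, each generating relation for `Q` lifts to one for `N'`. Correcting `t`
    -- by such a lift leaves an element of the kernel of `id ⊗ q` over `ℂ`, where right exactness
    -- applies.
    have hlift : balancedRelations R M Q ≤
        (balancedRelations R M N').map ((q.restrictScalars ℂ).lTensor M) := by
      rw [balancedRelations, Submodule.span_le]
      rintro _ ⟨m, b, n, rfl⟩
      obtain ⟨n, rfl⟩ := hq n
      exact ⟨_, tmul_sub_tmul_mem_balancedRelations m b n, by simp⟩
    obtain ⟨s, hs, hst⟩ := hlift h2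
    obtain ⟨r, hr⟩ := (hex (t - s)).1 (by rw [map_sub, hst, sub_self])
    refine ⟨Submodule.Quotient.mk r, ?_⟩
    refine (Submodule.Quotient.eq _).2 ?_
    change (f.restrictScalars ℂ).lTensor M r - t ∈ _
    rw [hr]
    simpa using hs
  · rintro ⟨y, hy⟩
    obtain ⟨s, rfl⟩ := Submodule.Quotient.mk_surjective _ y
    rw [← hy]
    change Submodule.Quotient.mk (((j ∘ₗ q).restrictScalars ℂ).lTensor M
      ((f.restrictScalars ℂ).lTensor M s)) = _
    rw [hcomp, hex.apply_apply_eq_zero, map_zero, Submodule.Quotient.mk_zero]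

theorem lTensor_exact_balanced {f : N →ₗ[R] N'} {g : N' →ₗ[R] N''}
    (hfg : Function.Exact f g) (hM : IsFlatRight R M) :
    Function.Exact (BalancedTensor.lTensor (M := M) f) (BalancedTensor.lTensor (M := M) g) :=
  lTensor_exact_balanced_of_comp (q := g.rangeRestrict) (j := (LinearMap.range g).subtype)
    (fun y => by rw [← hfg y, Subtype.ext_iff]; rfl) g.surjective_rangeRestrict
    Subtype.val_injective hM

/-- One element `e` suffices to reflect exactness, because `n ↦ e ⊗ n` is natural in `N` and
injective. For subalgebras the criterion is applied with `e = 1`. -/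
theorem isFaithfullyFlatRight_of_isFlatRight_of_isPureRight {e : M} (hM : IsFlatRight R M)
    (he : IsPureRight R e) : IsFaithfullyFlatRight R M := by
  intro N₁ N₂ N₃ _ _ _ _ _ _ _ _ _ _ _ _ f g
  refine ⟨fun h => lTensor_exact_balanced h hM, fun h y => ⟨fun hy => ?_, ?_⟩⟩
  · obtain ⟨z, hz⟩ := (h (Submodule.Quotient.mk (e ⊗ₜ y))).1 (by
      change Submodule.Quotient.mk ((g.restrictScalars ℂ).lTensor M (e ⊗ₜ y)) = _
      simp [hy])
    obtain ⟨s, rfl⟩ := Submodule.Quotient.mk_surjective _ z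
    -- In the cokernel of `f` the term coming from `s` dies, so `e ⊗ q y` is itself a relation and
    -- purity gives `q y = 0`.
    let q := (LinearMap.range f).mkQ
    have h1 : (f.restrictScalars ℂ).lTensor M s - e ⊗ₜ y ∈ balancedRelations R M N₂ :=
      (Submodule.Quotient.eq _).1 hz
    have h2 := map_mem_of_mem_balancedRelations ((q.restrictScalars ℂ).lTensor M)
      (balancedRelations R M _) (fun m b n => by
        simpa using tmul_sub_tmul_mem_balancedRelations m b (q n)) h1
    have h3 : q.restrictScalars ℂ ∘ₗ f.restrictScalars ℂ = 0 := by
      ext x; exact (Submodule.Quotient.mk_eq_zero _).2 ⟨x, rfl⟩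
    rw [map_sub, ← LinearMap.comp_apply, ← LinearMap.lTensor_comp, h3] at h2
    have h4 := he _ (q y) (by simpa using neg_mem h2)
    exact (Submodule.Quotient.mk_eq_zero _).1 h4
  · rintro ⟨x, rfl⟩
    refine he _ _ ((Submodule.Quotient.mk_eq_zero _).1 ?_)
    exact (h _).2 ⟨Submodule.Quotient.mk (e ⊗ₜ x), rfl⟩

theorem IsFaithfullyFlatRight.isFlatRight (hM : IsFaithfullyFlatRight R M) :
    IsFlatRight R M := by
  intro N N' _ _ _ _ _ _ _ _ f hf t ht
  have h0 : Function.Exact (0 : N →ₗ[R] N) f := by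
    intro y
    rw [map_eq_zero_iff f hf]
    exact ⟨fun h => ⟨0, by simp [h]⟩, by rintro ⟨x, rfl⟩; rfl⟩
  obtain ⟨x, hx⟩ := ((hM _ _ _ _ _).1 h0 (Submodule.Quotient.mk t)).1
    ((Submodule.Quotient.mk_eq_zero _).2 ht)
  obtain ⟨s, rfl⟩ := Submodule.Quotient.mk_surjective _ x
  have h1 : ((0 : N →ₗ[R] N).restrictScalars ℂ).lTensor M s - t ∈ balancedRelations R M N :=
    (Submodule.Quotient.eq _).1 hx
  have h2 : (0 : N →ₗ[R] N).restrictScalars ℂ = 0 := rfl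
  rw [h2] at h1
  simpa using h1

theorem IsFaithfullyFlatRight.surjective (hM : IsFaithfullyFlatRight R M) (f : N →ₗ[R] N')
    (hf : Function.Surjective (BalancedTensor.lTensor (M := M) f)) : Function.Surjective f := by
  intro y
  refine ((hM _ _ _ f (0 : N' →ₗ[R] N')).2 (fun z => ⟨fun _ => hf z, fun _ => ?_⟩) y).1 rfl
  obtain ⟨s, rfl⟩ := Submodule.Quotient.mk_surjective _ z
  change Submodule.Quotient.mk (((0 : N' →ₗ[R] N').restrictScalars ℂ).lTensor M s) = _
  have h2 : (0 : N' →ₗ[R] N').restrictScalars ℂ = 0 := rfl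
  simp [h2]

/-- Flatness embeds `M ⊗_R Rn` in `M ⊗_R N`, so the hypothesis makes `M ⊗_R Rn` vanish. Then the
zero endomorphism of `Rn` is onto after tensoring, hence onto already. -/
theorem IsFaithfullyFlatRight.eq_zero (hM : IsFaithfullyFlatRight R M) (n : N)
    (hn : ∀ m : M, m ⊗ₜ[ℂ] n ∈ balancedRelations R M N) : n = 0 := by
  let K := Submodule.span R {n}
  have hK : ∀ t : M ⊗[ℂ] K, t ∈ balancedRelations R M K := by
    intro t
    refine hM.isFlatRight K N K.subtype Subtype.val_injective t ?_
    induction t with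
    | zero => simp
    | add a b ha hb => rw [map_add]; exact add_mem ha hb
    | tmul m k =>
      obtain ⟨k, hk⟩ := k
      obtain ⟨b, rfl⟩ := Submodule.mem_span_singleton.1 hk
      have h := sub_mem (hn (MulOpposite.op b • m)) (tmul_sub_tmul_mem_balancedRelations m b n)
      simpa using h
  have h0 : ∀ z : BalancedTensor R M K, z = 0 := by
    intro z
    obtain ⟨s, rfl⟩ := Submodule.Quotient.mk_surjective _ z
    exact (Submodule.Quotient.mk_eq_zero _).2 (hK s)
  obtain ⟨y, hy⟩ := hM.surjective (0 : K →ₗ[R] K) (fun z => ⟨0, by rw [h0 z, map_zero]⟩)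
    ⟨n, Submodule.mem_span_singleton_self n⟩
  exact (congrArg Subtype.val hy).symm

end RightFlat

/-! ### Flatness and purity for left modules, the mirror image -/

section LeftFlat

variable {R : Type u} [Ring R] [Algebra ℂ R]
  {M : Type u} [AddCommGroup M] [Module ℂ M] [Module R M] [IsScalarTower ℂ R M]

variable (R M) in
/-- `- ⊗_R M` preserves injections. -/
def IsFlatLeft : Prop :=
  ∀ (N N' : Type u) [AddCommGroup N] [AddCommGroup N'] [Module ℂ N] [Module ℂ N']
    [Module Rᵐᵒᵖ N] [Module Rᵐᵒᵖ N'] [IsScalarTower ℂ Rᵐᵒᵖ N] [IsScalarTower ℂ Rᵐᵒᵖ N']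
    (f : N →ₗ[Rᵐᵒᵖ] N'), Function.Injective f → ∀ t : N ⊗[ℂ] M,
      (f.restrictScalars ℂ).rTensor M t ∈ balancedRelations R N' M → t ∈ balancedRelations R N M

/-- `N → N ⊗_R M`, `n ↦ n ⊗ e`, is injective for all right modules `N`. -/
def IsPureLeft (R : Type u) [Ring R] [Algebra ℂ R] {M : Type u} [AddCommGroup M] [Module ℂ M]
    [Module R M] (e : M) : Prop :=
  ∀ (N : Type u) [AddCommGroup N] [Module ℂ N] [Module Rᵐᵒᵖ N] [IsScalarTower ℂ Rᵐᵒᵖ N] (n : N),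
    n ⊗ₜ[ℂ] e ∈ balancedRelations R N M → n = 0

variable {N N' N'' : Type u} [AddCommGroup N] [AddCommGroup N'] [AddCommGroup N'']
  [Module ℂ N] [Module ℂ N'] [Module ℂ N''] [Module Rᵐᵒᵖ N] [Module Rᵐᵒᵖ N'] [Module Rᵐᵒᵖ N'']
  [IsScalarTower ℂ Rᵐᵒᵖ N] [IsScalarTower ℂ Rᵐᵒᵖ N'] [IsScalarTower ℂ Rᵐᵒᵖ N'']

/-- If `N → N' → Q → 0` is exact and `j : Q → N''` is injective, then tensoring keeps
`N → N' → N''` exact. -/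
theorem rTensor_exact_balanced_of_comp {Q : Type u} [AddCommGroup Q] [Module ℂ Q] [Module Rᵐᵒᵖ Q]
    [IsScalarTower ℂ Rᵐᵒᵖ Q] {f : N →ₗ[Rᵐᵒᵖ] N'} {q : N' →ₗ[Rᵐᵒᵖ] Q} {j : Q →ₗ[Rᵐᵒᵖ] N''}
    (hfq : Function.Exact f q) (hq : Function.Surjective q) (hj : Function.Injective j)
    (hM : IsFlatLeft R M) :
    Function.Exact (BalancedTensor.rTensor (N := M) f)
      (BalancedTensor.rTensor (N := M) (j ∘ₗ q)) := by
  have hcomp : ∀ t, ((j ∘ₗ q).restrictScalars ℂ).rTensor M t =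
      (j.restrictScalars ℂ).rTensor M ((q.restrictScalars ℂ).rTensor M t) := fun t => by
    rw [← LinearMap.comp_apply, ← LinearMap.rTensor_comp]; rfl
  have hex : Function.Exact ((f.restrictScalars ℂ).rTensor M) ((q.restrictScalars ℂ).rTensor M) :=
    rTensor_exact _ hfq hq
  intro y
  obtain ⟨t, rfl⟩ := Submodule.Quotient.mk_surjective _ y
  constructor
  · intro h
    have h1 : ((j ∘ₗ q).restrictScalars ℂ).rTensor M t ∈ balancedRelations R N'' M :=
      (Submodule.Quotient.mk_eq_zero _).1 h
    rw [hcomp] at h1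
    have h2 := hM Q N'' j hj _ h1
    have hlift : balancedRelations R Q M ≤
        (balancedRelations R N' M).map ((q.restrictScalars ℂ).rTensor M) := by
      rw [balancedRelations, Submodule.span_le]
      rintro _ ⟨m, b, n, rfl⟩
      obtain ⟨m, rfl⟩ := hq m
      exact ⟨_, tmul_sub_tmul_mem_balancedRelations m b n, by simp⟩
    obtain ⟨s, hs, hst⟩ := hlift h2
    obtain ⟨r, hr⟩ := (hex (t - s)).1 (by rw [map_sub, hst, sub_self])
    refine ⟨Submodule.Quotient.mk r, ?_⟩
    refine (Submodule.Quotient.eq _).2 ?_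
    change (f.restrictScalars ℂ).rTensor M r - t ∈ _
    rw [hr]
    simpa using hs
  · rintro ⟨y, hy⟩
    obtain ⟨s, rfl⟩ := Submodule.Quotient.mk_surjective _ y
    rw [← hy]
    change Submodule.Quotient.mk (((j ∘ₗ q).restrictScalars ℂ).rTensor M
      ((f.restrictScalars ℂ).rTensor M s)) = _
    rw [hcomp, hex.apply_apply_eq_zero, map_zero, Submodule.Quotient.mk_zero]

theorem rTensor_exact_balanced {f : N →ₗ[Rᵐᵒᵖ] N'} {g : N' →ₗ[Rᵐᵒᵖ] N''}
    (hfg : Function.Exact f g) (hM : IsFlatLeft R M) :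
    Function.Exact (BalancedTensor.rTensor (N := M) f) (BalancedTensor.rTensor (N := M) g) :=
  rTensor_exact_balanced_of_comp (q := g.rangeRestrict) (j := (LinearMap.range g).subtype)
    (fun y => by rw [← hfg y, Subtype.ext_iff]; rfl) g.surjective_rangeRestrict
    Subtype.val_injective hM

theorem isFaithfullyFlatLeft_of_isFlatLeft_of_isPureLeft {e : M} (hM : IsFlatLeft R M)
    (he : IsPureLeft R e) : IsFaithfullyFlatLeft R M := by
  intro N₁ N₂ N₃ _ _ _ _ _ _ _ _ _ _ _ _ f g
  refine ⟨fun h => rTensor_exact_balanced h hM, fun h y => ⟨fun hy => ?_, ?_⟩⟩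
  · obtain ⟨z, hz⟩ := (h (Submodule.Quotient.mk (y ⊗ₜ e))).1 (by
      change Submodule.Quotient.mk ((g.restrictScalars ℂ).rTensor M (y ⊗ₜ e)) = _
      simp [hy])
    obtain ⟨s, rfl⟩ := Submodule.Quotient.mk_surjective _ z
    let q := (LinearMap.range f).mkQ
    have h1 : (f.restrictScalars ℂ).rTensor M s - y ⊗ₜ e ∈ balancedRelations R N₂ M :=
      (Submodule.Quotient.eq _).1 hz
    have h2 := map_mem_of_mem_balancedRelations ((q.restrictScalars ℂ).rTensor M)
      (balancedRelations R _ M) (fun m b n => by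
        simpa using tmul_sub_tmul_mem_balancedRelations (q m) b n) h1
    have h3 : q.restrictScalars ℂ ∘ₗ f.restrictScalars ℂ = 0 := by
      ext x; exact (Submodule.Quotient.mk_eq_zero _).2 ⟨x, rfl⟩
    rw [map_sub, ← LinearMap.comp_apply, ← LinearMap.rTensor_comp, h3] at h2
    have h4 := he _ (q y) (by simpa using neg_mem h2)
    exact (Submodule.Quotient.mk_eq_zero _).1 h4
  · rintro ⟨x, rfl⟩
    refine he _ _ ((Submodule.Quotient.mk_eq_zero _).1 ?_)
    exact (h _).2 ⟨Submodule.Quotient.mk (x ⊗ₜ e), rfl⟩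

end LeftFlat

section Subalgebra

variable {A : Type u} [Ring A] [Algebra ℂ A]

/-- Left multiplication by `a` is right `B`-linear on `A`, so it turns the vanishing of `1 ⊗ n` into
that of `a ⊗ n` for every `a`. -/
theorem IsFaithfullyFlatRight.isPureRight {B : Subalgebra ℂ A} (h : IsFaithfullyFlatRight B A) :
    IsPureRight B (1 : A) := by
  intro N _ _ _ _ n hn
  refine h.eq_zero n fun a => ?_
  simpa using map_mem_of_mem_balancedRelations ((LinearMap.mulLeft ℂ a).rTensor N)
    (balancedRelations B A N) (fun m b n => by
      simpa [Subalgebra.op_smul_eq, mul_assoc] using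
        tmul_sub_tmul_mem_balancedRelations (a * m) b n) hn

end Subalgebra

/-! ### Intermediate subalgebras -/

/-! ### Multiplication operators on balanced tensor products -/

section ModuleStructure

/-- For `N ⊗_R P`, the right multiplications of `P` on the second factor. -/
def BalancedTensor.rightMulHom (R : Type*) [Ring R] [Algebra ℂ R]
    (N : Type*) [AddCommGroup N] [Module ℂ N] [Module Rᵐᵒᵖ N]
    (P : Type*) [Ring P] [Algebra ℂ P] [Module R P] [IsScalarTower R P P] :
    Pᵐᵒᵖ →+* Module.End ℂ (BalancedTensor R N P) where
  toFun p := Submodule.mapQ _ _ ((LinearMap.mulRight ℂ p.unop).lTensor N) fun _ ht =>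
    map_mem_of_mem_balancedRelations ((LinearMap.mulRight ℂ p.unop).lTensor N)
      (balancedRelations R N P) (fun m b n => by
      simpa [smul_mul_assoc] using tmul_sub_tmul_mem_balancedRelations m b (n * p.unop)) ht
  map_one' := by
    ext t
    simp
  map_mul' p q := by
    apply Submodule.linearMap_qext
    apply TensorProduct.ext'
    intro n x
    change Submodule.Quotient.mk (n ⊗ₜ (x * (q.unop * p.unop))) =
      Submodule.Quotient.mk (n ⊗ₜ ((x * q.unop) * p.unop))
    rw [mul_assoc]
  map_zero' := by
    apply Submodule.linearMap_qext
    apply TensorProduct.ext'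
    intro n x
    change (Submodule.Quotient.mk (n ⊗ₜ (x * 0)) : BalancedTensor R N P) = 0
    simp
  map_add' p q := by
    apply Submodule.linearMap_qext
    apply TensorProduct.ext'
    intro n x
    change (Submodule.Quotient.mk (n ⊗ₜ (x * (p.unop + q.unop))) : BalancedTensor R N P) =
      Submodule.Quotient.mk (n ⊗ₜ (x * p.unop) + n ⊗ₜ (x * q.unop))
    rw [mul_add, TensorProduct.tmul_add]

/-- For `P ⊗_R N`, the left multiplications of `P` on the first factor. -/
def BalancedTensor.leftMulHom (R : Type*) [Ring R] [Algebra ℂ R]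
    (N : Type*) [AddCommGroup N] [Module ℂ N] [Module R N]
    (P : Type*) [Ring P] [Algebra ℂ P] [Module Rᵐᵒᵖ P] [SMulCommClass Rᵐᵒᵖ P P] :
    P →+* Module.End ℂ (BalancedTensor R P N) where
  toFun p := Submodule.mapQ _ _ ((LinearMap.mulLeft ℂ p).rTensor N) fun _ ht =>
    map_mem_of_mem_balancedRelations ((LinearMap.mulLeft ℂ p).rTensor N)
      (balancedRelations R P N) (fun m b n => by
      have h := smul_comm (MulOpposite.op b) p m
      simp only [smul_eq_mul] at h
      simpa [h] using tmul_sub_tmul_mem_balancedRelations (p * m) b n) ht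
  map_one' := by
    ext t
    simp
  map_mul' p q := by
    apply Submodule.linearMap_qext
    apply TensorProduct.ext'
    intro x n
    change Submodule.Quotient.mk ((p * q * x) ⊗ₜ n) = Submodule.Quotient.mk ((p * (q * x)) ⊗ₜ n)
    rw [mul_assoc]
  map_zero' := by
    apply Submodule.linearMap_qext
    apply TensorProduct.ext'
    intro x n
    change (Submodule.Quotient.mk ((0 * x) ⊗ₜ n) : BalancedTensor R P N) = 0
    simp
  map_add' p q := by
    apply Submodule.linearMap_qext
    apply TensorProduct.ext'
    intro x n
    change (Submodule.Quotient.mk (((p + q) * x) ⊗ₜ n) : BalancedTensor R P N) =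
      Submodule.Quotient.mk ((p * x) ⊗ₜ n + (q * x) ⊗ₜ n)
    rw [add_mul, TensorProduct.add_tmul]

end ModuleStructure

section Intermediate

variable {A : Type u} [Ring A] [Algebra ℂ A] {B P : Subalgebra ℂ A} {B' : Subalgebra ℂ P}

instance Subalgebra.rightModule_smulCommClass (B : Subalgebra ℂ A) :
    SMulCommClass (↥B)ᵐᵒᵖ A A :=
  ⟨fun b x y => by
    induction b with
    | h b => exact mul_assoc x y (b : A)⟩

/-- A subalgebra `B ≤ P` of `A`, regarded as the subalgebra `B'` of `P`. -/
def Subalgebra.toComap (h : ∀ p : P, p ∈ B' ↔ (p : A) ∈ B) (hle : B ≤ P) : B →ₐ[ℂ] B' :=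
  (Subalgebra.inclusion hle).codRestrict B' fun b => (h _).2 b.2

/-- If `A` is pure as a left `P`-module, relations in `N ⊗ P` can be checked in `N ⊗ A`. -/
theorem mem_balancedRelations_of_lTensor_val (h : ∀ p : P, p ∈ B' ↔ (p : A) ∈ B) (hle : B ≤ P)
    (hP : IsPureLeft P (1 : A)) {N : Type u} [AddCommGroup N] [Module ℂ N] [Module (↥B')ᵐᵒᵖ N]
    [IsScalarTower ℂ (↥B')ᵐᵒᵖ N] [Module (↥B)ᵐᵒᵖ N]
    (hN : ∀ (b : B) (n : N), MulOpposite.op b • n =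
      MulOpposite.op (Subalgebra.toComap h hle b) • n)
    {t : N ⊗[ℂ] P} (ht : P.val.toLinearMap.lTensor N t ∈ balancedRelations B N A) :
    t ∈ balancedRelations B' N P := by
  -- `X` is a right `P`-module, and `n ⊗ a ↦ (n ⊗ 1) ⊗ a` maps `N ⊗_B A` to `X ⊗_P A`. On the image
  -- of `N ⊗ P` this is `x ↦ x ⊗ 1`, which purity makes injective.
  let X := BalancedTensor B' N P
  let _ : Module (↥P)ᵐᵒᵖ X := Module.compHom X (BalancedTensor.rightMulHom B' N P)
  have hsmul : ∀ (p q : P) (n : N), (MulOpposite.op p • (Submodule.Quotient.mk (n ⊗ₜ q) : X) : X) =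
      Submodule.Quotient.mk (n ⊗ₜ (q * p)) := fun _ _ _ => rfl
  have : IsScalarTower ℂ (↥P)ᵐᵒᵖ X := ⟨fun c p x => by
    obtain ⟨s, rfl⟩ := Submodule.Quotient.mk_surjective _ x
    induction p with
    | h p =>
      induction s with
      | zero => rw [Submodule.Quotient.mk_zero, smul_zero, smul_zero, smul_zero]
      | add a b ha hb =>
        rw [Submodule.Quotient.mk_add, smul_add, smul_add, smul_add, ha, hb]
      | tmul n q =>
        rw [← MulOpposite.op_smul, hsmul, hsmul, mul_smul_comm, TensorProduct.tmul_smul,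
          Submodule.Quotient.mk_smul]⟩
  let G : N →ₗ[ℂ] X := (balancedRelations B' N P).mkQ ∘ₗ (TensorProduct.mk ℂ N P).flip 1
  have hG : ∀ n, G n = Submodule.Quotient.mk (n ⊗ₜ (1 : P)) := fun _ => rfl
  have h1 := map_mem_of_mem_balancedRelations (G.rTensor A) (balancedRelations P X A)
    (fun n b a => by
      have e : G (MulOpposite.op b • n) =
          MulOpposite.op (Subalgebra.inclusion hle b) • G n := by
        rw [hG, hG, hsmul, hN]
        refine (Submodule.Quotient.eq _).2 ?_
        have := tmul_sub_tmul_mem_balancedRelations n (Subalgebra.toComap h hle b) (1 : P)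
        rw [Subalgebra.smul_def, smul_eq_mul, mul_one, ← one_mul
          ((Subalgebra.toComap h hle b : B') : P)] at this
        exact this
      have := tmul_sub_tmul_mem_balancedRelations (G n) (Subalgebra.inclusion hle b) a
      simp only [LinearMap.rTensor_tmul, e]
      exact this) ht
  have h2 : ∀ s : N ⊗[ℂ] P, G.rTensor A (P.val.toLinearMap.lTensor N s) -
      (Submodule.Quotient.mk s : X) ⊗ₜ[ℂ] (1 : A) ∈ balancedRelations P X A := by
    intro s
    induction s with
    | zero => simp
    | add a b ha hb =>
      rw [map_add, map_add, Submodule.Quotient.mk_add, TensorProduct.add_tmul, add_sub_add_comm]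
      exact add_mem ha hb
    | tmul n p =>
      have := neg_mem (tmul_sub_tmul_mem_balancedRelations (G n) p (1 : A))
      rw [neg_sub, hG, hsmul, one_mul] at this
      simpa [Subalgebra.smul_def, hG] using this
  have h3 := hP X (Submodule.Quotient.mk t) (by simpa using sub_mem h1 (h2 t))
  exact (Submodule.Quotient.mk_eq_zero _).1 h3

theorem lTensor_val_mem_balancedRelations (h : ∀ p : P, p ∈ B' ↔ (p : A) ∈ B) (hle : B ≤ P)
    {N : Type u} [AddCommGroup N] [Module ℂ N] [Module (↥B')ᵐᵒᵖ N] [Module (↥B)ᵐᵒᵖ N]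
    (hN : ∀ (b : B) (n : N), MulOpposite.op b • n =
      MulOpposite.op (Subalgebra.toComap h hle b) • n)
    {t : N ⊗[ℂ] P} (ht : t ∈ balancedRelations B' N P) :
    P.val.toLinearMap.lTensor N t ∈ balancedRelations B N A :=
  map_mem_of_mem_balancedRelations _ _ (fun n b p => by
    have := tmul_sub_tmul_mem_balancedRelations n (⟨b, (h _).1 b.2⟩ : B) (p : A)
    rw [hN] at this
    exact this) ht

/-- Relations are pushed from `P` to `A`, cancelled along `f` there by flatness over `B`, and pulled
back to `P` by purity over `P`. -/
theorem IsFlatLeft.of_intermediate (h : ∀ p : P, p ∈ B' ↔ (p : A) ∈ B) (hle : B ≤ P)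
    (hB : IsFlatLeft B A) (hP : IsPureLeft P (1 : A)) : IsFlatLeft B' P := by
  intro N N' _ _ _ _ _ _ _ _ f hf t ht
  let e : (↥B)ᵐᵒᵖ →+* (↥B')ᵐᵒᵖ := (Subalgebra.toComap h hle : B →+* B').op
  let _ : Module (↥B)ᵐᵒᵖ N := Module.compHom N e
  let _ : Module (↥B)ᵐᵒᵖ N' := Module.compHom N' e
  have : IsScalarTower ℂ (↥B)ᵐᵒᵖ N := ⟨fun c b n => by
    change e (c • b) • n = c • (e b • n)
    rw [← smul_assoc]; rfl⟩
  have : IsScalarTower ℂ (↥B)ᵐᵒᵖ N' := ⟨fun c b n => by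
    change e (c • b) • n = c • (e b • n)
    rw [← smul_assoc]; rfl⟩
  let g : N →ₗ[(↥B)ᵐᵒᵖ] N' := { f with map_smul' := fun b n => f.map_smul (e b) n }
  refine mem_balancedRelations_of_lTensor_val h hle hP (fun _ _ => rfl) ?_
  refine hB N N' g hf _ ?_
  have h1 := lTensor_val_mem_balancedRelations h hle (fun _ _ => rfl) ht
  have h2 : ∀ s : N ⊗[ℂ] P, (g.restrictScalars ℂ).rTensor A (P.val.toLinearMap.lTensor N s) =
      P.val.toLinearMap.lTensor N' ((f.restrictScalars ℂ).rTensor P s) := by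
    intro s
    induction s with
    | zero => simp
    | add a b ha hb => simp only [map_add, ha, hb]
    | tmul n p => rfl
  rw [h2]
  exact h1

theorem IsPureLeft.of_intermediate (h : ∀ p : P, p ∈ B' ↔ (p : A) ∈ B) (hle : B ≤ P)
    (hB : IsPureLeft B (1 : A)) : IsPureLeft B' (1 : P) := by
  intro N _ _ _ _ n hn
  let e : (↥B)ᵐᵒᵖ →+* (↥B')ᵐᵒᵖ := (Subalgebra.toComap h hle : B →+* B').op
  let _ : Module (↥B)ᵐᵒᵖ N := Module.compHom N e
  have : IsScalarTower ℂ (↥B)ᵐᵒᵖ N := ⟨fun c b n => by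
    change e (c • b) • n = c • (e b • n)
    rw [← smul_assoc]; rfl⟩
  exact hB N n (lTensor_val_mem_balancedRelations h hle (fun _ _ => rfl) hn)

/-- If `A` is pure as a right `P`-module, relations in `P ⊗ N` can be checked in `A ⊗ N`. -/
theorem mem_balancedRelations_of_rTensor_val (h : ∀ p : P, p ∈ B' ↔ (p : A) ∈ B) (hle : B ≤ P)
    (hP : IsPureRight P (1 : A)) {N : Type u} [AddCommGroup N] [Module ℂ N] [Module B' N]
    [IsScalarTower ℂ B' N] [Module B N]
    (hN : ∀ (b : B) (n : N), b • n = Subalgebra.toComap h hle b • n)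
    {t : P ⊗[ℂ] N} (ht : P.val.toLinearMap.rTensor N t ∈ balancedRelations B A N) :
    t ∈ balancedRelations B' P N := by
  -- Here the comparison map is `A ⊗_B N → A ⊗_P X`, `a ⊗ n ↦ a ⊗ (1 ⊗ n)`, which restricts to `x ↦
  -- 1 ⊗ x` on `P ⊗ N`.
  let X := BalancedTensor B' P N
  let _ : Module P X := Module.compHom X (BalancedTensor.leftMulHom B' N P)
  have hsmul : ∀ (p q : P) (n : N), (p • (Submodule.Quotient.mk (q ⊗ₜ n) : X) : X) =
      Submodule.Quotient.mk ((p * q) ⊗ₜ n) := fun _ _ _ => rfl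
  have : IsScalarTower ℂ P X := ⟨fun c p x => by
    obtain ⟨s, rfl⟩ := Submodule.Quotient.mk_surjective _ x
    induction s with
    | zero => rw [Submodule.Quotient.mk_zero, smul_zero, smul_zero, smul_zero]
    | add a b ha hb =>
      rw [Submodule.Quotient.mk_add, smul_add, smul_add, smul_add, ha, hb]
    | tmul q n =>
      rw [hsmul, hsmul, smul_mul_assoc, ← TensorProduct.smul_tmul', Submodule.Quotient.mk_smul]⟩
  let G : N →ₗ[ℂ] X := (balancedRelations B' P N).mkQ ∘ₗ TensorProduct.mk ℂ P N 1
  have hG : ∀ n, G n = Submodule.Quotient.mk ((1 : P) ⊗ₜ n) := fun _ => rfl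
  have h1 := map_mem_of_mem_balancedRelations (G.lTensor A) (balancedRelations P A X)
    (fun a b n => by
      have e : G (b • n) = Subalgebra.inclusion hle b • G n := by
        rw [hG, hG, hsmul, hN]
        refine ((Submodule.Quotient.eq _).2 ?_).symm
        have := tmul_sub_tmul_mem_balancedRelations (1 : P) (Subalgebra.toComap h hle b) n
        rw [Subalgebra.op_smul_eq, one_mul, ← mul_one
          ((Subalgebra.toComap h hle b : B') : P)] at this
        exact this
      have := tmul_sub_tmul_mem_balancedRelations a (Subalgebra.inclusion hle b) (G n)
      simp only [LinearMap.lTensor_tmul, e]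
      exact this) ht
  have h2 : ∀ s : P ⊗[ℂ] N, G.lTensor A (P.val.toLinearMap.rTensor N s) -
      (1 : A) ⊗ₜ[ℂ] (Submodule.Quotient.mk s : X) ∈ balancedRelations P A X := by
    intro s
    induction s with
    | zero => simp
    | add a b ha hb =>
      rw [map_add, map_add, Submodule.Quotient.mk_add, TensorProduct.tmul_add, add_sub_add_comm]
      exact add_mem ha hb
    | tmul p n =>
      have := tmul_sub_tmul_mem_balancedRelations (1 : A) p (G n)
      rw [hG, hsmul, mul_one] at this
      simpa [Subalgebra.op_smul_eq, hG] using this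
  have h3 := hP X (Submodule.Quotient.mk t) (by simpa using sub_mem h1 (h2 t))
  exact (Submodule.Quotient.mk_eq_zero _).1 h3

theorem rTensor_val_mem_balancedRelations (h : ∀ p : P, p ∈ B' ↔ (p : A) ∈ B) (hle : B ≤ P)
    {N : Type u} [AddCommGroup N] [Module ℂ N] [Module B' N] [Module B N]
    (hN : ∀ (b : B) (n : N), b • n = Subalgebra.toComap h hle b • n)
    {t : P ⊗[ℂ] N} (ht : t ∈ balancedRelations B' P N) :
    P.val.toLinearMap.rTensor N t ∈ balancedRelations B A N :=
  map_mem_of_mem_balancedRelations _ _ (fun p b n => by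
    have := tmul_sub_tmul_mem_balancedRelations (p : A) (⟨b, (h _).1 b.2⟩ : B) n
    rw [hN] at this
    exact this) ht

theorem IsFlatRight.of_intermediate (h : ∀ p : P, p ∈ B' ↔ (p : A) ∈ B) (hle : B ≤ P)
    (hB : IsFlatRight B A) (hP : IsPureRight P (1 : A)) : IsFlatRight B' P := by
  intro N N' _ _ _ _ _ _ _ _ f hf t ht
  let e : B →+* B' := Subalgebra.toComap h hle
  let _ : Module B N := Module.compHom N e
  let _ : Module B N' := Module.compHom N' e
  have : IsScalarTower ℂ B N := ⟨fun c b n => by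
    change e (c • b) • n = c • (e b • n)
    rw [← smul_assoc]; rfl⟩
  have : IsScalarTower ℂ B N' := ⟨fun c b n => by
    change e (c • b) • n = c • (e b • n)
    rw [← smul_assoc]; rfl⟩
  let g : N →ₗ[B] N' := { f with map_smul' := fun b n => f.map_smul (e b) n }
  refine mem_balancedRelations_of_rTensor_val h hle hP (fun _ _ => rfl) ?_
  refine hB N N' g hf _ ?_
  have h1 := rTensor_val_mem_balancedRelations h hle (fun _ _ => rfl) ht
  have h2 : ∀ s : P ⊗[ℂ] N, (g.restrictScalars ℂ).lTensor A (P.val.toLinearMap.rTensor N s) =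
      P.val.toLinearMap.rTensor N' ((f.restrictScalars ℂ).lTensor P s) := by
    intro s
    induction s with
    | zero => simp
    | add a b ha hb => simp only [map_add, ha, hb]
    | tmul n p => rfl
  rw [h2]
  exact h1

theorem IsPureRight.of_intermediate (h : ∀ p : P, p ∈ B' ↔ (p : A) ∈ B) (hle : B ≤ P)
    (hB : IsPureRight B (1 : A)) : IsPureRight B' (1 : P) := by
  intro N _ _ _ _ n hn
  let e : B →+* B' := Subalgebra.toComap h hle
  let _ : Module B N := Module.compHom N e
  have : IsScalarTower ℂ B N := ⟨fun c b n => by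
    change e (c • b) • n = c • (e b • n)
    rw [← smul_assoc]; rfl⟩
  exact hB N n (rTensor_val_mem_balancedRelations h hle (fun _ _ => rfl) hn)

end Intermediate

/-! ### The canonical map of a quotient Hopf algebra -/

section GaloisMap

variable {A C : Type u} [Ring A] [HopfAlgebra ℂ A] [Ring C] [HopfAlgebra ℂ C]

/-- `π : A → C` is a quotient map of Hopf algebras with kernel `B⁺A`. -/
structure IsHopfQuotient (B : Subalgebra ℂ A) (π : A →ₐ[ℂ] C) : Prop where
  surjective : Function.Surjective π
  comul_apply : ∀ a, Coalgebra.comul (R := ℂ) (π a) =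
    TensorProduct.map π.toLinearMap π.toLinearMap (Coalgebra.comul (R := ℂ) a)
  counit_apply : ∀ a, Coalgebra.counit (R := ℂ) (π a) = Coalgebra.counit (R := ℂ) a
  ker_eq : LinearMap.ker π.toLinearMap = B.augmentation * ⊤

/-- The coaction `(id ⊗ π) ∘ Δ`. -/
def coactionAlong (π : A →ₐ[ℂ] C) : A →ₐ[ℂ] A ⊗[ℂ] C :=
  (Algebra.TensorProduct.map (AlgHom.id ℂ A) π).comp (Bialgebra.comulAlgHom ℂ A)

theorem coactionAlong_apply (π : A →ₐ[ℂ] C) (a : A) :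
    coactionAlong π a = π.toLinearMap.lTensor A (Coalgebra.comul (R := ℂ) a) := rfl

theorem IsHopfQuotient.apply_eq {B : Subalgebra ℂ A} {π : A →ₐ[ℂ] C} (hπ : IsHopfQuotient B π)
    {b : A} (hb : b ∈ B) : π b = algebraMap ℂ C (Coalgebra.counit (R := ℂ) b) := by
  have h1 : b - algebraMap ℂ A (Coalgebra.counit (R := ℂ) b) ∈ LinearMap.ker π.toLinearMap := by
    rw [hπ.ker_eq, ← mul_one (b - _)]
    exact Submodule.mul_mem_mul (Subalgebra.sub_counit_mem B ⟨b, hb⟩) Submodule.mem_top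
  have h2 : π (b - algebraMap ℂ A (Coalgebra.counit (R := ℂ) b)) = 0 := h1
  rwa [map_sub, AlgHom.commutes, sub_eq_zero] at h2

/-- The second leg of `Δ(b)` lies in `B`, where `π` is the counit, so the counit axiom applies. -/
theorem coactionAlong_eq_tmul {B : Subalgebra ℂ A} {π : A →ₐ[ℂ] C} (hπ : IsHopfQuotient B π)
    [hB : IsQuantumHomogeneousSpace B] {b : A} (hb : b ∈ B) : coactionAlong π b = b ⊗ₜ 1 := by
  obtain ⟨t, ht⟩ := hB.comul_mem b hb
  have hπb : ∀ b : B, π b = algebraMap ℂ C (Coalgebra.counit (R := ℂ) (b : A)) := fun b =>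
    hπ.apply_eq b.2
  have key : ∀ t : A ⊗[ℂ] B, π.toLinearMap.lTensor A
      ((Algebra.TensorProduct.map (AlgHom.id ℂ A) B.val) t) =
      (Algebra.linearMap ℂ C).lTensor A ((Coalgebra.counit (R := ℂ) (A := A)).lTensor A
        ((Algebra.TensorProduct.map (AlgHom.id ℂ A) B.val) t)) := by
    intro t
    induction t with
    | zero => simp
    | add x y hx hy => simp only [map_add, hx, hy]
    | tmul x y => simp [hπb]
  have h1 : (Algebra.TensorProduct.map (AlgHom.id ℂ A) B.val) t = Coalgebra.comul (R := ℂ) b := ht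
  rw [coactionAlong_apply, ← h1, key, h1, Coalgebra.lTensor_counit_comul]
  simp

/-- The map `x ⊗ y ↦ x y₍₁₎ ⊗ π(y₍₂₎)`. -/
def galoisMap (π : A →ₐ[ℂ] C) : A ⊗[ℂ] A →ₗ[ℂ] A ⊗[ℂ] C :=
  (LinearMap.mul' ℂ A).rTensor C ∘ₗ (TensorProduct.assoc ℂ A A C).symm.toLinearMap ∘ₗ
    (coactionAlong π).toLinearMap.lTensor A

theorem galoisMap_tmul (π : A →ₐ[ℂ] C) (x y : A) :
    galoisMap π (x ⊗ₜ y) = (x ⊗ₜ[ℂ] (1 : C)) * coactionAlong π y := by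
  change (LinearMap.mul' ℂ A).rTensor C ((TensorProduct.assoc ℂ A A C).symm
    (x ⊗ₜ[ℂ] coactionAlong π y)) = _
  generalize coactionAlong π y = t
  induction t with
  | zero => simp
  | add a b ha hb => simp only [map_add, TensorProduct.tmul_add, mul_add, ha, hb]
  | tmul a b => simp

variable (A) in
/-- The map `x ⊗ y ↦ x S(y₍₁₎) ⊗ y₍₂₎`. -/
def translationMap : A ⊗[ℂ] A →ₗ[ℂ] A ⊗[ℂ] A :=
  (LinearMap.mul' ℂ A ∘ₗ (HopfAlgebra.antipode ℂ (A := A)).lTensor A).rTensor A ∘ₗ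
    (TensorProduct.assoc ℂ A A A).symm.toLinearMap ∘ₗ
    (Coalgebra.comul (R := ℂ) (A := A)).lTensor A

theorem translationMap_tmul (x y : A) : translationMap A (x ⊗ₜ y) =
    (x ⊗ₜ[ℂ] (1 : A)) *
      (HopfAlgebra.antipode ℂ (A := A)).rTensor A (Coalgebra.comul (R := ℂ) y) := by
  change (LinearMap.mul' ℂ A ∘ₗ (HopfAlgebra.antipode ℂ (A := A)).lTensor A).rTensor A
    ((TensorProduct.assoc ℂ A A A).symm (x ⊗ₜ[ℂ] Coalgebra.comul (R := ℂ) y)) = _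
  generalize Coalgebra.comul (R := ℂ) y = t
  induction t with
  | zero => simp
  | add a b ha hb => simp only [map_add, TensorProduct.tmul_add, mul_add, ha, hb]
  | tmul a b => simp

theorem translationMap_mul (x : A) (t : A ⊗[ℂ] A) :
    translationMap A ((x ⊗ₜ[ℂ] (1 : A)) * t) = (x ⊗ₜ[ℂ] (1 : A)) * translationMap A t := by
  induction t with
  | zero => simp
  | add a b ha hb => simp only [mul_add, map_add, ha, hb]
  | tmul a b =>
    rw [Algebra.TensorProduct.tmul_mul_tmul, one_mul, translationMap_tmul, translationMap_tmul,
      ← mul_assoc, Algebra.TensorProduct.tmul_mul_tmul, one_mul]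

theorem translationMap_comul (y : A) :
    translationMap A (Coalgebra.comul (R := ℂ) y) = 1 ⊗ₜ y := by
  change (LinearMap.mul' ℂ A ∘ₗ (HopfAlgebra.antipode ℂ (A := A)).lTensor A).rTensor A
    ((TensorProduct.assoc ℂ A A A).symm ((Coalgebra.comul (R := ℂ) (A := A)).lTensor A
      (Coalgebra.comul (R := ℂ) y))) = _
  rw [Coalgebra.coassoc_symm_apply, ← LinearMap.comp_apply, ← LinearMap.rTensor_comp,
    LinearMap.comp_assoc, HopfAlgebra.mul_antipode_lTensor_comul, LinearMap.rTensor_comp,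
    LinearMap.comp_apply, Coalgebra.rTensor_counit_comul]
  simp

/-- `π` applied to the second leg of the bijection `x ⊗ y ↦ x y₍₁₎ ⊗ y₍₂₎`. -/
theorem galoisMap_eq (π : A →ₐ[ℂ] C) (t : A ⊗[ℂ] A) :
    galoisMap π t = π.toLinearMap.lTensor A (galoisMap (AlgHom.id ℂ A) t) := by
  induction t with
  | zero => simp
  | add a b ha hb => simp only [map_add, ha, hb]
  | tmul a b =>
    rw [galoisMap_tmul, galoisMap_tmul, coactionAlong_apply, coactionAlong_apply]
    generalize Coalgebra.comul (R := ℂ) b = t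
    induction t with
    | zero => simp
    | add a b ha hb => simp only [map_add, mul_add, ha, hb]
    | tmul a b => simp

theorem galoisMap_id_tmul (x y : A) : galoisMap (AlgHom.id ℂ A) (x ⊗ₜ y) =
    (x ⊗ₜ[ℂ] (1 : A)) * Coalgebra.comul (R := ℂ) y := by
  rw [galoisMap_tmul, coactionAlong_apply]
  congr 1
  exact LinearMap.lTensor_id_apply _ _ _

/-- The case `C = A`: together with `galoisMap_translationMap`, this says that `A` is a Galois
extension of the ground field, with the inverse written out. -/
theorem translationMap_galoisMap (t : A ⊗[ℂ] A) :
    translationMap A (galoisMap (AlgHom.id ℂ A) t) = t := by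
  induction t with
  | zero => simp
  | add a b ha hb => simp only [map_add, ha, hb]
  | tmul a b =>
    rw [galoisMap_id_tmul, translationMap_mul, translationMap_comul]
    simp

theorem galoisMap_mul (π : A →ₐ[ℂ] C) (x : A) (t : A ⊗[ℂ] A) :
    galoisMap π ((x ⊗ₜ[ℂ] (1 : A)) * t) = (x ⊗ₜ[ℂ] (1 : C)) * galoisMap π t := by
  induction t with
  | zero => simp
  | add a b ha hb => simp only [mul_add, map_add, ha, hb]
  | tmul a b =>
    rw [Algebra.TensorProduct.tmul_mul_tmul, one_mul, galoisMap_tmul, galoisMap_tmul,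
      ← mul_assoc, Algebra.TensorProduct.tmul_mul_tmul, one_mul]

theorem galoisMap_antipode_comul (y : A) :
    galoisMap (AlgHom.id ℂ A) ((HopfAlgebra.antipode ℂ (A := A)).rTensor A
      (Coalgebra.comul (R := ℂ) y)) = 1 ⊗ₜ y := by
  have h1 : ∀ t : A ⊗[ℂ] A, galoisMap (AlgHom.id ℂ A)
      ((HopfAlgebra.antipode ℂ (A := A)).rTensor A t) =
      (LinearMap.mul' ℂ A ∘ₗ (HopfAlgebra.antipode ℂ (A := A)).rTensor A).rTensor A
        ((TensorProduct.assoc ℂ A A A).symm ((Coalgebra.comul (R := ℂ) (A := A)).lTensor A t)) := by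
    intro t
    induction t with
    | zero => simp
    | add a b ha hb => simp only [map_add, ha, hb]
    | tmul a b =>
      rw [LinearMap.rTensor_tmul, galoisMap_id_tmul, LinearMap.lTensor_tmul]
      generalize Coalgebra.comul (R := ℂ) b = t
      induction t with
      | zero => simp
      | add a b ha hb => simp only [map_add, mul_add, TensorProduct.tmul_add, ha, hb]
      | tmul a b => simp
  rw [h1, Coalgebra.coassoc_symm_apply, ← LinearMap.comp_apply, ← LinearMap.rTensor_comp,
    LinearMap.comp_assoc, HopfAlgebra.mul_antipode_rTensor_comul, LinearMap.rTensor_comp,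
    LinearMap.comp_apply, Coalgebra.rTensor_counit_comul]
  simp

theorem galoisMap_translationMap (t : A ⊗[ℂ] A) :
    galoisMap (AlgHom.id ℂ A) (translationMap A t) = t := by
  induction t with
  | zero => simp
  | add a b ha hb => simp only [map_add, ha, hb]
  | tmul a b =>
    rw [translationMap_tmul, galoisMap_mul, galoisMap_antipode_comul]
    simp

theorem galoisMap_surjective {π : A →ₐ[ℂ] C} (hπ : Function.Surjective π) :
    Function.Surjective (galoisMap π) := by
  intro y
  obtain ⟨s, rfl⟩ := LinearMap.lTensor_surjective A (g := π.toLinearMap) hπ y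
  exact ⟨translationMap A s, by rw [galoisMap_eq, galoisMap_translationMap]⟩

/-! ### The kernel of the Galois map -/

variable {B : Subalgebra ℂ A}

/-- The image is `a S(y₁) S(b₁) ⊗ b₂ y₂`. As `b₂` lies in `B`, it may be moved across the tensor
sign, producing `S(b₁) b₂ = ε(b) = 0`. -/
theorem translationMap_mul_mem [hB : IsQuantumHomogeneousSpace B] (a y : A) {b : A}
    (hb : b ∈ B.augmentation) :
    translationMap A (a ⊗ₜ (b * y)) ∈ balancedRelations B A A := by
  obtain ⟨t, ht, h0, -⟩ := hB.comul_sub_mem B hb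
  rw [translationMap_tmul, Bialgebra.comul_mul, ht]
  set S := HopfAlgebra.antipode ℂ (A := A)
  have key : ∀ (t : A ⊗[ℂ] B) (s : A ⊗[ℂ] A),
      (a ⊗ₜ[ℂ] (1 : A)) * S.rTensor A (Algebra.TensorProduct.map (AlgHom.id ℂ A) B.val t * s) -
      (LinearMap.mulRight ℂ (LinearMap.mul' ℂ A (S.rTensor A
        (Algebra.TensorProduct.map (AlgHom.id ℂ A) B.val t))) ∘ₗ
          LinearMap.mulLeft ℂ a ∘ₗ S).rTensor A s ∈ balancedRelations B A A := by
    intro t s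
    induction s with
    | zero => simp
    | add x y hx hy =>
      simp only [mul_add, map_add]
      rw [add_sub_add_comm]
      exact add_mem hx hy
    | tmul y z =>
      induction t with
      | zero => simp
      | add u v hu hv =>
        simp only [map_add, add_mul, mul_add, LinearMap.rTensor_tmul, LinearMap.comp_apply,
          LinearMap.mulRight_apply, TensorProduct.add_tmul] at hu hv ⊢
        rw [add_sub_add_comm]
        exact add_mem hu hv
      | tmul x b =>
        have h := neg_mem (tmul_sub_tmul_mem_balancedRelations (a * (S y * S x)) b z)
        rw [neg_sub, Subalgebra.op_smul_eq, Subalgebra.smul_def, smul_eq_mul] at h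
        simpa [S, HopfAlgebra.antipode_mul_antidistrib, mul_assoc] using h
  have h := key t (Coalgebra.comul (R := ℂ) y)
  rw [h0] at h
  simpa using h

theorem galoisMap_eq_zero_of_mem {π : A →ₐ[ℂ] C} (hπ : IsHopfQuotient B π)
    [IsQuantumHomogeneousSpace B] {t : A ⊗[ℂ] A} (ht : t ∈ balancedRelations B A A) :
    galoisMap π t = 0 := by
  refine map_mem_of_mem_balancedRelations (galoisMap π) ⊥ (fun m b n => ?_) ht
  rw [Subalgebra.op_smul_eq, Subalgebra.smul_def, smul_eq_mul, galoisMap_tmul, galoisMap_tmul,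
    map_mul, coactionAlong_eq_tmul hπ b.2, ← mul_assoc, Algebra.TensorProduct.tmul_mul_tmul,
    mul_one, sub_self]
  exact zero_mem _

/-- Up to the bijective Galois map for `C = A`, the kernel is `A ⊗ ker π = A ⊗ B⁺A`, whose preimage
is controlled by `translationMap_mul_mem`. -/
theorem mem_balancedRelations_of_galoisMap {π : A →ₐ[ℂ] C} (hπ : IsHopfQuotient B π)
    [IsQuantumHomogeneousSpace B] {t : A ⊗[ℂ] A} (ht : galoisMap π t = 0) :
    t ∈ balancedRelations B A A := by
  rw [galoisMap_eq] at ht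
  have hex : Function.Exact ((LinearMap.ker π.toLinearMap).subtype.lTensor A)
      (π.toLinearMap.lTensor A) :=
    lTensor_exact A (LinearMap.exact_subtype_ker_map _) hπ.surjective
  obtain ⟨s, hs⟩ := (hex _).1 ht
  rw [← translationMap_galoisMap t, ← hs]
  clear hs ht
  induction s with
  | zero => simp
  | add x y hx hy => rw [map_add, map_add]; exact add_mem hx hy
  | tmul a k =>
    obtain ⟨k, hk⟩ := k
    rw [LinearMap.lTensor_tmul, Submodule.subtype_apply]
    have hk' : k ∈ B.augmentation * ⊤ := hπ.ker_eq ▸ hk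
    change translationMap A (a ⊗ₜ k) ∈ _
    clear hk
    induction hk' using Submodule.mul_induction_on' with
    | mem_mul_mem b hb y _ => exact translationMap_mul_mem a y hb
    | add x hx y hy h1 h2 => rw [TensorProduct.tmul_add, map_add]; exact add_mem h1 h2

/-! ### The Galois map with coefficients in a vector space -/

variable (V : Type u) [AddCommGroup V] [Module ℂ V]

/-- The map `x ⊗ (y ⊗ v) ↦ x y₍₁₎ ⊗ (π(y₍₂₎) ⊗ v)`. -/
def galoisMapTensor (π : A →ₐ[ℂ] C) : A ⊗[ℂ] (A ⊗[ℂ] V) →ₗ[ℂ] A ⊗[ℂ] (C ⊗[ℂ] V) :=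
  (TensorProduct.assoc ℂ A C V).toLinearMap ∘ₗ (galoisMap π).rTensor V ∘ₗ
    (TensorProduct.assoc ℂ A A V).symm.toLinearMap

theorem galoisMapTensor_tmul (π : A →ₐ[ℂ] C) (x y : A) (v : V) :
    galoisMapTensor V π (x ⊗ₜ (y ⊗ₜ v)) =
      TensorProduct.assoc ℂ A C V (galoisMap π (x ⊗ₜ y) ⊗ₜ v) := rfl

theorem galoisMapTensor_surjective {π : A →ₐ[ℂ] C} (hπ : Function.Surjective π) :
    Function.Surjective (galoisMapTensor V π) :=
  (TensorProduct.assoc ℂ A C V).surjective.comp <|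
    (LinearMap.rTensor_surjective V (galoisMap_surjective hπ)).comp
      (TensorProduct.assoc ℂ A A V).symm.surjective

theorem galoisMapTensor_eq_zero_of_mem {π : A →ₐ[ℂ] C} (hπ : IsHopfQuotient B π)
    [IsQuantumHomogeneousSpace B] {t : A ⊗[ℂ] (A ⊗[ℂ] V)}
    (ht : t ∈ balancedRelations B A (A ⊗[ℂ] V)) : galoisMapTensor V π t = 0 := by
  refine map_mem_of_mem_balancedRelations (galoisMapTensor V π) ⊥ (fun m b n => ?_) ht
  rw [Submodule.mem_bot]
  induction n with
  | zero => simp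
  | add x y hx hy =>
    simp only [smul_add, TensorProduct.tmul_add, map_add]
    rw [add_sub_add_comm, hx, hy, add_zero]
  | tmul y v =>
    rw [show b • (y ⊗ₜ[ℂ] v) = (b • y) ⊗ₜ[ℂ] v from rfl, galoisMapTensor_tmul,
      galoisMapTensor_tmul, ← map_sub,
      ← TensorProduct.sub_tmul, ← map_sub, galoisMap_eq_zero_of_mem hπ
        (tmul_sub_tmul_mem_balancedRelations m b y)]
    simp

theorem mem_balancedRelations_of_galoisMapTensor {π : A →ₐ[ℂ] C} (hπ : IsHopfQuotient B π)
    [IsQuantumHomogeneousSpace B] {t : A ⊗[ℂ] (A ⊗[ℂ] V)} (ht : galoisMapTensor V π t = 0) :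
    t ∈ balancedRelations B A (A ⊗[ℂ] V) := by
  have h1 : (galoisMap π).rTensor V ((TensorProduct.assoc ℂ A A V).symm t) = 0 :=
    (TensorProduct.assoc ℂ A C V).map_eq_zero_iff.1 ht
  have hex := Module.Flat.rTensor_exact V (LinearMap.exact_subtype_ker_map (galoisMap π))
  obtain ⟨s, hs⟩ := (hex _).1 h1
  rw [← (TensorProduct.assoc ℂ A A V).apply_symm_apply t, ← hs]
  clear hs h1 ht
  induction s with
  | zero => simp
  | add x y hx hy => rw [map_add, map_add]; exact add_mem hx hy
  | tmul k v =>
    have hk : (k : A ⊗[ℂ] A) ∈ balancedRelations B A A :=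
      mem_balancedRelations_of_galoisMap hπ k.2
    exact map_mem_of_mem_balancedRelations ((TensorProduct.assoc ℂ A A V).toLinearMap ∘ₗ
      (TensorProduct.mk ℂ (A ⊗[ℂ] A) V).flip v) (balancedRelations B A (A ⊗[ℂ] V))
      (fun m b n => tmul_sub_tmul_mem_balancedRelations m b (n ⊗ₜ[ℂ] v)) hk

end GaloisMap

/-! ### Cotensor products -/

section Cotensor

variable {A C : Type u} [Ring A] [HopfAlgebra ℂ A] [Ring C] [HopfAlgebra ℂ C]

/-- A left comodule structure. -/
structure LeftComodule (C : Type*) [Ring C] [HopfAlgebra ℂ C] (V : Type*) [AddCommGroup V]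
    [Module ℂ V] where
  coact : V →ₗ[ℂ] C ⊗[ℂ] V
  coassoc : ∀ v, TensorProduct.assoc ℂ C C V
    ((Coalgebra.comul (R := ℂ) (A := C)).rTensor V (coact v)) = coact.lTensor C (coact v)
  counit : ∀ v, (Coalgebra.counit (R := ℂ) (A := C)).rTensor V (coact v) = 1 ⊗ₜ v

theorem LeftComodule.lTensor_coact_injective {V : Type*} [AddCommGroup V] [Module ℂ V]
    (v : LeftComodule C V) (W : Type*) [AddCommGroup W] [Module ℂ W] :
    Function.Injective (v.coact.lTensor W) := by
  refine Module.Flat.lTensor_preserves_injective_linearMap _ fun x y hxy => ?_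
  have h := congrArg (fun t => TensorProduct.lid ℂ V
    ((Coalgebra.counit (R := ℂ) (A := C)).rTensor V t)) hxy
  simpa [v.counit] using h

/-- The comodule on `V` with `v ↦ 1 ⊗ v`. -/
def LeftComodule.trivial (C : Type*) [Ring C] [HopfAlgebra ℂ C] (V : Type*) [AddCommGroup V]
    [Module ℂ V] : LeftComodule C V where
  coact := TensorProduct.mk ℂ C V 1
  coassoc v := by simp [Algebra.TensorProduct.one_def]
  counit v := by simp

theorem lTensor_rTensor_apply {M M' N N' : Type*} [AddCommGroup M] [Module ℂ M]
    [AddCommGroup M'] [Module ℂ M'] [AddCommGroup N] [Module ℂ N] [AddCommGroup N'] [Module ℂ N']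
    (f : M →ₗ[ℂ] M') (g : N →ₗ[ℂ] N') (t : M ⊗[ℂ] N) :
    g.lTensor M' (f.rTensor N t) = f.rTensor N' (g.lTensor M t) := by
  rw [← LinearMap.comp_apply, LinearMap.lTensor_comp_rTensor, ← LinearMap.rTensor_comp_lTensor,
    LinearMap.comp_apply]

theorem coactionAlong_counit {π : A →ₐ[ℂ] C}
    (hπ : ∀ a, Coalgebra.counit (R := ℂ) (π a) = Coalgebra.counit (R := ℂ) a) (a : A) :
    (Coalgebra.counit (R := ℂ) (A := C)).lTensor A (coactionAlong π a) = a ⊗ₜ 1 := by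
  have h : Coalgebra.counit (R := ℂ) ∘ₗ π.toLinearMap = Coalgebra.counit (R := ℂ) (A := A) :=
    LinearMap.ext hπ
  rw [coactionAlong_apply, ← LinearMap.comp_apply, ← LinearMap.lTensor_comp, h,
    Coalgebra.lTensor_counit_comul]

theorem coactionAlong_coassoc {π : A →ₐ[ℂ] C}
    (hπ : ∀ a, Coalgebra.comul (R := ℂ) (π a) =
      TensorProduct.map π.toLinearMap π.toLinearMap (Coalgebra.comul (R := ℂ) a)) (a : A) :
    TensorProduct.assoc ℂ A C C
      ((coactionAlong π).toLinearMap.rTensor C (coactionAlong π a)) =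
      (Coalgebra.comul (R := ℂ) (A := C)).lTensor A (coactionAlong π a) := by
  have h := congrArg (TensorProduct.map LinearMap.id
    (TensorProduct.map π.toLinearMap π.toLinearMap)) (Coalgebra.coassoc_apply (R := ℂ) a)
  rw [coactionAlong_apply]
  generalize Coalgebra.comul (R := ℂ) a = t at h ⊢
  convert h using 1
  · clear h
    induction t with
    | zero => simp
    | add x y hx hy => simp only [map_add, hx, hy]
    | tmul x y =>
      simp only [LinearMap.lTensor_tmul, LinearMap.rTensor_tmul, AlgHom.toLinearMap_apply,
        coactionAlong_apply]
      generalize Coalgebra.comul (R := ℂ) x = s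
      induction s with
      | zero => simp
      | add x y hx hy => simp only [map_add, TensorProduct.add_tmul, hx, hy]
      | tmul x y => simp
  · clear h
    induction t with
    | zero => simp
    | add x y hx hy => simp only [map_add, hx, hy]
    | tmul x y => simp [hπ]

/-- `δ ⊗ id - id ⊗ λ : A ⊗ V → A ⊗ C ⊗ V`. -/
def cotensorDiff (π : A →ₐ[ℂ] C) {V : Type*} [AddCommGroup V] [Module ℂ V]
    (v : LeftComodule C V) : A ⊗[ℂ] V →ₗ[ℂ] A ⊗[ℂ] (C ⊗[ℂ] V) :=
  (TensorProduct.assoc ℂ A C V).toLinearMap ∘ₗ (coactionAlong π).toLinearMap.rTensor V -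
    v.coact.lTensor A

theorem assoc_mul_tmul {V : Type*} [AddCommGroup V] [Module ℂ V] (x : A) (t : A ⊗[ℂ] C) (v : V) :
    TensorProduct.assoc ℂ A C V (((x ⊗ₜ[ℂ] (1 : C)) * t) ⊗ₜ v) =
      (LinearMap.mulLeft ℂ x).rTensor (C ⊗[ℂ] V) (TensorProduct.assoc ℂ A C V (t ⊗ₜ v)) := by
  induction t with
  | zero => simp
  | add a b ha hb => simp only [mul_add, TensorProduct.add_tmul, map_add, ha, hb]
  | tmul a b => simp

variable {B : Subalgebra ℂ A} {π : A →ₐ[ℂ] C}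
  {V : Type u} [AddCommGroup V] [Module ℂ V]

/-- Elements of `B` are coinvariant and the coaction is multiplicative. This is what makes `A □_C V`
a left `B`-module. -/
theorem cotensorDiff_smul [IsQuantumHomogeneousSpace B] (hπ : IsHopfQuotient B π)
    (v : LeftComodule C V) (b : B) (t : A ⊗[ℂ] V) :
    cotensorDiff π v (b • t) = b • cotensorDiff π v t := by
  induction t with
  | zero => simp
  | add x y hx hy => rw [smul_add, map_add, map_add, smul_add, hx, hy]
  | tmul a w =>
    rw [show b • (a ⊗ₜ[ℂ] w) = ((b : A) * a) ⊗ₜ[ℂ] w from rfl]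
    simp only [cotensorDiff, LinearMap.sub_apply, LinearMap.comp_apply, LinearMap.rTensor_tmul,
      LinearMap.lTensor_tmul, AlgHom.toLinearMap_apply, map_mul, LinearEquiv.coe_coe, smul_sub]
    rw [coactionAlong_eq_tmul hπ b.2, assoc_mul_tmul]
    rfl

/-- The cotensor product `A □_C V`, a left `B`-submodule of `A ⊗ V`. -/
def cotensor [IsQuantumHomogeneousSpace B] (hπ : IsHopfQuotient B π) (v : LeftComodule C V) :
    Submodule B (A ⊗[ℂ] V) :=
  LinearMap.ker ({ cotensorDiff π v with map_smul' := cotensorDiff_smul hπ v } :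
    A ⊗[ℂ] V →ₗ[B] A ⊗[ℂ] (C ⊗[ℂ] V))

theorem mem_cotensor [IsQuantumHomogeneousSpace B] (hπ : IsHopfQuotient B π)
    (v : LeftComodule C V) {t : A ⊗[ℂ] V} : t ∈ cotensor hπ v ↔
    TensorProduct.assoc ℂ A C V ((coactionAlong π).toLinearMap.rTensor V t) =
        v.coact.lTensor A t := sub_eq_zero

variable (A V) in
/-- `x ⊗ (a ⊗ v) ↦ x a ⊗ v`. -/
def mulTensor : A ⊗[ℂ] (A ⊗[ℂ] V) →ₗ[ℂ] A ⊗[ℂ] V :=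
  (LinearMap.mul' ℂ A).rTensor V ∘ₗ (TensorProduct.assoc ℂ A A V).symm.toLinearMap

theorem mulTensor_tmul (x : A) (t : A ⊗[ℂ] V) :
    mulTensor A V (x ⊗ₜ t) = (LinearMap.mulLeft ℂ x).rTensor V t := by
  induction t with
  | zero => simp
  | add a b ha hb => simp only [TensorProduct.tmul_add, map_add, ha, hb]
  | tmul a b => rfl

theorem galoisMapTensor_eq (x : A) (t : A ⊗[ℂ] V) : galoisMapTensor V π (x ⊗ₜ t) =
    (LinearMap.mulLeft ℂ x).rTensor (C ⊗[ℂ] V)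
      (TensorProduct.assoc ℂ A C V ((coactionAlong π).toLinearMap.rTensor V t)) := by
  induction t with
  | zero => simp
  | add a b ha hb => simp only [TensorProduct.tmul_add, map_add, ha, hb]
  | tmul a w => rw [galoisMapTensor_tmul, galoisMap_tmul, assoc_mul_tmul]; rfl

/-- The inclusion `A ⊗ (A □ V) → A ⊗ (A ⊗ V)`. -/
abbrev cotensorIncl [IsQuantumHomogeneousSpace B] (hπ : IsHopfQuotient B π)
    (v : LeftComodule C V) : A ⊗[ℂ] cotensor hπ v →ₗ[ℂ] A ⊗[ℂ] (A ⊗[ℂ] V) :=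
  ((cotensor hπ v).subtype.restrictScalars ℂ).lTensor A

/-- On `A □_C V` the coaction of `A` may be traded for that of `V`, so the Galois map only sees the
product `x a ⊗ v`. -/
theorem galoisMapTensor_cotensorIncl [IsQuantumHomogeneousSpace B] (hπ : IsHopfQuotient B π)
    (v : LeftComodule C V) (t : A ⊗[ℂ] cotensor hπ v) :
    galoisMapTensor V π (cotensorIncl hπ v t) =
      v.coact.lTensor A (mulTensor A V (cotensorIncl hπ v t)) := by
  induction t with
  | zero => simp
  | add a b ha hb => simp only [map_add, ha, hb]
  | tmul x k =>
    obtain ⟨k, hk⟩ := k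
    simp only [cotensorIncl, LinearMap.lTensor_tmul, LinearMap.coe_restrictScalars,
      Submodule.subtype_apply]
    rw [galoisMapTensor_eq, mulTensor_tmul, (mem_cotensor hπ v).1 hk, lTensor_rTensor_apply]

/-- Injectivity of `A ⊗_B (A □_C V) → A ⊗ V`: flatness embeds the source in `A ⊗_B (A ⊗ V)`, where
the Galois map is injective and factors through the product on this subspace. -/
theorem mem_balancedRelations_of_mulTensor [hB : IsQuantumHomogeneousSpace B]
    (hπ : IsHopfQuotient B π)
    (v : LeftComodule C V) (t : A ⊗[ℂ] cotensor hπ v)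
    (ht : mulTensor A V (cotensorIncl hπ v t) = 0) :
    t ∈ balancedRelations B A (cotensor hπ v) := by
  refine hB.faithfullyFlat.isFlatRight (cotensor hπ v) (A ⊗[ℂ] V) (cotensor hπ v).subtype
    Subtype.val_injective t ?_
  apply mem_balancedRelations_of_galoisMapTensor V hπ
  rw [galoisMapTensor_cotensorIncl, ht, map_zero]

/-- The Galois map carries the map defining `A □_C V`, tensored with `A`, to the next map `C ⊗ V → C
⊗ C ⊗ V` of the cobar complex of `V`. -/
theorem galoisMapTensor_cotensorDiff (hπ : IsHopfQuotient B π)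
    (v : LeftComodule C V) (t : A ⊗[ℂ] (A ⊗[ℂ] V)) :
    galoisMapTensor (C ⊗[ℂ] V) π ((cotensorDiff π v).lTensor A t) =
      ((TensorProduct.assoc ℂ C C V).toLinearMap ∘ₗ
        (Coalgebra.comul (R := ℂ) (A := C)).rTensor V - v.coact.lTensor C).lTensor A
          (galoisMapTensor V π t) := by
  induction t with
  | zero => simp
  | add a b ha hb => simp only [map_add, ha, hb]
  | tmul x t =>
    induction t with
    | zero => simp
    | add a b ha hb => simp only [map_add, TensorProduct.tmul_add, ha, hb]
    | tmul y w =>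
      rw [LinearMap.lTensor_tmul, galoisMapTensor_eq, galoisMapTensor_eq, lTensor_rTensor_apply]
      congr 1
      simp only [cotensorDiff, LinearMap.sub_apply, map_sub, LinearMap.lTensor_sub,
        LinearMap.comp_apply, LinearMap.rTensor_tmul, LinearMap.lTensor_tmul,
        LinearEquiv.coe_coe, AlgHom.toLinearMap_apply]
      congr 1
      · have h := congrArg (fun s => (TensorProduct.assoc ℂ C C V).toLinearMap.lTensor A
          (TensorProduct.assoc ℂ A (C ⊗[ℂ] C) V (s ⊗ₜ[ℂ] w))) (coactionAlong_coassoc hπ.comul_apply y)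
        generalize coactionAlong π y = s at h ⊢
        convert h using 1
        · clear h
          induction s with
          | zero => simp
          | add a b ha hb => simp only [map_add, TensorProduct.add_tmul, ha, hb]
          | tmul a c =>
            simp only [TensorProduct.assoc_tmul, LinearMap.rTensor_tmul]
            generalize (coactionAlong π).toLinearMap a = r
            induction r with
            | zero => simp
            | add a b ha hb => simp only [map_add, TensorProduct.add_tmul, ha, hb]
            | tmul a c => simp
        · clear h
          induction s with
          | zero => simp
          | add a b ha hb => simp only [map_add, TensorProduct.add_tmul, ha, hb]
          | tmul a c => simp
      · generalize coactionAlong π y = s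
        induction s with
        | zero => simp
        | add a b ha hb => simp only [map_add, TensorProduct.add_tmul, ha, hb]
        | tmul a c => simp

/-- Surjectivity of `A ⊗_B (A □_C V) → A ⊗ V`. Coassociativity makes the coaction of `s` a cobar
cocycle; a Galois preimage of it therefore lies in the kernel that flatness identifies with `A ⊗_B
(A □_C V)`. -/
theorem exists_mulTensor_eq [hB : IsQuantumHomogeneousSpace B] (hπ : IsHopfQuotient B π)
    (v : LeftComodule C V) (s : A ⊗[ℂ] V) :
    ∃ t, mulTensor A V (cotensorIncl hπ v t) = s := by
  obtain ⟨t, ht⟩ := galoisMapTensor_surjective V hπ.surjective (v.coact.lTensor A s)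
  have h1 : galoisMapTensor (C ⊗[ℂ] V) π ((cotensorDiff π v).lTensor A t) = 0 := by
    rw [galoisMapTensor_cotensorDiff hπ, ht, ← LinearMap.comp_apply, ← LinearMap.lTensor_comp]
    have : ((TensorProduct.assoc ℂ C C V).toLinearMap ∘ₗ
        (Coalgebra.comul (R := ℂ) (A := C)).rTensor V - v.coact.lTensor C) ∘ₗ v.coact = 0 := by
      ext w
      simp [v.coassoc]
    rw [this]
    simp
  have h2 := mem_balancedRelations_of_galoisMapTensor (C ⊗[ℂ] V) hπ h1
  let d : A ⊗[ℂ] V →ₗ[B] A ⊗[ℂ] (C ⊗[ℂ] V) :=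
    { cotensorDiff π v with map_smul' := cotensorDiff_smul hπ v }
  have hex : Function.Exact (cotensor hπ v).subtype d := LinearMap.exact_subtype_ker_map d
  obtain ⟨z, hz⟩ := ((hB.faithfullyFlat (cotensor hπ v) (A ⊗[ℂ] V) (A ⊗[ℂ] (C ⊗[ℂ] V))
    (cotensor hπ v).subtype d).1 hex (Submodule.Quotient.mk t)).1
    ((Submodule.Quotient.mk_eq_zero _).2 h2)
  obtain ⟨r, rfl⟩ := Submodule.Quotient.mk_surjective _ z
  have h3 : cotensorIncl hπ v r - t ∈ balancedRelations B A (A ⊗[ℂ] V) :=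
    (Submodule.Quotient.eq _).1 hz
  -- The equation may be checked after applying the coaction, where both sides are values of the
  -- Galois map.
  refine ⟨r, v.lTensor_coact_injective A ?_⟩
  rw [← galoisMapTensor_cotensorIncl, ← ht, ← sub_eq_zero, ← map_sub]
  exact galoisMapTensor_eq_zero_of_mem V hπ h3

/-- `A □_C -` preserves surjections. -/
theorem cotensor_lift [hB : IsQuantumHomogeneousSpace B] (hπ : IsHopfQuotient B π)
    (v : LeftComodule C V) {V' : Type u} [AddCommGroup V'] [Module ℂ V'] (v' : LeftComodule C V')
    (f : V →ₗ[ℂ] V') (hf : ∀ x, v'.coact (f x) = f.lTensor C (v.coact x))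
    (hsurj : Function.Surjective f) {w : A ⊗[ℂ] V'} (hw : w ∈ cotensor hπ v') :
    ∃ t ∈ cotensor hπ v, f.lTensor A t = w := by
  have hmaps : ∀ t ∈ cotensor hπ v, f.lTensor A t ∈ cotensor hπ v' := by
    intro t ht
    rw [mem_cotensor] at ht ⊢
    have h1 := congrArg ((f.lTensor C).lTensor A) ht
    have h2 : v'.coact ∘ₗ f = f.lTensor C ∘ₗ v.coact := LinearMap.ext hf
    rw [← LinearMap.comp_apply, ← LinearMap.lTensor_comp, ← h2, LinearMap.lTensor_comp,
      LinearMap.comp_apply] at h1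
    rw [← h1]
    clear h1 ht
    induction t with
    | zero => simp
    | add a b ha hb => simp only [map_add, ha, hb]
    | tmul a x =>
      simp only [LinearMap.lTensor_tmul, LinearMap.rTensor_tmul]
      generalize (coactionAlong π).toLinearMap a = s
      induction s with
      | zero => simp
      | add a b ha hb => simp only [map_add, TensorProduct.add_tmul, ha, hb]
      | tmul a c => simp
  let F : cotensor hπ v →ₗ[B] cotensor hπ v' :=
    { toFun := fun t => ⟨f.lTensor A t, hmaps t t.2⟩
      map_add' := fun x y => Subtype.ext (map_add _ _ _)
      map_smul' := fun b x => Subtype.ext (by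
        change f.lTensor A (b • (x : A ⊗[ℂ] V)) = b • f.lTensor A x
        generalize (x : A ⊗[ℂ] V) = t
        induction t with
        | zero => simp
        | add a b ha hb => rw [smul_add, map_add, map_add, smul_add, ha, hb]
        | tmul a x => rfl) }
  have hF : ∀ t, mulTensor A V' (cotensorIncl hπ v' ((F.restrictScalars ℂ).lTensor A t)) =
      f.lTensor A (mulTensor A V (cotensorIncl hπ v t)) := by
    intro t
    induction t with
    | zero => simp
    | add a b ha hb => simp only [map_add, ha, hb]
    | tmul x k =>
      simp only [cotensorIncl, LinearMap.lTensor_tmul, mulTensor_tmul]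
      rw [lTensor_rTensor_apply]
      rfl
  -- Under `A ⊗_B (A □_C V) ≅ A ⊗ V` the map `A ⊗_B F` becomes `id ⊗ f`, which is onto. Faithful
  -- flatness brings surjectivity back to `F`.
  have hsF : Function.Surjective F := by
    refine hB.faithfullyFlat.surjective (N := cotensor hπ v) (N' := cotensor hπ v') F fun z => ?_
    obtain ⟨t, rfl⟩ := Submodule.Quotient.mk_surjective _ z
    obtain ⟨s, hs⟩ := LinearMap.lTensor_surjective A hsurj
      (mulTensor A V' (cotensorIncl hπ v' t))
    obtain ⟨r, hr⟩ := exists_mulTensor_eq hπ v s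
    refine ⟨Submodule.Quotient.mk r, (Submodule.Quotient.eq _).2 ?_⟩
    apply mem_balancedRelations_of_mulTensor hπ v'
    rw [map_sub, map_sub, hF, hr, hs, sub_self]
  obtain ⟨t, ht⟩ := hsF ⟨w, hw⟩
  exact ⟨t, t.2, congrArg Subtype.val ht⟩

/-- `B` is the algebra of coinvariants of `A`. -/
theorem mem_of_coactionAlong_eq [hB : IsQuantumHomogeneousSpace B] (hπ : IsHopfQuotient B π)
    {a : A} (ha : coactionAlong π a = a ⊗ₜ 1) : a ∈ B := by
  let K : Submodule B A :=
    { carrier := {a | coactionAlong π a = a ⊗ₜ 1}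
      add_mem' := fun {x y} hx hy => by
        rw [Set.mem_ofPred_eq] at *
        rw [map_add, hx, hy, TensorProduct.add_tmul]
      zero_mem' := by simp
      smul_mem' := fun b x hx => by
        rw [Set.mem_ofPred_eq] at *
        rw [Subalgebra.smul_def, smul_eq_mul, map_mul, hx, coactionAlong_eq_tmul hπ b.2,
          Algebra.TensorProduct.tmul_mul_tmul, mul_one] }
  let ι : B →ₗ[B] K := LinearMap.toSpanSingleton B K ⟨1, by
    change coactionAlong π 1 = _
    rw [map_one]; rfl⟩
  have hgal : ∀ t : A ⊗[ℂ] K, galoisMap π ((K.subtype.restrictScalars ℂ).lTensor A t) =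
      (LinearMap.mul' ℂ A ((K.subtype.restrictScalars ℂ).lTensor A t)) ⊗ₜ 1 := by
    intro t
    induction t with
    | zero => simp
    | add a b ha hb => simp only [map_add, TensorProduct.add_tmul, ha, hb]
    | tmul x k =>
      have hk : coactionAlong π (k : A) = (k : A) ⊗ₜ 1 := k.2
      rw [LinearMap.lTensor_tmul, galoisMap_tmul]
      simp [hk]
  -- On `A ⊗_B K` the Galois map is injective and depends only on the product, so `x ⊗ k` equals `x
  -- k ⊗ 1`. Thus the inclusion of `B` into the coinvariants `K` is onto after tensoring, and so
  -- before.
  have hι : Function.Surjective ι := by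
    refine hB.faithfullyFlat.surjective ι fun z => ?_
    obtain ⟨t, rfl⟩ := Submodule.Quotient.mk_surjective _ z
    refine ⟨Submodule.Quotient.mk (LinearMap.mul' ℂ A ((K.subtype.restrictScalars ℂ).lTensor A t)
      ⊗ₜ[ℂ] (1 : B)), (Submodule.Quotient.eq _).2 ?_⟩
    refine hB.faithfullyFlat.isFlatRight _ _ K.subtype Subtype.val_injective _ ?_
    apply mem_balancedRelations_of_galoisMap hπ
    rw [map_sub, map_sub, hgal, hgal]
    simp [ι]
  obtain ⟨b, hb⟩ := hι ⟨a, ha⟩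
  have h := congrArg Subtype.val hb
  simp only [ι, LinearMap.toSpanSingleton_apply, Submodule.coe_smul] at h
  rw [← h, Subalgebra.smul_def, smul_eq_mul, mul_one]
  exact b.2

end Cotensor

/-! ### The antipode and the coproduct -/

section Antipode

variable {C : Type*} [Ring C] [HopfAlgebra ℂ C]

variable (C) in
/-- `c ⊗ d ↦ S(d) ⊗ S(c)`. -/
def antipodeSwap : C ⊗[ℂ] C →ₗ[ℂ] C ⊗[ℂ] C :=
  TensorProduct.map (HopfAlgebra.antipode ℂ) (HopfAlgebra.antipode ℂ) ∘ₗ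
    (TensorProduct.comm ℂ C C).toLinearMap

@[simp]
theorem antipodeSwap_tmul (c d : C) : antipodeSwap C (c ⊗ₜ d) =
    HopfAlgebra.antipode ℂ d ⊗ₜ HopfAlgebra.antipode ℂ c := rfl

/-- The left side is `c₁ S(c₄) ⊗ c₂ S(c₃)`; the inner pair cancels first and then the outer one. -/
theorem mul_comul_antipodeSwap (c : C) : LinearMap.mul' ℂ (C ⊗[ℂ] C)
    (TensorProduct.map (Coalgebra.comul (R := ℂ) (A := C))
      (antipodeSwap C ∘ₗ Coalgebra.comul (R := ℂ) (A := C)) (Coalgebra.comul (R := ℂ) c)) =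
      algebraMap ℂ _ (Coalgebra.counit (R := ℂ) c) := by
  set S := HopfAlgebra.antipode ℂ (A := C)
  let G : C ⊗[ℂ] (C ⊗[ℂ] C) →ₗ[ℂ] C ⊗[ℂ] C := LinearMap.mul' ℂ (C ⊗[ℂ] C) ∘ₗ
    TensorProduct.map (Coalgebra.comul (R := ℂ) (A := C)) (antipodeSwap C)
  have h1 : ∀ t : C ⊗[ℂ] C, LinearMap.mul' ℂ (C ⊗[ℂ] C)
    (TensorProduct.map (Coalgebra.comul (R := ℂ) (A := C))
      (antipodeSwap C ∘ₗ Coalgebra.comul (R := ℂ) (A := C)) t) =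
      G ((Coalgebra.comul (R := ℂ) (A := C)).lTensor C t) := by
    intro t
    induction t with
    | zero => simp
    | add a b ha hb => simp only [map_add, ha, hb]
    | tmul a b => rfl
  let K : C → C ⊗[ℂ] (C ⊗[ℂ] C) →ₗ[ℂ] C ⊗[ℂ] C := fun w =>
    TensorProduct.map (LinearMap.mulRight ℂ (S w)) (LinearMap.mul' ℂ C ∘ₗ S.lTensor C)
  have h2 : ∀ x w : C, G (TensorProduct.assoc ℂ C C C (Coalgebra.comul (R := ℂ) x ⊗ₜ w)) =
      (x * S w) ⊗ₜ 1 := by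
    intro x w
    have h3 : ∀ t : C ⊗[ℂ] C, G (TensorProduct.assoc ℂ C C C (t ⊗ₜ w)) =
        K w (TensorProduct.assoc ℂ C C C ((Coalgebra.comul (R := ℂ) (A := C)).rTensor C t)) := by
      intro t
      induction t with
      | zero => simp
      | add a b ha hb => simp only [map_add, TensorProduct.add_tmul, ha, hb]
      | tmul a b =>
        simp only [G, TensorProduct.assoc_tmul, LinearMap.comp_apply, TensorProduct.map_tmul,
          antipodeSwap_tmul, LinearMap.mul'_apply, LinearMap.rTensor_tmul]
        generalize Coalgebra.comul (R := ℂ) a = s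
        induction s with
        | zero => simp
        | add a b ha hb => simp only [map_add, TensorProduct.add_tmul, add_mul, ha, hb]
        | tmul a b => simp [K, S]
    have h4 : ∀ t : C ⊗[ℂ] C, K w ((Coalgebra.comul (R := ℂ) (A := C)).lTensor C t) =
        (TensorProduct.map (LinearMap.mulRight ℂ (S w)) (Algebra.linearMap ℂ C))
          ((Coalgebra.counit (R := ℂ) (A := C)).lTensor C t) := by
      intro t
      induction t with
      | zero => simp
      | add a b ha hb => simp only [map_add, ha, hb]
      | tmul a b =>
        simp only [K, LinearMap.lTensor_tmul, TensorProduct.map_tmul, LinearMap.comp_apply]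
        rw [HopfAlgebra.mul_antipode_lTensor_comul_apply]
        rfl
    rw [h3, Coalgebra.coassoc_apply, h4, Coalgebra.lTensor_counit_comul]
    simp
  have h5 : ∀ t : C ⊗[ℂ] C, G (TensorProduct.assoc ℂ C C C
      ((Coalgebra.comul (R := ℂ) (A := C)).rTensor C t)) =
        (LinearMap.mul' ℂ C (S.lTensor C t)) ⊗ₜ 1 := by
    intro t
    induction t with
    | zero => simp
    | add a b ha hb => simp only [map_add, TensorProduct.add_tmul, ha, hb]
    | tmul a b => rw [LinearMap.rTensor_tmul, h2]; rfl
  rw [h1, ← Coalgebra.coassoc_apply, h5, HopfAlgebra.mul_antipode_lTensor_comul_apply]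
  rfl

/-- The antipode reverses the coproduct. -/
theorem comul_antipode_eq (c : C) : Coalgebra.comul (R := ℂ) (HopfAlgebra.antipode ℂ c) =
    antipodeSwap C (Coalgebra.comul (R := ℂ) c) := by
  -- In the convolution algebra of maps `C → C ⊗ C`, `Δ ∘ S` is a left inverse of `Δ` and
  -- `antipodeSwap C ∘ Δ` is a right inverse, so they coincide.
  open WithConv in
  have h1 : toConv ((Coalgebra.comul (R := ℂ) (A := C)) ∘ₗ HopfAlgebra.antipode ℂ) *
      toConv (Coalgebra.comul (R := ℂ) (A := C)) = 1 := by
    apply ofConv_injective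
    ext x
    have h := congrArg (Bialgebra.comulAlgHom ℂ C)
      (HopfAlgebra.mul_antipode_rTensor_comul_apply (R := ℂ) x)
    rw [AlgHom.commutes] at h
    refine Eq.trans ?_ h
    change LinearMap.mul' ℂ _ (TensorProduct.map _ _ (Coalgebra.comul (R := ℂ) x)) = _
    generalize Coalgebra.comul (R := ℂ) x = t
    induction t with
    | zero => simp
    | add a b ha hb => simp only [map_add, ha, hb]
    | tmul a b => simp [Bialgebra.comulAlgHom]
  open WithConv in
  have h2 : toConv (Coalgebra.comul (R := ℂ) (A := C)) *
      toConv (antipodeSwap C ∘ₗ Coalgebra.comul (R := ℂ) (A := C)) = 1 := by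
    apply ofConv_injective
    ext x
    exact mul_comul_antipodeSwap x
  have h3 := left_inv_eq_right_inv h1 h2
  exact LinearMap.congr_fun (congrArg WithConv.ofConv h3) c

end Antipode

/-! ### Comodules: twisting and tensor products -/

section Comodule

variable {C : Type*} [Ring C] [HopfAlgebra ℂ C]

/-- A right comodule structure. -/
structure RightComodule (C : Type*) [Ring C] [HopfAlgebra ℂ C] (M : Type*) [AddCommGroup M]
    [Module ℂ M] where
  coact : M →ₗ[ℂ] M ⊗[ℂ] C
  coassoc : ∀ m, TensorProduct.assoc ℂ M C C (coact.rTensor C (coact m)) =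
    (Coalgebra.comul (R := ℂ) (A := C)).lTensor M (coact m)
  counit : ∀ m, (Coalgebra.counit (R := ℂ) (A := C)).lTensor M (coact m) = m ⊗ₜ 1

variable {M X : Type*} [AddCommGroup M] [Module ℂ M] [AddCommGroup X] [Module ℂ X]

/-- A right comodule becomes a left comodule through the antipode, `m ↦ S(m₍₁₎) ⊗ m₍₀₎`. -/
def RightComodule.twist (r : RightComodule C M) : LeftComodule C M where
  coact := (HopfAlgebra.antipode ℂ (A := C)).rTensor M ∘ₗ
    (TensorProduct.comm ℂ M C).toLinearMap ∘ₗ r.coact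
  coassoc m := by
    set S := HopfAlgebra.antipode ℂ (A := C) with hS
    let T : M ⊗[ℂ] (C ⊗[ℂ] C) →ₗ[ℂ] C ⊗[ℂ] (C ⊗[ℂ] M) :=
      (TensorProduct.assoc ℂ C C M).toLinearMap ∘ₗ (antipodeSwap C).rTensor M ∘ₗ
        (TensorProduct.comm ℂ M (C ⊗[ℂ] C)).toLinearMap
    have h := congrArg T (r.coassoc m)
    simp only [LinearMap.comp_apply, LinearEquiv.coe_coe]
    generalize r.coact m = t at h ⊢
    convert h.symm using 1
    · clear h
      induction t with
      | zero => simp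
      | add a b ha hb => simp only [map_add, ha, hb]
      | tmul m c =>
        simp only [TensorProduct.comm_tmul, LinearMap.rTensor_tmul, LinearMap.lTensor_tmul, hS,
          comul_antipode_eq]
        rfl
    · clear h
      induction t with
      | zero => simp
      | add a b ha hb => simp only [map_add, ha, hb]
      | tmul m c =>
        simp only [TensorProduct.comm_tmul, LinearMap.rTensor_tmul, LinearMap.lTensor_tmul,
          LinearMap.comp_apply, LinearEquiv.coe_coe]
        generalize r.coact m = s
        induction s with
        | zero => simp
        | add a b ha hb =>
          simp only [map_add, TensorProduct.add_tmul, TensorProduct.tmul_add, ha, hb]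
        | tmul m d => rfl
  counit m := by
    have h := congrArg (TensorProduct.comm ℂ M ℂ) (r.counit m)
    rw [TensorProduct.comm_tmul] at h
    rw [← h]
    simp only [LinearMap.comp_apply, LinearEquiv.coe_coe]
    generalize r.coact m = t
    induction t with
    | zero => simp
    | add a b ha hb => simp only [map_add, ha, hb]
    | tmul m c => simp

theorem RightComodule.twist_coact (r : RightComodule C M) (m : M) : r.twist.coact m =
    (HopfAlgebra.antipode ℂ (A := C)).rTensor M (TensorProduct.comm ℂ M C (r.coact m)) := rfl

/-- The pairing `(c ⊗ m, d ⊗ x) ↦ c d ⊗ (m ⊗ x)`. -/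
abbrev mulPairing (C M X : Type*) [Ring C] [HopfAlgebra ℂ C] [AddCommGroup M] [Module ℂ M]
    [AddCommGroup X] [Module ℂ X] : C ⊗[ℂ] M →ₗ[ℂ] C ⊗[ℂ] X →ₗ[ℂ] C ⊗[ℂ] (M ⊗[ℂ] X) :=
  TensorProduct.map₂ (LinearMap.mul ℂ C) (TensorProduct.mk ℂ M X)

/-- The tensor product of two left comodules. -/
def LeftComodule.tensor (v : LeftComodule C M) (w : LeftComodule C X) :
    LeftComodule C (M ⊗[ℂ] X) where
  coact := TensorProduct.lift ((mulPairing C M X).compl₁₂ v.coact w.coact)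
  coassoc t := by
    let L : C ⊗[ℂ] (C ⊗[ℂ] M) →ₗ[ℂ] C ⊗[ℂ] (C ⊗[ℂ] X) →ₗ[ℂ] C ⊗[ℂ] (C ⊗[ℂ] (M ⊗[ℂ] X)) :=
      TensorProduct.map₂ (LinearMap.mul ℂ C) (mulPairing C M X)
    have h1 : ∀ (s : C ⊗[ℂ] M) (r : C ⊗[ℂ] X), TensorProduct.assoc ℂ C C (M ⊗[ℂ] X)
        ((Coalgebra.comul (R := ℂ) (A := C)).rTensor _ (mulPairing C M X s r)) =
        L (TensorProduct.assoc ℂ C C M ((Coalgebra.comul (R := ℂ) (A := C)).rTensor _ s))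
          (TensorProduct.assoc ℂ C C X ((Coalgebra.comul (R := ℂ) (A := C)).rTensor _ r)) := by
      intro s r
      induction s with
      | zero => simp
      | add a b ha hb => simp only [map_add, LinearMap.add_apply, ha, hb]
      | tmul c m =>
        induction r with
        | zero => simp
        | add a b ha hb => simp only [map_add, ha, hb]
        | tmul d x =>
          simp only [mulPairing, TensorProduct.map₂_apply_tmul, TensorProduct.map_tmul,
            LinearMap.rTensor_tmul, LinearMap.mul_apply', Bialgebra.comul_mul,
            TensorProduct.mk_apply]
          generalize Coalgebra.comul (R := ℂ) c = p
          generalize Coalgebra.comul (R := ℂ) d = q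
          induction p with
          | zero => simp
          | add a b ha hb =>
            simp only [map_add, TensorProduct.add_tmul, add_mul, LinearMap.add_apply, ha, hb]
          | tmul a b =>
            induction q with
            | zero => simp
            | add a b ha hb => simp only [map_add, TensorProduct.add_tmul, mul_add, ha, hb]
            | tmul a b => simp [L]
    have h2 : ∀ (s : C ⊗[ℂ] M) (r : C ⊗[ℂ] X),
        (TensorProduct.lift ((mulPairing C M X).compl₁₂ v.coact w.coact)).lTensor C
          (mulPairing C M X s r) = L (v.coact.lTensor C s) (w.coact.lTensor C r) := by
      intro s r
      induction s with
      | zero => simp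
      | add a b ha hb => simp only [map_add, LinearMap.add_apply, ha, hb]
      | tmul c m =>
        induction r with
        | zero => simp
        | add a b ha hb => simp only [map_add, ha, hb]
        | tmul d x => simp [L]
    induction t with
    | zero => simp
    | add a b ha hb => simp only [map_add, ha, hb]
    | tmul m x =>
      rw [TensorProduct.lift.tmul, LinearMap.compl₁₂_apply, h1, h2, v.coassoc, w.coassoc]
  counit t := by
    have h : ∀ (s : C ⊗[ℂ] M) (r : C ⊗[ℂ] X),
        (Coalgebra.counit (R := ℂ) (A := C)).rTensor _ (mulPairing C M X s r) =
        TensorProduct.map₂ (LinearMap.mul ℂ ℂ) (TensorProduct.mk ℂ M X)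
          ((Coalgebra.counit (R := ℂ) (A := C)).rTensor _ s)
          ((Coalgebra.counit (R := ℂ) (A := C)).rTensor _ r) := by
      intro s r
      induction s with
      | zero => simp
      | add a b ha hb => simp only [map_add, LinearMap.add_apply, ha, hb]
      | tmul c m =>
        induction r with
        | zero => simp
        | add a b ha hb => simp only [map_add, ha, hb]
        | tmul d x => simp
    induction t with
    | zero => simp
    | add a b ha hb => simp only [map_add, TensorProduct.tmul_add, ha, hb]
    | tmul m x =>
      rw [TensorProduct.lift.tmul, LinearMap.compl₁₂_apply, h, v.counit, w.counit]
      simp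

theorem LeftComodule.tensor_coact_tmul (v : LeftComodule C M) (w : LeftComodule C X) (m : M)
    (x : X) : (v.tensor w).coact (m ⊗ₜ x) = mulPairing C M X (v.coact m) (w.coact x) := rfl

/-- Membership of `u` in `M □_C X`. -/
def IsCotensor (r : RightComodule C M) (w : LeftComodule C X) (u : M ⊗[ℂ] X) : Prop :=
  TensorProduct.assoc ℂ M C X (r.coact.rTensor X u) = w.coact.lTensor M u

/-- On `M □_C X` the coaction `S(m₍₁₎) x₍₋₁₎ ⊗ m₍₀₎ ⊗ x₍₀₎` is trivial. -/
theorem IsCotensor.coact_eq {r : RightComodule C M} {w : LeftComodule C X} {u : M ⊗[ℂ] X}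
    (hu : IsCotensor r w u) : (r.twist.tensor w).coact u = 1 ⊗ₜ u := by
  set S := HopfAlgebra.antipode ℂ (A := C) with hS
  -- `φ` is `m ⊗ c ↦ S(m₁) c ⊗ m₀`. The cotensor condition replaces `x₋₁` by one more coaction on
  -- `m`, and then `S(m₁) m₂` cancels.
  let φ : M ⊗[ℂ] C →ₗ[ℂ] C ⊗[ℂ] M := (TensorProduct.comm ℂ M C).toLinearMap ∘ₗ
    (LinearMap.mul' ℂ C ∘ₗ S.rTensor C).lTensor M ∘ₗ (TensorProduct.assoc ℂ M C C).toLinearMap ∘ₗ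
      r.coact.rTensor C
  let Φ : M ⊗[ℂ] (C ⊗[ℂ] X) →ₗ[ℂ] C ⊗[ℂ] (M ⊗[ℂ] X) := (TensorProduct.assoc ℂ C M X).toLinearMap ∘ₗ
    φ.rTensor X ∘ₗ (TensorProduct.assoc ℂ M C X).symm.toLinearMap
  have h1 : ∀ u, (r.twist.tensor w).coact u = Φ (w.coact.lTensor M u) := by
    intro u
    induction u with
    | zero => simp
    | add a b ha hb => simp only [map_add, ha, hb]
    | tmul m x =>
      rw [LeftComodule.tensor_coact_tmul, RightComodule.twist_coact, LinearMap.lTensor_tmul]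
      generalize w.coact x = s
      induction s with
      | zero => simp
      | add a b ha hb => simp only [map_add, TensorProduct.tmul_add, ha, hb]
      | tmul c x =>
        simp only [Φ, φ, LinearMap.comp_apply, LinearEquiv.coe_coe, TensorProduct.assoc_symm_tmul,
          LinearMap.rTensor_tmul]
        generalize r.coact m = t
        induction t with
        | zero => simp
        | add a b ha hb =>
          simp only [map_add, TensorProduct.add_tmul, LinearMap.add_apply, ha, hb]
        | tmul n d => simp [S]
  have h2 : ∀ m, φ (r.coact m) = 1 ⊗ₜ m := by
    intro m
    simp only [φ, LinearMap.comp_apply, LinearEquiv.coe_coe]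
    rw [r.coassoc, ← LinearMap.comp_apply (f := LinearMap.lTensor _ _), ← LinearMap.lTensor_comp,
      LinearMap.comp_assoc, hS, HopfAlgebra.mul_antipode_rTensor_comul, LinearMap.lTensor_comp,
      LinearMap.comp_apply, r.counit]
    simp
  have h3 : ∀ u, Φ (TensorProduct.assoc ℂ M C X (r.coact.rTensor X u)) = 1 ⊗ₜ u := by
    intro u
    induction u with
    | zero => simp
    | add a b ha hb => simp only [map_add, TensorProduct.tmul_add, ha, hb]
    | tmul m x =>
      simp only [Φ, LinearMap.comp_apply, LinearEquiv.coe_coe, LinearEquiv.symm_apply_apply,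
        LinearMap.rTensor_tmul, h2]
      rfl
  rw [h1, ← hu, h3]

end Comodule

/-! ### Relative Hopf modules -/

section RelHopfModule

variable {A C : Type u} [Ring A] [HopfAlgebra ℂ A] [Ring C] [HopfAlgebra ℂ C]

/-- A right `C`-comodule with a compatible right action `(m, a) ↦ act a m` of `A`. -/
structure RelHopfModule (π : A →ₐ[ℂ] C) (M : Type*) [AddCommGroup M] [Module ℂ M] extends
    RightComodule C M where
  act : A →ₗ[ℂ] M →ₗ[ℂ] M
  act_one : ∀ m, act 1 m = m
  act_mul : ∀ a b m, act (a * b) m = act b (act a m)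
  coact_act : ∀ a m, coact (act a m) =
    TensorProduct.map₂ act (LinearMap.mul ℂ C).flip (coactionAlong π a) (coact m)

variable {π : A →ₐ[ℂ] C} {M M' X X' : Type u} [AddCommGroup M] [Module ℂ M] [AddCommGroup M']
  [Module ℂ M'] [AddCommGroup X] [Module ℂ X] [AddCommGroup X'] [Module ℂ X']

/-- The action `a ⊗ (m ⊗ x) ↦ m a ⊗ x`. -/
def RelHopfModule.actTensor (r : RelHopfModule π M) (X : Type*) [AddCommGroup X] [Module ℂ X] :
    A ⊗[ℂ] (M ⊗[ℂ] X) →ₗ[ℂ] M ⊗[ℂ] X :=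
  TensorProduct.lift (LinearMap.rTensorHom X ∘ₗ r.act)

theorem RelHopfModule.actTensor_tmul (r : RelHopfModule π M) (a : A) (t : M ⊗[ℂ] X) :
    r.actTensor X (a ⊗ₜ t) = (r.act a).rTensor X t := rfl

/-- The coaction of `m a` is `m₀ a₀ ⊗ m₁ a₁`. The hypothesis trades `a₁` for `S(m₁) x₋₁`, so after
coassociativity `m₁ S(m₂)` cancels and `x₋₁` remains. -/
theorem RelHopfModule.isCotensor_actTensor (r : RelHopfModule π M) (w : LeftComodule C X)
    {t : A ⊗[ℂ] (M ⊗[ℂ] X)} (ht : TensorProduct.assoc ℂ A C (M ⊗[ℂ] X)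
      ((coactionAlong π).toLinearMap.rTensor _ t) = (r.twist.tensor w).coact.lTensor A t) :
    IsCotensor r.toRightComodule w (r.actTensor X t) := by
  set S := HopfAlgebra.antipode ℂ (A := C) with hS
  -- `κ` is `c ⊗ m ↦ m₀ ⊗ m₁ c`; it undoes the antipode twist.
  let κ : C ⊗[ℂ] M →ₗ[ℂ] M ⊗[ℂ] C := (LinearMap.mul' ℂ C).lTensor M ∘ₗ
    (TensorProduct.assoc ℂ M C C).toLinearMap ∘ₗ r.coact.rTensor C ∘ₗ
      (TensorProduct.comm ℂ C M).toLinearMap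
  let K : C ⊗[ℂ] (M ⊗[ℂ] X) →ₗ[ℂ] M ⊗[ℂ] (C ⊗[ℂ] X) := (TensorProduct.assoc ℂ M C X).toLinearMap ∘ₗ
    κ.rTensor X ∘ₗ (TensorProduct.assoc ℂ C M X).symm.toLinearMap
  let Ψ : A ⊗[ℂ] (C ⊗[ℂ] (M ⊗[ℂ] X)) →ₗ[ℂ] M ⊗[ℂ] (C ⊗[ℂ] X) := r.actTensor (C ⊗[ℂ] X) ∘ₗ
    K.lTensor A
  have h1 : ∀ t, TensorProduct.assoc ℂ M C X (r.coact.rTensor X (r.actTensor X t)) =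
      Ψ (TensorProduct.assoc ℂ A C (M ⊗[ℂ] X) ((coactionAlong π).toLinearMap.rTensor _ t)) := by
    intro t
    induction t with
    | zero => simp
    | add a b ha hb => simp only [map_add, ha, hb]
    | tmul a u =>
      induction u with
      | zero => simp
      | add a b ha hb => simp only [map_add, TensorProduct.tmul_add, ha, hb]
      | tmul m x =>
        simp only [RelHopfModule.actTensor_tmul, LinearMap.rTensor_tmul, r.coact_act,
          AlgHom.toLinearMap_apply]
        generalize coactionAlong π a = s
        induction s with
        | zero => simp
        | add a b ha hb =>
          simp only [map_add, TensorProduct.add_tmul, LinearMap.add_apply, ha, hb]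
        | tmul b c =>
          simp only [Ψ, K, κ, LinearMap.comp_apply, LinearEquiv.coe_coe, TensorProduct.assoc_tmul,
            LinearMap.lTensor_tmul, RelHopfModule.actTensor_tmul, TensorProduct.assoc_symm_tmul,
            LinearMap.rTensor_tmul, TensorProduct.comm_tmul, TensorProduct.map₂_apply_tmul]
          generalize r.coact m = q
          induction q with
          | zero => simp
          | add a b ha hb => simp only [map_add, TensorProduct.add_tmul, ha, hb]
          | tmul n d => simp
  have h2 : ∀ m, κ (r.twist.coact m) = m ⊗ₜ 1 := by
    intro m
    have h3 : ∀ q : M ⊗[ℂ] C, κ (S.rTensor M (TensorProduct.comm ℂ M C q)) =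
        (LinearMap.mul' ℂ C ∘ₗ S.lTensor C).lTensor M
          (TensorProduct.assoc ℂ M C C (r.coact.rTensor C q)) := by
      intro q
      induction q with
      | zero => simp
      | add a b ha hb => simp only [map_add, ha, hb]
      | tmul n c =>
        simp only [κ, LinearMap.comp_apply, LinearEquiv.coe_coe, TensorProduct.comm_tmul,
          LinearMap.rTensor_tmul]
        generalize r.coact n = q
        induction q with
        | zero => simp
        | add a b ha hb => simp only [map_add, TensorProduct.add_tmul, ha, hb]
        | tmul n d => simp
    rw [RightComodule.twist_coact, h3, r.coassoc, ← LinearMap.comp_apply,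
      ← LinearMap.lTensor_comp, LinearMap.comp_assoc, hS, HopfAlgebra.mul_antipode_lTensor_comul,
      LinearMap.lTensor_comp, LinearMap.comp_apply, r.counit]
    simp
  have h4 : ∀ u, K ((r.twist.tensor w).coact u) = w.coact.lTensor M u := by
    intro u
    induction u with
    | zero => simp
    | add a b ha hb => simp only [map_add, ha, hb]
    | tmul m x =>
      rw [LeftComodule.tensor_coact_tmul, LinearMap.lTensor_tmul]
      have h5 : ∀ (s : C ⊗[ℂ] M) (c : C) (x : X), K (mulPairing C M X s (c ⊗ₜ x)) =
          TensorProduct.assoc ℂ M C X (((LinearMap.mulRight ℂ c).lTensor M (κ s)) ⊗ₜ x) := by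
        intro s c x
        induction s with
        | zero => simp
        | add a b ha hb =>
          simp only [map_add, TensorProduct.add_tmul, LinearMap.add_apply, ha, hb]
        | tmul d m =>
          simp only [K, κ, mulPairing, TensorProduct.map₂_apply_tmul, TensorProduct.map_tmul,
            LinearMap.comp_apply, LinearEquiv.coe_coe, TensorProduct.mk_apply,
            LinearMap.mul_apply', TensorProduct.assoc_symm_tmul, LinearMap.rTensor_tmul,
            TensorProduct.comm_tmul]
          generalize r.coact m = q
          induction q with
          | zero => simp
          | add a b ha hb => simp only [map_add, TensorProduct.add_tmul, ha, hb]
          | tmul n d => simp [mul_assoc]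
      generalize w.coact x = q
      induction q with
      | zero => simp
      | add a b ha hb => simp only [map_add, TensorProduct.tmul_add, ha, hb]
      | tmul c x => simp [h5, h2]
  have h6 : Ψ ((r.twist.tensor w).coact.lTensor A t) = w.coact.lTensor M (r.actTensor X t) := by
    clear ht
    induction t with
    | zero => simp
    | add a b ha hb => simp only [map_add, ha, hb]
    | tmul a u =>
      simp only [Ψ, LinearMap.comp_apply, LinearMap.lTensor_tmul, h4,
        RelHopfModule.actTensor_tmul, lTensor_rTensor_apply]
  rw [IsCotensor, h1, ht, h6]

/-- `M ↦ M □_C X` on Hopf modules preserves surjections in both arguments. -/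
theorem RelHopfModule.exists_isCotensor {B : Subalgebra ℂ A} [IsQuantumHomogeneousSpace B]
    (hπ : IsHopfQuotient B π) (r : RelHopfModule π M) (r' : RelHopfModule π M')
    (w : LeftComodule C X) (w' : LeftComodule C X') (f : M →ₗ[ℂ] M') (h : X →ₗ[ℂ] X')
    (hfc : ∀ m, r'.coact (f m) = f.rTensor C (r.coact m))
    (hfa : ∀ a m, f (r.act a m) = r'.act a (f m)) (hf : Function.Surjective f)
    (hhc : ∀ x, w'.coact (h x) = h.lTensor C (w.coact x)) (hh : Function.Surjective h)
    {u : M' ⊗[ℂ] X'} (hu : IsCotensor r'.toRightComodule w' u) :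
    ∃ z : M ⊗[ℂ] X, IsCotensor r.toRightComodule w z ∧ TensorProduct.map f h z = u := by
  -- The twisted coaction is trivial on `u`, so `u` enters `A □_C (M' ⊗ X')` as `1 ⊗ u`. It is
  -- lifted there, and letting `A` act brings the lift back to `M ⊗ X`; since `1` acts as the
  -- identity, this lift maps to `u`.
  have hu' : (1 : A) ⊗ₜ[ℂ] u ∈ cotensor hπ (r'.twist.tensor w') := by
    rw [mem_cotensor, LinearMap.rTensor_tmul, LinearMap.lTensor_tmul, hu.coact_eq]
    simp [Algebra.TensorProduct.one_def]
  have hcol : ∀ t, (r'.twist.tensor w').coact (TensorProduct.map f h t) =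
      (TensorProduct.map f h).lTensor C ((r.twist.tensor w).coact t) := by
    intro t
    induction t with
    | zero => simp
    | add a b ha hb => simp only [map_add, ha, hb]
    | tmul m x =>
      rw [TensorProduct.map_tmul, LeftComodule.tensor_coact_tmul, LeftComodule.tensor_coact_tmul,
        RightComodule.twist_coact, RightComodule.twist_coact, hfc, hhc]
      generalize r.coact m = s
      generalize w.coact x = q
      induction s with
      | zero => simp
      | add a b ha hb => simp only [map_add, LinearMap.add_apply, ha, hb]
      | tmul m c =>
        induction q with
        | zero => simp
        | add a b ha hb => simp only [map_add, ha, hb]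
        | tmul d x => simp
  obtain ⟨t, ht, htu⟩ := cotensor_lift hπ (r.twist.tensor w) (r'.twist.tensor w')
    (TensorProduct.map f h) hcol (TensorProduct.map_surjective hf hh) hu'
  refine ⟨r.actTensor X t, r.isCotensor_actTensor w ((mem_cotensor hπ _).1 ht), ?_⟩
  have h1 : ∀ t, TensorProduct.map f h (r.actTensor X t) =
      r'.actTensor X' ((TensorProduct.map f h).lTensor A t) := by
    intro t
    induction t with
    | zero => simp
    | add a b ha hb => simp only [map_add, ha, hb]
    | tmul a u =>
      induction u with
      | zero => simp
      | add a b ha hb => simp only [map_add, TensorProduct.tmul_add, ha, hb]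
      | tmul m x => simp [RelHopfModule.actTensor_tmul, hfa]
  rw [h1, htu, RelHopfModule.actTensor_tmul]
  have h2 : r'.act 1 = LinearMap.id := LinearMap.ext r'.act_one
  rw [h2]
  simp

/-- Surjections of Hopf modules are surjective on coinvariants. -/
theorem RelHopfModule.exists_coinvariant {B : Subalgebra ℂ A} [IsQuantumHomogeneousSpace B]
    (hπ : IsHopfQuotient B π) (r : RelHopfModule π M) (r' : RelHopfModule π M') (f : M →ₗ[ℂ] M')
    (hfc : ∀ m, r'.coact (f m) = f.rTensor C (r.coact m))
    (hfa : ∀ a m, f (r.act a m) = r'.act a (f m)) (hf : Function.Surjective f) {m' : M'}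
    (hm' : r'.coact m' = m' ⊗ₜ 1) : ∃ m, r.coact m = m ⊗ₜ 1 ∧ f m = m' := by
  -- `C` with trivial coaction stands in for the ground field, which lives in another universe; the
  -- counit of `C` collapses the extra factor afterwards.
  obtain ⟨z, hz, hzm⟩ := r.exists_isCotensor hπ r' (LeftComodule.trivial C C)
    (LeftComodule.trivial C C) f LinearMap.id hfc hfa hf (by intro x; simp)
    Function.surjective_id (u := m' ⊗ₜ 1) (by
      rw [IsCotensor, LinearMap.rTensor_tmul, hm']; rfl)
  let e : M ⊗[ℂ] C →ₗ[ℂ] M := (TensorProduct.rid ℂ M).toLinearMap ∘ₗ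
    (Coalgebra.counit (R := ℂ) (A := C)).lTensor M
  refine ⟨e z, ?_, ?_⟩
  · have h := congrArg (((TensorProduct.rid ℂ C).toLinearMap ∘ₗ
      (Coalgebra.counit (R := ℂ) (A := C)).lTensor C).lTensor M) hz
    convert h using 1
    · clear h hz hzm
      induction z with
      | zero => simp
      | add a b ha hb => simp only [map_add, ha, hb]
      | tmul m c =>
        simp only [e, LinearMap.comp_apply, LinearMap.lTensor_tmul, LinearMap.rTensor_tmul,
          LinearEquiv.coe_coe, TensorProduct.rid_tmul, map_smul]
        generalize r.coact m = q
        induction q with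
        | zero => simp
        | add a b ha hb => simp only [map_add, TensorProduct.add_tmul, smul_add, ha, hb]
        | tmul n d => simp
    · clear h hz hzm
      induction z with
      | zero => simp
      | add a b ha hb => simp only [map_add, TensorProduct.add_tmul, ha, hb]
      | tmul m c => simp [e, LeftComodule.trivial, TensorProduct.smul_tmul]
  · have h1 : f (e z) = (TensorProduct.rid ℂ M').toLinearMap
        ((Coalgebra.counit (R := ℂ) (A := C)).lTensor M' (TensorProduct.map f LinearMap.id z)) := by
      clear hz hzm
      induction z with
      | zero => simp
      | add a b ha hb => simp only [map_add, ha, hb]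
      | tmul m c => simp [e]
    rw [h1, hzm]
    simp

/-- `A` as a left `C`-comodule. -/
def leftComoduleAlong {B : Subalgebra ℂ A} (hπ : IsHopfQuotient B π) : LeftComodule C A where
  coact := π.toLinearMap.rTensor A ∘ₗ Coalgebra.comul (R := ℂ)
  coassoc a := by
    have h := congrArg (TensorProduct.map π.toLinearMap (π.toLinearMap.rTensor A))
      (Coalgebra.coassoc_apply (R := ℂ) a)
    simp only [LinearMap.comp_apply]
    generalize Coalgebra.comul (R := ℂ) a = t at h ⊢
    convert h using 1
    · clear h
      induction t with
      | zero => simp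
      | add x y hx hy => simp only [map_add, hx, hy]
      | tmul x y =>
        simp only [LinearMap.rTensor_tmul, AlgHom.toLinearMap_apply, hπ.comul_apply]
        generalize Coalgebra.comul (R := ℂ) x = s
        induction s with
        | zero => simp
        | add x y hx hy => simp only [map_add, TensorProduct.add_tmul, hx, hy]
        | tmul x y => simp
    · clear h
      induction t with
      | zero => simp
      | add x y hx hy => simp only [map_add, hx, hy]
      | tmul x y => simp
  counit a := by
    rw [← Coalgebra.rTensor_counit_comul]
    simp only [LinearMap.comp_apply]
    generalize Coalgebra.comul (R := ℂ) a = t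
    induction t with
    | zero => simp
    | add x y hx hy => simp only [map_add, hx, hy]
    | tmul x y => simp [hπ.counit_apply]

variable (C) in
/-- `C` as a left comodule over itself. -/
def LeftComodule.regular : LeftComodule C C where
  coact := Coalgebra.comul (R := ℂ)
  coassoc := Coalgebra.coassoc_apply
  counit := Coalgebra.rTensor_counit_comul

/-- With `δ` the coaction, `1 ⊗ π(b) = (S(b₁) ⊗ 1) δ(b₂)`; multiplicativity of `δ` then lets `a₂
S(a₃)` cancel inside it. This cancellation is what makes the elements `n S(a₁)` below coinvariant.
-/
theorem mul_coactionAlong_antipode (a : A) : LinearMap.mul' ℂ (A ⊗[ℂ] C)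
    (TensorProduct.map ((Algebra.TensorProduct.includeRight (R := ℂ) (A := A)).comp π).toLinearMap
      ((coactionAlong π).toLinearMap ∘ₗ HopfAlgebra.antipode ℂ) (Coalgebra.comul (R := ℂ) a)) =
      HopfAlgebra.antipode ℂ a ⊗ₜ 1 := by
  set S := HopfAlgebra.antipode ℂ (A := A) with hS
  let F : A ⊗[ℂ] (A ⊗[ℂ] A) →ₗ[ℂ] A ⊗[ℂ] C := LinearMap.mul' ℂ (A ⊗[ℂ] C) ∘ₗ
    TensorProduct.map ((Algebra.TensorProduct.includeLeft (S := ℂ) (B := C)).toLinearMap ∘ₗ S)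
      ((coactionAlong π).toLinearMap ∘ₗ LinearMap.mul' ℂ A ∘ₗ S.lTensor A)
  have h1 : ∀ b x : A, F (TensorProduct.assoc ℂ A A A (Coalgebra.comul (R := ℂ) b ⊗ₜ x)) =
      (1 ⊗ₜ π b) * coactionAlong π (S x) := by
    intro b x
    have h2 : ∀ t : A ⊗[ℂ] A, F (TensorProduct.assoc ℂ A A A (t ⊗ₜ x)) =
        galoisMap π (S.rTensor A t) * coactionAlong π (S x) := by
      intro t
      induction t with
      | zero => simp
      | add a b ha hb => simp only [map_add, TensorProduct.add_tmul, add_mul, ha, hb]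
      | tmul a b => simp [F, galoisMap_tmul, mul_assoc]
    rw [h2, galoisMap_eq, galoisMap_antipode_comul]
    rfl
  have h3 : ∀ t : A ⊗[ℂ] A, LinearMap.mul' ℂ (A ⊗[ℂ] C) (TensorProduct.map
      ((Algebra.TensorProduct.includeRight (R := ℂ) (A := A)).comp π).toLinearMap
      ((coactionAlong π).toLinearMap ∘ₗ S) t) =
      F (TensorProduct.assoc ℂ A A A ((Coalgebra.comul (R := ℂ)).rTensor A t)) := by
    intro t
    induction t with
    | zero => simp
    | add a b ha hb => simp only [map_add, ha, hb]
    | tmul a b => rw [LinearMap.rTensor_tmul, h1]; simp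
  have h4 : ∀ t : A ⊗[ℂ] A, F ((Coalgebra.comul (R := ℂ)).lTensor A t) =
      (S (TensorProduct.rid ℂ A ((Coalgebra.counit (R := ℂ)).lTensor A t))) ⊗ₜ 1 := by
    intro t
    induction t with
    | zero => simp
    | add a b ha hb => simp only [map_add, TensorProduct.add_tmul, ha, hb]
    | tmul a b =>
      simp only [F, LinearMap.lTensor_tmul, LinearMap.comp_apply, TensorProduct.map_tmul]
      rw [hS, HopfAlgebra.mul_antipode_lTensor_comul_apply]
      simp [Algebra.algebraMap_eq_smul_one, Algebra.TensorProduct.one_def, TensorProduct.smul_tmul]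
  rw [h3, Coalgebra.coassoc_apply, h4, Coalgebra.lTensor_counit_comul]
  simp

/-- Hopf modules are generated by their coinvariants. -/
theorem RelHopfModule.mem_span_act {B : Subalgebra ℂ A} [IsQuantumHomogeneousSpace B]
    (hπ : IsHopfQuotient B π) (r : RelHopfModule π M) (m : M) :
    m ∈ Submodule.span ℂ {x | ∃ a n, r.coact n = n ⊗ₜ 1 ∧ x = r.act a n} := by
  set S := HopfAlgebra.antipode ℂ (A := A) with hS
  -- By coassociativity the coaction of `m` lies in `M □_C C`; it is lifted along `π` to `z` in `M
  -- □_C A`.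
  obtain ⟨z, hz, hzm⟩ := r.exists_isCotensor hπ r (leftComoduleAlong hπ) (LeftComodule.regular C)
    LinearMap.id π.toLinearMap (by intro x; simp) (by simp) Function.surjective_id (by
      intro a
      change Coalgebra.comul (R := ℂ) (π a) = _
      rw [hπ.comul_apply]
      simp only [leftComoduleAlong, LinearMap.comp_apply]
      rw [← LinearMap.comp_apply (f := LinearMap.lTensor _ _), LinearMap.lTensor_comp_rTensor])
    hπ.surjective (u := r.coact m) (r.coassoc m)
  -- `Y` is `n ⊗ a ↦ n S(a₁) ⊗ a₂`. Acting with the second leg on the first returns `n ε(a)`.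
  let Y : M ⊗[ℂ] A →ₗ[ℂ] M ⊗[ℂ] A := r.actTensor A ∘ₗ
    (TensorProduct.leftComm ℂ M A A).toLinearMap ∘ₗ (S.rTensor A).lTensor M ∘ₗ
      (Coalgebra.comul (R := ℂ) (A := A)).lTensor M
  have hY : ∀ (n : M) (a : A), Y (n ⊗ₜ a) =
      ((r.act.flip n) ∘ₗ S).rTensor A (Coalgebra.comul (R := ℂ) a) := by
    intro n a
    simp only [Y, LinearMap.comp_apply, LinearMap.lTensor_tmul, LinearEquiv.coe_coe]
    generalize Coalgebra.comul (R := ℂ) a = t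
    induction t with
    | zero => simp
    | add a b ha hb => simp only [map_add, TensorProduct.tmul_add, ha, hb]
    | tmul a b => simp [RelHopfModule.actTensor_tmul]
  -- the coaction on the first leg of `Y z` is trivial
  let E : A ⊗[ℂ] A →ₗ[ℂ] A ⊗[ℂ] C := LinearMap.mul' ℂ (A ⊗[ℂ] C) ∘ₗ
    TensorProduct.map ((Algebra.TensorProduct.includeRight (R := ℂ) (A := A)).comp π).toLinearMap
      ((coactionAlong π).toLinearMap ∘ₗ S)
  let Ω : M ⊗[ℂ] (C ⊗[ℂ] A) →ₗ[ℂ] (M ⊗[ℂ] C) ⊗[ℂ] A :=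
    (TensorProduct.lift (TensorProduct.map₂ r.act (LinearMap.mul ℂ C).flip) ∘ₗ
      ((coactionAlong π).toLinearMap ∘ₗ S).rTensor (M ⊗[ℂ] C)).rTensor A ∘ₗ
    (TensorProduct.assoc ℂ A (M ⊗[ℂ] C) A).symm.toLinearMap ∘ₗ
    (TensorProduct.leftComm ℂ (M ⊗[ℂ] C) A A).toLinearMap ∘ₗ
    (Coalgebra.comul (R := ℂ) (A := A)).lTensor (M ⊗[ℂ] C) ∘ₗ
    (TensorProduct.assoc ℂ M C A).symm.toLinearMap
  have hΩ : ∀ (n : M) (c : C) (a : A), Ω (n ⊗ₜ (c ⊗ₜ a)) =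
      (((TensorProduct.map₂ r.act (LinearMap.mul ℂ C).flip).flip (n ⊗ₜ c)) ∘ₗ
        (coactionAlong π).toLinearMap ∘ₗ S).rTensor A (Coalgebra.comul (R := ℂ) a) := by
    intro n c a
    simp only [Ω, LinearMap.comp_apply, TensorProduct.assoc_symm_tmul, LinearMap.lTensor_tmul,
      LinearEquiv.coe_coe]
    generalize Coalgebra.comul (R := ℂ) a = t
    induction t with
    | zero => simp
    | add a b ha hb => simp only [map_add, TensorProduct.tmul_add, ha, hb]
    | tmul a b => simp
  have h1 : ∀ z, r.coact.rTensor A (Y z) =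
      Ω (TensorProduct.assoc ℂ M C A (r.coact.rTensor A z)) := by
    intro z
    induction z with
    | zero => simp
    | add a b ha hb => simp only [map_add, ha, hb]
    | tmul n a =>
      rw [hY, LinearMap.rTensor_tmul]
      have h2 : ∀ q : M ⊗[ℂ] C, Ω (TensorProduct.assoc ℂ M C A (q ⊗ₜ a)) =
        (((TensorProduct.map₂ r.act (LinearMap.mul ℂ C).flip).flip q) ∘ₗ
          (coactionAlong π).toLinearMap ∘ₗ S).rTensor A (Coalgebra.comul (R := ℂ) a) := by
        intro q
        induction q with
        | zero => simp
        | add a b ha hb =>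
          rw [TensorProduct.add_tmul, map_add, map_add, ha, hb, map_add, LinearMap.add_comp,
            LinearMap.rTensor_add, LinearMap.add_apply]
        | tmul n c => rw [TensorProduct.assoc_tmul, hΩ]
      rw [h2, ← LinearMap.comp_apply, ← LinearMap.rTensor_comp]
      congr 2
      ext b
      simp [r.coact_act]
  have h3 : ∀ z, Ω ((leftComoduleAlong hπ).coact.lTensor M z) =
      ((TensorProduct.mk ℂ M C).flip 1).rTensor A (Y z) := by
    intro z
    induction z with
    | zero => simp
    | add a b ha hb => simp only [map_add, ha, hb]
    | tmul n a =>
      rw [hY, LinearMap.lTensor_tmul]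
      simp only [leftComoduleAlong, LinearMap.comp_apply]
      let N : A ⊗[ℂ] C →ₗ[ℂ] M ⊗[ℂ] C := (r.act.flip n).rTensor C
      have h4 : ∀ t : A ⊗[ℂ] A, Ω (n ⊗ₜ (π.toLinearMap.rTensor A t)) =
          (N ∘ₗ E).rTensor A ((TensorProduct.assoc ℂ A A A).symm
            ((Coalgebra.comul (R := ℂ)).lTensor A t)) := by
        intro t
        induction t with
        | zero => simp
        | add a b ha hb => simp only [map_add, TensorProduct.tmul_add, ha, hb]
        | tmul a b =>
          rw [LinearMap.rTensor_tmul, hΩ, LinearMap.lTensor_tmul]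
          generalize Coalgebra.comul (R := ℂ) b = s
          induction s with
          | zero => simp
          | add a b ha hb => simp only [map_add, TensorProduct.tmul_add, ha, hb]
          | tmul b c =>
            simp only [E, N, TensorProduct.assoc_symm_tmul, LinearMap.rTensor_tmul,
              LinearMap.comp_apply, TensorProduct.map_tmul, AlgHom.toLinearMap_apply,
              LinearMap.mul'_apply, AlgHom.comp_apply,
              Algebra.TensorProduct.includeRight_apply]
            congr 1
            generalize coactionAlong π (S b) = s
            induction s with
            | zero => simp
            | add a b ha hb => simp only [map_add, mul_add, ha, hb]
            | tmul b c => simp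
      have h5 : ∀ t : A ⊗[ℂ] A, (N ∘ₗ E).rTensor A ((Coalgebra.comul (R := ℂ)).rTensor A t) =
          ((TensorProduct.mk ℂ M C).flip 1).rTensor A ((r.act.flip n ∘ₗ S).rTensor A t) := by
        intro t
        induction t with
        | zero => simp
        | add a b ha hb => simp only [map_add, ha, hb]
        | tmul a b =>
          simp only [LinearMap.rTensor_tmul, LinearMap.comp_apply, E]
          rw [mul_coactionAlong_antipode]
          simp [N, S]
      rw [h4, Coalgebra.coassoc_symm_apply, h5]
  have h6 : (r.coact - (TensorProduct.mk ℂ M C).flip 1).rTensor A (Y z) = 0 := by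
    rw [LinearMap.rTensor_sub, LinearMap.sub_apply, h1, hz, h3, sub_self]
  -- Flatness over the field turns triviality of the coaction on the first leg into membership in
  -- (coinvariants of `M`) `⊗ A`.
  obtain ⟨y, hy⟩ := (Module.Flat.rTensor_exact A (LinearMap.exact_subtype_ker_map
    (r.coact - (TensorProduct.mk ℂ M C).flip 1)) _).1 h6
  -- multiplying the legs of `Y z` gives back `m`
  let μ : M ⊗[ℂ] A →ₗ[ℂ] M := TensorProduct.lift r.act.flip
  have h7 : ∀ z, μ (Y z) = TensorProduct.rid ℂ M ((Coalgebra.counit (R := ℂ)).lTensor M z) := by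
    intro z
    induction z with
    | zero => simp
    | add a b ha hb => simp only [map_add, ha, hb]
    | tmul n a =>
      have h8 : ∀ t : A ⊗[ℂ] A, μ ((r.act.flip n ∘ₗ S).rTensor A t) =
          r.act (LinearMap.mul' ℂ A (S.rTensor A t)) n := by
        intro t
        induction t with
        | zero => simp
        | add a b ha hb => simp only [map_add, LinearMap.add_apply, ha, hb]
        | tmul a b => simp [μ, r.act_mul]
      rw [hY, h8, hS, HopfAlgebra.mul_antipode_rTensor_comul_apply]
      simp [Algebra.algebraMap_eq_smul_one, r.act_one]
  have h9 : TensorProduct.rid ℂ M ((Coalgebra.counit (R := ℂ)).lTensor M z) = m := by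
    have h10 : (Coalgebra.counit (R := ℂ) (A := A)) =
        (Coalgebra.counit (R := ℂ) (A := C)) ∘ₗ π.toLinearMap :=
      LinearMap.ext fun a => (hπ.counit_apply a).symm
    rw [h10, LinearMap.lTensor_comp, LinearMap.comp_apply]
    have h11 : π.toLinearMap.lTensor M z = r.coact m := hzm
    rw [h11, r.counit]
    simp
  rw [← h9, ← h7, ← hy]
  clear hy
  induction y with
  | zero => simp
  | add a b ha hb => rw [map_add, map_add]; exact add_mem ha hb
  | tmul n a => exact Submodule.subset_span ⟨a, n, sub_eq_zero.1 n.2, rfl⟩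

end RelHopfModule

/-! ### Left flatness over a quantum homogeneous space -/

section LeftFlatness

variable {A C : Type u} [Ring A] [HopfAlgebra ℂ A] [Ring C] [HopfAlgebra ℂ C]
  {B : Subalgebra ℂ A} {π : A →ₐ[ℂ] C}

/-- The Hopf module `W ⊗ A`. -/
def RelHopfModule.free (hπ : IsHopfQuotient B π) (W : Type*) [AddCommGroup W] [Module ℂ W] :
    RelHopfModule π (W ⊗[ℂ] A) where
  coact := (TensorProduct.assoc ℂ W A C).symm.toLinearMap ∘ₗ
    (coactionAlong π).toLinearMap.lTensor W
  coassoc t := by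
    induction t with
    | zero => simp
    | add a b ha hb => simp only [map_add, ha, hb]
    | tmul w a =>
      have h := congrArg (fun t => (TensorProduct.assoc ℂ W A (C ⊗[ℂ] C)).symm (w ⊗ₜ[ℂ] t))
        (coactionAlong_coassoc hπ.comul_apply a)
      simp only [LinearMap.comp_apply, LinearMap.lTensor_tmul, AlgHom.toLinearMap_apply,
        LinearEquiv.coe_coe]
      generalize coactionAlong π a = s at h ⊢
      convert h using 1
      · clear h
        induction s with
        | zero => simp
        | add a b ha hb => simp only [map_add, TensorProduct.tmul_add, ha, hb]
        | tmul a c =>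
          simp only [TensorProduct.assoc_symm_tmul, LinearMap.rTensor_tmul,
            LinearMap.comp_apply, LinearMap.lTensor_tmul, LinearEquiv.coe_coe]
          generalize (coactionAlong π).toLinearMap a = s
          induction s with
          | zero => simp
          | add a b ha hb =>
            simp only [map_add, TensorProduct.tmul_add, TensorProduct.add_tmul, ha, hb]
          | tmul a c => simp
      · clear h
        induction s with
        | zero => simp
        | add a b ha hb => simp only [map_add, TensorProduct.tmul_add, ha, hb]
        | tmul a c => simp
  counit t := by
    induction t with
    | zero => simp
    | add a b ha hb => simp only [map_add, TensorProduct.add_tmul, ha, hb]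
    | tmul w a =>
      have h := congrArg (fun t => (TensorProduct.assoc ℂ W A ℂ).symm (w ⊗ₜ[ℂ] t))
        (coactionAlong_counit hπ.counit_apply a)
      rw [TensorProduct.assoc_symm_tmul] at h
      rw [← h]
      simp only [LinearMap.comp_apply, LinearMap.lTensor_tmul, AlgHom.toLinearMap_apply,
        LinearEquiv.coe_coe]
      generalize coactionAlong π a = s
      induction s with
      | zero => simp
      | add a b ha hb => simp only [map_add, TensorProduct.tmul_add, ha, hb]
      | tmul a c => simp
  act := LinearMap.lTensorHom W ∘ₗ (LinearMap.mul ℂ A).flip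
  act_one t := by
    have : (LinearMap.mul ℂ A).flip 1 = LinearMap.id := by ext; simp
    simp [this]
  act_mul a b t := by
    have : (LinearMap.mul ℂ A).flip (a * b) =
        (LinearMap.mul ℂ A).flip b ∘ₗ (LinearMap.mul ℂ A).flip a := by ext; simp [mul_assoc]
    simp [this, LinearMap.lTensor_comp]
  coact_act a t := by
    induction t with
    | zero => simp
    | add a b ha hb => simp only [map_add, ha, hb]
    | tmul w x =>
      simp only [LinearMap.comp_apply, LinearMap.lTensor_tmul, AlgHom.toLinearMap_apply,
        LinearEquiv.coe_coe, LinearMap.coe_lTensorHom, LinearMap.flip_apply,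
        LinearMap.mul_apply', map_mul]
      generalize coactionAlong π a = s
      generalize coactionAlong π x = q
      induction s with
      | zero => simp
      | add a b ha hb =>
        simp only [map_add, mul_add, TensorProduct.tmul_add, LinearMap.add_apply, ha, hb]
      | tmul a c =>
        induction q with
        | zero => simp
        | add a b ha hb => simp only [map_add, add_mul, TensorProduct.tmul_add, ha, hb]
        | tmul x d => simp

theorem RelHopfModule.free_coact_tmul (hπ : IsHopfQuotient B π) {W : Type*} [AddCommGroup W]
    [Module ℂ W] (w : W) (a : A) : (RelHopfModule.free hπ W).coact (w ⊗ₜ a) =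
      (TensorProduct.assoc ℂ W A C).symm (w ⊗ₜ coactionAlong π a) := rfl

theorem RelHopfModule.free_act_tmul (hπ : IsHopfQuotient B π) {W : Type*} [AddCommGroup W]
    [Module ℂ W] (w : W) (a b : A) :
    (RelHopfModule.free hπ W).act b (w ⊗ₜ a) = w ⊗ₜ (a * b) := rfl

theorem RelHopfModule.free_coact_rTensor (hπ : IsHopfQuotient B π) {W W' : Type*} [AddCommGroup W]
    [Module ℂ W] [AddCommGroup W'] [Module ℂ W'] (f : W →ₗ[ℂ] W') (t : W ⊗[ℂ] A) :
    (RelHopfModule.free hπ W').coact (f.rTensor A t) =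
      (f.rTensor A).rTensor C ((RelHopfModule.free hπ W).coact t) := by
  induction t with
  | zero => simp
  | add a b ha hb => simp only [map_add, ha, hb]
  | tmul w a =>
    rw [LinearMap.rTensor_tmul, RelHopfModule.free_coact_tmul, RelHopfModule.free_coact_tmul]
    generalize coactionAlong π a = s
    induction s with
    | zero => simp
    | add a b ha hb => simp only [map_add, TensorProduct.tmul_add, ha, hb]
    | tmul a c => simp

/-- `B` is the kernel of `a ↦ δ(a) - a ⊗ 1`, with `δ` the coaction, and tensoring with `W` over the
field preserves this kernel. -/
theorem RelHopfModule.exists_of_free_coact [IsQuantumHomogeneousSpace B]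
    (hπ : IsHopfQuotient B π) {W : Type*} [AddCommGroup W] [Module ℂ W] {t : W ⊗[ℂ] A}
    (ht : (RelHopfModule.free hπ W).coact t = t ⊗ₜ 1) :
    ∃ s : W ⊗[ℂ] B, B.val.toLinearMap.lTensor W s = t := by
  have hex : Function.Exact B.val.toLinearMap
      ((coactionAlong π).toLinearMap - (TensorProduct.mk ℂ A C).flip 1) := by
    intro a
    constructor
    · intro h
      exact ⟨⟨a, mem_of_coactionAlong_eq hπ (sub_eq_zero.1 h)⟩, rfl⟩
    · rintro ⟨b, rfl⟩
      exact sub_eq_zero.2 (coactionAlong_eq_tmul hπ b.2)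
  refine (Module.Flat.lTensor_exact W hex t).1 ?_
  rw [LinearMap.lTensor_sub, LinearMap.sub_apply, sub_eq_zero]
  have h := congrArg (TensorProduct.assoc ℂ W A C) ht
  convert h using 1
  · simp [RelHopfModule.free]
  · clear h ht
    induction t with
    | zero => simp
    | add a b ha hb => simp only [map_add, TensorProduct.add_tmul, ha, hb]
    | tmul w a => rfl

/-! ### Hopf submodules -/

variable {M : Type*} [AddCommGroup M] [Module ℂ M]

/-- The restriction of a coaction to a subspace. -/
def RelHopfModule.coactRestrict (r : RelHopfModule π M) (K : Submodule ℂ M)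
    (hK : ∀ m ∈ K, r.coact m ∈ LinearMap.range (K.subtype.rTensor C)) : K →ₗ[ℂ] K ⊗[ℂ] C :=
  (LinearEquiv.ofInjective (K.subtype.rTensor C)
    (Module.Flat.rTensor_preserves_injective_linearMap _ Subtype.val_injective)).symm.toLinearMap ∘ₗ
    (r.coact ∘ₗ K.subtype).codRestrict _ (fun k => hK k k.2)

theorem RelHopfModule.rTensor_coactRestrict (r : RelHopfModule π M) (K : Submodule ℂ M)
    (hK : ∀ m ∈ K, r.coact m ∈ LinearMap.range (K.subtype.rTensor C)) (k : K) :
    K.subtype.rTensor C (r.coactRestrict K hK k) = r.coact k := by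
  have h := congrArg Subtype.val ((LinearEquiv.ofInjective (K.subtype.rTensor C)
    (Module.Flat.rTensor_preserves_injective_linearMap _ Subtype.val_injective)).apply_symm_apply
      ((r.coact ∘ₗ K.subtype).codRestrict _ (fun k => hK k k.2) k))
  exact h

/-- A subspace stable under the action and the coaction is a Hopf module. -/
def RelHopfModule.restrict (r : RelHopfModule π M) (K : Submodule ℂ M)
    (hK : ∀ m ∈ K, r.coact m ∈ LinearMap.range (K.subtype.rTensor C))
    (hact : ∀ a, ∀ m ∈ K, r.act a m ∈ K) : RelHopfModule π K where
  coact := r.coactRestrict K hK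
  coassoc k := by
    have hinj : Function.Injective (K.subtype.rTensor (C ⊗[ℂ] C)) :=
      Module.Flat.rTensor_preserves_injective_linearMap _ Subtype.val_injective
    apply hinj
    have h := r.coassoc k
    rw [← r.rTensor_coactRestrict K hK k] at h
    generalize r.coactRestrict K hK k = t at h ⊢
    convert h using 1
    · clear h
      induction t with
      | zero => simp
      | add a b ha hb => simp only [map_add, ha, hb]
      | tmul m c =>
        simp only [LinearMap.rTensor_tmul, Submodule.subtype_apply]
        rw [← r.rTensor_coactRestrict K hK m]
        generalize r.coactRestrict K hK m = s
        induction s with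
        | zero => simp
        | add a b ha hb => simp only [map_add, TensorProduct.add_tmul, ha, hb]
        | tmul n d => simp
    · rw [lTensor_rTensor_apply]
  counit k := by
    have hinj : Function.Injective (K.subtype.rTensor ℂ) :=
      Module.Flat.rTensor_preserves_injective_linearMap _ Subtype.val_injective
    apply hinj
    rw [← lTensor_rTensor_apply, r.rTensor_coactRestrict, r.counit]
    rfl
  act := LinearMap.mk₂ ℂ (fun a k => ⟨r.act a k, hact a k k.2⟩)
    (fun a b k => Subtype.ext (by simp)) (fun c a k => Subtype.ext (by simp))
    (fun a k l => Subtype.ext (by simp)) (fun c a k => Subtype.ext (by simp))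
  act_one k := Subtype.ext (r.act_one k)
  act_mul a b k := Subtype.ext (r.act_mul a b k)
  coact_act a k := by
    have hinj : Function.Injective (K.subtype.rTensor C) :=
      Module.Flat.rTensor_preserves_injective_linearMap _ Subtype.val_injective
    apply hinj
    rw [r.rTensor_coactRestrict]
    have h := r.coact_act a k
    rw [← r.rTensor_coactRestrict K hK k] at h
    refine h.trans ?_
    generalize r.coactRestrict K hK k = t
    generalize coactionAlong π a = s
    induction s with
    | zero => simp
    | add a b ha hb => simp only [map_add, LinearMap.add_apply, ha, hb]
    | tmul a c =>
      induction t with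
      | zero => simp
      | add a b ha hb => simp only [map_add, ha, hb]
      | tmul m d => simp

/-! ### Hopf modules attached to `N ⊗_B A` -/

variable {N N' : Type u} [AddCommGroup N] [AddCommGroup N'] [Module ℂ N] [Module ℂ N']
  [Module (↥B)ᵐᵒᵖ N] [Module (↥B)ᵐᵒᵖ N']

theorem free_act_mem_balancedRelations (hπ : IsHopfQuotient B π) (a : A) {t : N ⊗[ℂ] A}
    (ht : t ∈ balancedRelations B N A) :
    (RelHopfModule.free hπ N).act a t ∈ balancedRelations B N A :=
  map_mem_of_mem_balancedRelations ((RelHopfModule.free hπ N).act a) (balancedRelations B N A)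
    (fun n b x => by
      have h := tmul_sub_tmul_mem_balancedRelations n b (x * a)
      rwa [Subalgebra.smul_def, smul_eq_mul, ← mul_assoc] at h) ht

/-- The coaction descends to `N ⊗_B A` because elements of `B` are coinvariant. -/
theorem free_coact_mkQ_eq_zero [IsQuantumHomogeneousSpace B] (hπ : IsHopfQuotient B π)
    {t : N ⊗[ℂ] A} (ht : t ∈ balancedRelations B N A) :
    (balancedRelations B N A).mkQ.rTensor C ((RelHopfModule.free hπ N).coact t) = 0 := by
  refine map_mem_of_mem_balancedRelations
    ((balancedRelations B N A).mkQ.rTensor C ∘ₗ (RelHopfModule.free hπ N).coact) ⊥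
    (fun n b x => ?_) ht
  rw [Submodule.mem_bot, sub_eq_zero]
  simp only [LinearMap.comp_apply, RelHopfModule.free_coact_tmul]
  rw [Subalgebra.smul_def, smul_eq_mul, map_mul, coactionAlong_eq_tmul hπ b.2]
  generalize coactionAlong π x = s
  induction s with
  | zero => simp
  | add a b ha hb => simp only [map_add, mul_add, TensorProduct.tmul_add, ha, hb]
  | tmul a c =>
    rw [Algebra.TensorProduct.tmul_mul_tmul, one_mul, TensorProduct.assoc_symm_tmul,
      TensorProduct.assoc_symm_tmul, LinearMap.rTensor_tmul, LinearMap.rTensor_tmul]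
    congr 1
    exact (Submodule.Quotient.eq _).2 (tmul_sub_tmul_mem_balancedRelations n b a)

/-- The kernel of `N ⊗ A → N' ⊗_B A`. -/
def balancedKer (f : N →ₗ[(↥B)ᵐᵒᵖ] N') [IsScalarTower ℂ (↥B)ᵐᵒᵖ N] [IsScalarTower ℂ (↥B)ᵐᵒᵖ N'] :
    Submodule ℂ (N ⊗[ℂ] A) :=
  LinearMap.ker ((balancedRelations B N' A).mkQ ∘ₗ (f.restrictScalars ℂ).rTensor A)

variable [IsScalarTower ℂ (↥B)ᵐᵒᵖ N] [IsScalarTower ℂ (↥B)ᵐᵒᵖ N']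

theorem mem_balancedKer (f : N →ₗ[(↥B)ᵐᵒᵖ] N') (t : N ⊗[ℂ] A) :
    t ∈ balancedKer f ↔ (f.restrictScalars ℂ).rTensor A t ∈ balancedRelations B N' A :=
  Submodule.Quotient.mk_eq_zero _

theorem free_coact_mem_range [IsQuantumHomogeneousSpace B] (hπ : IsHopfQuotient B π)
    (f : N →ₗ[(↥B)ᵐᵒᵖ] N') {t : N ⊗[ℂ] A} (ht : t ∈ balancedKer f) :
    (RelHopfModule.free hπ N).coact t ∈
      LinearMap.range ((balancedKer f).subtype.rTensor C) := by
  refine (Module.Flat.rTensor_exact C (LinearMap.exact_subtype_ker_map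
    ((balancedRelations B N' A).mkQ ∘ₗ (f.restrictScalars ℂ).rTensor A)) _).1 ?_
  rw [LinearMap.rTensor_comp, LinearMap.comp_apply, ← RelHopfModule.free_coact_rTensor]
  exact free_coact_mkQ_eq_zero hπ ((mem_balancedKer f t).1 ht)

/-- The kernel of `N ⊗ A → N' ⊗_B A` as a Hopf module. -/
def RelHopfModule.ker [IsQuantumHomogeneousSpace B] (hπ : IsHopfQuotient B π)
    (f : N →ₗ[(↥B)ᵐᵒᵖ] N') : RelHopfModule π (balancedKer f) :=
  (RelHopfModule.free hπ N).restrict (balancedKer f)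
    (fun _ ht => free_coact_mem_range hπ f ht)
    (fun a t ht => by
      rw [mem_balancedKer] at ht ⊢
      convert free_act_mem_balancedRelations hπ a ht using 1
      exact (lTensor_rTensor_apply _ _ _).symm)

theorem RelHopfModule.rTensor_ker_coact [IsQuantumHomogeneousSpace B] (hπ : IsHopfQuotient B π)
    (f : N →ₗ[(↥B)ᵐᵒᵖ] N') (k : balancedKer f) :
    (balancedKer f).subtype.rTensor C ((RelHopfModule.ker hπ f).coact k) =
      (RelHopfModule.free hπ N).coact k :=
  RelHopfModule.rTensor_coactRestrict _ _ (fun _ ht => free_coact_mem_range hπ f ht) k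

theorem RelHopfModule.coe_ker_act [IsQuantumHomogeneousSpace B] (hπ : IsHopfQuotient B π)
    (f : N →ₗ[(↥B)ᵐᵒᵖ] N') (a : A) (k : balancedKer f) :
    ((RelHopfModule.ker hπ f).act a k : N ⊗[ℂ] A) = (RelHopfModule.free hπ N).act a k := rfl

variable (B N) in
/-- The action `N ⊗ B → N`. -/
def rightActionMap : N ⊗[ℂ] B →ₗ[ℂ] N :=
  TensorProduct.lift (LinearMap.mk₂ ℂ (fun n (b : B) => MulOpposite.op b • n)
    (fun n n' b => smul_add _ _ _) (fun c n b => smul_algebra_smul_comm _ _ _)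
    (fun n b b' => add_smul _ _ _)
    (fun c n b => by rw [MulOpposite.op_smul, smul_assoc]))

theorem rightActionMap_tmul (n : N) (b : B) :
    rightActionMap B N (n ⊗ₜ b) = MulOpposite.op b • n := rfl

/-- The map `N ⊗ B → N` factors through `N ⊗_B A`. -/
theorem rightActionMap_eq_zero [IsQuantumHomogeneousSpace B] (hπ : IsHopfQuotient B π)
    {y : N ⊗[ℂ] B} (hy : B.val.toLinearMap.lTensor N y ∈ balancedRelations B N A) :
    rightActionMap B N y = 0 := by
  -- `J` is the space of relations itself, seen as a Hopf submodule of `N ⊗ A`. It is the image of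
  -- `φ`, a map of Hopf modules out of the free module `(N ⊗ B) ⊗ A`.
  let J := balancedKer (LinearMap.id : N →ₗ[(↥B)ᵐᵒᵖ] N)
  have hJ : ∀ t, t ∈ J ↔ t ∈ balancedRelations B N A := fun t => by
    rw [mem_balancedKer]
    have : (LinearMap.id : N →ₗ[(↥B)ᵐᵒᵖ] N).restrictScalars ℂ = LinearMap.id := rfl
    rw [this, LinearMap.rTensor_id, LinearMap.id_apply]
  let φ : (N ⊗[ℂ] B) ⊗[ℂ] A →ₗ[ℂ] N ⊗[ℂ] A := (rightActionMap B N).rTensor A -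
    (LinearMap.mul' ℂ A ∘ₗ B.val.toLinearMap.rTensor A).lTensor N ∘ₗ
      (TensorProduct.assoc ℂ N B A).toLinearMap
  have hφ : ∀ (n : N) (b : B) (a : A), φ ((n ⊗ₜ b) ⊗ₜ a) =
      (MulOpposite.op b • n) ⊗ₜ a - n ⊗ₜ (b • a) := fun _ _ _ => rfl
  have hφJ : ∀ t, φ t ∈ J := by
    intro t
    rw [hJ]
    induction t with
    | zero => simp
    | add a b ha hb => rw [map_add]; exact add_mem ha hb
    | tmul y a =>
      induction y with
      | zero => simp
      | add a b ha hb => rw [TensorProduct.add_tmul, map_add]; exact add_mem ha hb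
      | tmul n b => rw [hφ]; exact tmul_sub_tmul_mem_balancedRelations n b a
  have hsurj : Function.Surjective (φ.codRestrict J hφJ) := by
    rintro ⟨t, ht⟩
    have hle : balancedRelations B N A ≤ LinearMap.range φ := by
      rw [balancedRelations, Submodule.span_le]
      rintro _ ⟨n, b, a, rfl⟩
      exact ⟨(n ⊗ₜ b) ⊗ₜ a, hφ n b a⟩
    obtain ⟨s, hs⟩ := hle ((hJ t).1 ht)
    exact ⟨s, Subtype.ext hs⟩
  have hφc : ∀ t, (RelHopfModule.free hπ N).coact (φ t) =
      φ.rTensor C ((RelHopfModule.free hπ (N ⊗[ℂ] B)).coact t) := by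
    intro t
    induction t with
    | zero => simp
    | add a b ha hb => simp only [map_add, ha, hb]
    | tmul y a =>
      induction y with
      | zero => simp
      | add a b ha hb => simp only [map_add, TensorProduct.add_tmul, ha, hb]
      | tmul n b =>
        rw [hφ, map_sub, RelHopfModule.free_coact_tmul, RelHopfModule.free_coact_tmul,
          RelHopfModule.free_coact_tmul, Subalgebra.smul_def, smul_eq_mul, map_mul,
          coactionAlong_eq_tmul hπ b.2]
        generalize coactionAlong π a = s
        induction s with
        | zero => simp
        | add a b ha hb =>
          simp only [map_add, TensorProduct.tmul_add, mul_add, ← ha, ← hb]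
          abel
        | tmul a c =>
          rw [Algebra.TensorProduct.tmul_mul_tmul, one_mul, TensorProduct.assoc_symm_tmul,
            TensorProduct.assoc_symm_tmul, TensorProduct.assoc_symm_tmul, LinearMap.rTensor_tmul,
            hφ, TensorProduct.sub_tmul]
          rfl
  have hinj : Function.Injective (J.subtype.rTensor C) :=
    Module.Flat.rTensor_preserves_injective_linearMap _ Subtype.val_injective
  have hyc : (RelHopfModule.free hπ N).coact (B.val.toLinearMap.lTensor N y) =
      (B.val.toLinearMap.lTensor N y) ⊗ₜ 1 := by
    clear hy
    induction y with
    | zero => simp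
    | add a b ha hb => simp only [map_add, TensorProduct.add_tmul, ha, hb]
    | tmul n b =>
      rw [LinearMap.lTensor_tmul, RelHopfModule.free_coact_tmul]
      exact congrArg _ (congrArg (n ⊗ₜ[ℂ] ·) (coactionAlong_eq_tmul hπ b.2))
  -- The image of `y` is a coinvariant of `J`, so it lifts to a coinvariant of the free module, that
  -- is, to an element of `(N ⊗ B) ⊗ B`.
  obtain ⟨t, htc, hty⟩ := (RelHopfModule.free hπ (N ⊗[ℂ] B)).exists_coinvariant hπ
    (RelHopfModule.ker hπ (LinearMap.id : N →ₗ[(↥B)ᵐᵒᵖ] N)) (φ.codRestrict J hφJ)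
    (fun t => by
      apply hinj
      rw [RelHopfModule.rTensor_ker_coact, ← LinearMap.comp_apply (LinearMap.rTensor C _),
        ← LinearMap.rTensor_comp]
      exact hφc t)
    (fun a t => by
      apply Subtype.ext
      rw [RelHopfModule.coe_ker_act]
      change φ _ = (RelHopfModule.free hπ N).act a (φ t)
      induction t with
      | zero => simp
      | add x y hx hy => simp only [map_add, hx, hy]
      | tmul y x =>
        induction y with
        | zero => simp
        | add x y hx hy => simp only [map_add, TensorProduct.add_tmul, hx, hy]
        | tmul n b =>
          rw [RelHopfModule.free_act_tmul, hφ, hφ, map_sub, RelHopfModule.free_act_tmul,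
            RelHopfModule.free_act_tmul, smul_mul_assoc])
    hsurj (m' := ⟨B.val.toLinearMap.lTensor N y, (hJ _).2 hy⟩) (by
      apply hinj
      rw [RelHopfModule.rTensor_ker_coact]
      exact hyc)
  obtain ⟨s, hs⟩ := RelHopfModule.exists_of_free_coact hπ htc
  have hφy : φ t = B.val.toLinearMap.lTensor N y := congrArg Subtype.val hty
  -- `ψ` is `φ` with `B` in place of `A`. So `y` is a combination of relations over `B`, which the
  -- action kills by associativity.
  let ψ : (N ⊗[ℂ] B) ⊗[ℂ] B →ₗ[ℂ] N ⊗[ℂ] B := (rightActionMap B N).rTensor B -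
    (LinearMap.mul' ℂ B).lTensor N ∘ₗ (TensorProduct.assoc ℂ N B B).toLinearMap
  have hψ : ∀ s, B.val.toLinearMap.lTensor N (ψ s) =
      φ (B.val.toLinearMap.lTensor (N ⊗[ℂ] B) s) := by
    intro s
    induction s with
    | zero => simp
    | add a b ha hb => simp only [map_add, ha, hb]
    | tmul y b =>
      induction y with
      | zero => simp
      | add a b ha hb => simp only [map_add, TensorProduct.add_tmul, ha, hb]
      | tmul n b' =>
        change B.val.toLinearMap.lTensor N ((MulOpposite.op b' • n) ⊗ₜ b - n ⊗ₜ (b' * b)) = _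
        rw [map_sub]
        rfl
  have hψ0 : ∀ s, rightActionMap B N (ψ s) = 0 := by
    intro s
    induction s with
    | zero => simp
    | add a b ha hb => simp only [map_add, ha, hb, add_zero]
    | tmul y b =>
      induction y with
      | zero => simp
      | add a b ha hb => simp only [map_add, TensorProduct.add_tmul, ha, hb, add_zero]
      | tmul n b' =>
        change rightActionMap B N ((MulOpposite.op b' • n) ⊗ₜ b - n ⊗ₜ (b' * b)) = 0
        rw [map_sub, rightActionMap_tmul, rightActionMap_tmul, MulOpposite.op_mul, mul_smul,
          sub_self]
  have hval : Function.Injective (B.val.toLinearMap.lTensor N) :=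
    Module.Flat.lTensor_preserves_injective_linearMap _ Subtype.val_injective
  rw [← hval (show _ = B.val.toLinearMap.lTensor N y by rw [hψ s, hs, hφy]), hψ0]

theorem isPureLeft_of_isHopfQuotient [IsQuantumHomogeneousSpace B] (hπ : IsHopfQuotient B π) :
    IsPureLeft B (1 : A) := by
  intro N _ _ _ _ n hn
  have h := rightActionMap_eq_zero hπ (y := n ⊗ₜ[ℂ] (1 : B)) hn
  rwa [rightActionMap_tmul, MulOpposite.op_one, one_smul] at h

/-- The kernel of `N ⊗ A → N' ⊗_B A` is a Hopf module, so it is generated by its coinvariants, and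
these come from `N ⊗ B`. For such an element, multiplying out gives something in `N` that `f` kills,
hence zero; modulo relations the element is this product tensored with `1`. -/
theorem isFlatLeft_of_isHopfQuotient [IsQuantumHomogeneousSpace B] (hπ : IsHopfQuotient B π) :
    IsFlatLeft B A := by
  intro N N' _ _ _ _ _ _ _ _ f hf t ht
  have hspan := (RelHopfModule.ker hπ f).mem_span_act hπ ⟨t, (mem_balancedKer f t).2 ht⟩
  suffices Submodule.span ℂ {x | ∃ a n, (RelHopfModule.ker hπ f).coact n = n ⊗ₜ 1 ∧
      x = (RelHopfModule.ker hπ f).act a n} ≤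
      (balancedRelations B N A).comap (balancedKer f).subtype from this hspan
  rw [Submodule.span_le]
  rintro _ ⟨a, k, hk, rfl⟩
  change ((RelHopfModule.ker hπ f).act a k : N ⊗[ℂ] A) ∈ balancedRelations B N A
  rw [RelHopfModule.coe_ker_act]
  apply free_act_mem_balancedRelations
  have h1 := congrArg ((balancedKer f).subtype.rTensor C) hk
  rw [RelHopfModule.rTensor_ker_coact] at h1
  obtain ⟨s, hs⟩ := RelHopfModule.exists_of_free_coact hπ h1
  have hs' : B.val.toLinearMap.lTensor N s = (k : N ⊗[ℂ] A) := hs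
  rw [← hs']
  have h2 := (mem_balancedKer f _).1 k.2
  rw [← hs', ← lTensor_rTensor_apply] at h2
  have h3 := rightActionMap_eq_zero hπ h2
  have h4 : ∀ s, rightActionMap B N' ((f.restrictScalars ℂ).rTensor B s) =
      f (rightActionMap B N s) := by
    intro s
    induction s with
    | zero => simp
    | add a b ha hb => simp only [map_add, ha, hb]
    | tmul n b => exact (f.map_smul _ _).symm
  rw [h4] at h3
  have h5 : rightActionMap B N s = 0 := hf (h3.trans (map_zero f).symm)
  have h6 : ∀ s : N ⊗[ℂ] B, B.val.toLinearMap.lTensor N s -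
      (rightActionMap B N s) ⊗ₜ (1 : A) ∈ balancedRelations B N A := by
    intro s
    induction s with
    | zero => simp
    | add a b ha hb =>
      rw [map_add, map_add, TensorProduct.add_tmul, add_sub_add_comm]
      exact add_mem ha hb
    | tmul n b =>
      have := neg_mem (tmul_sub_tmul_mem_balancedRelations n b (1 : A))
      rw [neg_sub, Subalgebra.smul_def, smul_eq_mul, mul_one] at this
      exact this
  simpa [h5] using h6 s

end LeftFlatness

/-! ### Bijectivity of antipodes -/

section AntipodeBijective

variable {A C : Type u} [Ring A] [HopfAlgebra ℂ A] [Ring C] [HopfAlgebra ℂ C]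
  {B : Subalgebra ℂ A} {π : A →ₐ[ℂ] C}

/-- If the antipode of `A` is bijective, then the antipode of `A/B⁺A` is injective. -/
theorem IsHopfQuotient.antipode_injective [hB : IsQuantumHomogeneousSpace B]
    (hπ : IsHopfQuotient B π)
    (hS : Function.Bijective (HopfAlgebra.antipode ℂ : A →ₗ[ℂ] A))
    (hSπ : ∀ a, HopfAlgebra.antipode ℂ (π a) = π (HopfAlgebra.antipode ℂ a)) :
    Function.Injective (HopfAlgebra.antipode ℂ : C →ₗ[ℂ] C) := by
  let e := LinearEquiv.ofBijective (HopfAlgebra.antipode ℂ : A →ₗ[ℂ] A) hS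
  have he : ∀ x, HopfAlgebra.antipode ℂ (e.symm x) = x := e.apply_symm_apply
  have hmul : ∀ x y, e.symm (x * y) = e.symm y * e.symm x := fun x y => by
    apply hS.1
    rw [he, HopfAlgebra.antipode_mul_antidistrib, he, he]
  have hone : e.symm 1 = 1 := by
    apply hS.1
    rw [he, HopfAlgebra.antipode_one]
  -- `R` is `x ⊗ y ↦ y S⁻¹(x)`; applying `S` to the antipode axiom's mirror form gives `b₂ S⁻¹(b₁) =
  -- ε(b)`.
  let R : A ⊗[ℂ] A →ₗ[ℂ] A := LinearMap.mul' ℂ A ∘ₗ (TensorProduct.comm ℂ A A).toLinearMap ∘ₗ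
    e.symm.toLinearMap.rTensor A
  have hR : ∀ t, HopfAlgebra.antipode ℂ (R t) =
      LinearMap.mul' ℂ A ((HopfAlgebra.antipode ℂ (A := A)).lTensor A t) := by
    intro t
    induction t with
    | zero => simp
    | add a b ha hb => simp only [map_add, ha, hb]
    | tmul x y => simp [R, HopfAlgebra.antipode_mul_antidistrib, he]
  have hRc : ∀ b, R (Coalgebra.comul (R := ℂ) b) =
      algebraMap ℂ A (Coalgebra.counit (R := ℂ) b) := by
    intro b
    apply hS.1
    rw [hR, HopfAlgebra.mul_antipode_lTensor_comul_apply, Algebra.algebraMap_eq_smul_one, map_smul,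
      HopfAlgebra.antipode_one]
  -- In `b₂ S⁻¹(b₁) = 0` the factor `b₂` lies in `B`, so `π` turns it into a scalar and leaves
  -- `π(S⁻¹(b)) = 0`. Hence `S⁻¹` preserves the kernel of `π`.
  have hb0 : ∀ b ∈ B.augmentation, π (e.symm b) = 0 := by
    intro b hb
    obtain ⟨t, ht, -, ht2⟩ := hB.comul_sub_mem B hb
    have h1 : ∀ t : A ⊗[ℂ] B, π (R (Algebra.TensorProduct.map (AlgHom.id ℂ A) B.val t)) =
        π (e.symm (TensorProduct.rid ℂ A ((Coalgebra.counit (R := ℂ) (A := A)).lTensor A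
          (Algebra.TensorProduct.map (AlgHom.id ℂ A) B.val t)))) := by
      intro t
      induction t with
      | zero => simp
      | add a b ha hb => simp only [map_add, ha, hb]
      | tmul x b => simp [R, hπ.apply_eq b.2, Algebra.algebraMap_eq_smul_one]
    have h2 := h1 t
    rw [← ht, hRc, ht, ht2, show Coalgebra.counit (R := ℂ) b = 0 from hb.2] at h2
    simpa using h2.symm
  have hker : ∀ x, π x = 0 → π (e.symm x) = 0 := by
    intro x hx
    have hx' : x ∈ B.augmentation * ⊤ := hπ.ker_eq ▸ (show x ∈ LinearMap.ker π.toLinearMap from hx)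
    clear hx
    induction hx' using Submodule.mul_induction_on' with
    | mem_mul_mem b hb y _ => rw [hmul, map_mul, hb0 b hb, mul_zero]
    | add x hx y hy h1 h2 =>
      rw [map_add, map_add, h1, h2, add_zero]
  rw [← LinearMap.ker_eq_bot, LinearMap.ker_eq_bot']
  intro c hc
  obtain ⟨a, rfl⟩ := hπ.surjective c
  rw [hSπ] at hc
  have h := hker _ hc
  rwa [show e.symm (HopfAlgebra.antipode ℂ a) = a from e.symm_apply_apply a] at h

theorem IsHopfQuotient.antipode_surjective (hπ : IsHopfQuotient B π)
    (hS : Function.Bijective (HopfAlgebra.antipode ℂ : A →ₗ[ℂ] A))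
    (hSπ : ∀ a, HopfAlgebra.antipode ℂ (π a) = π (HopfAlgebra.antipode ℂ a)) :
    Function.Surjective (HopfAlgebra.antipode ℂ : C →ₗ[ℂ] C) := by
  intro c
  obtain ⟨a, rfl⟩ := hπ.surjective c
  obtain ⟨x, rfl⟩ := hS.2 a
  exact ⟨π x, hSπ x⟩

end AntipodeBijective

/-! ### Nested quantum homogeneous spaces -/

section Pair

variable {A C D : Type u} [Ring A] [HopfAlgebra ℂ A] [Ring C] [HopfAlgebra ℂ C]
  [Ring D] [HopfAlgebra ℂ D] {B P : Subalgebra ℂ A} {π : A →ₐ[ℂ] C} {ρ : A →ₐ[ℂ] D}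
  {f : C →ₐ[ℂ] D}

theorem comul_apply_of_comp (hπ : IsHopfQuotient B π) (hρ : IsHopfQuotient P ρ)
    (hf : ∀ a, f (π a) = ρ a) (c : C) : Coalgebra.comul (R := ℂ) (f c) =
      TensorProduct.map f.toLinearMap f.toLinearMap (Coalgebra.comul (R := ℂ) c) := by
  obtain ⟨a, rfl⟩ := hπ.surjective c
  have h : ρ.toLinearMap = f.toLinearMap ∘ₗ π.toLinearMap := LinearMap.ext fun a => (hf a).symm
  rw [hf, hπ.comul_apply, hρ.comul_apply, h, TensorProduct.map_comp, LinearMap.comp_apply]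

theorem counit_apply_of_comp (hπ : IsHopfQuotient B π) (hρ : IsHopfQuotient P ρ)
    (hf : ∀ a, f (π a) = ρ a) (c : C) :
    Coalgebra.counit (R := ℂ) (f c) = Coalgebra.counit (R := ℂ) c := by
  obtain ⟨a, rfl⟩ := hπ.surjective c
  rw [hf, hπ.counit_apply, hρ.counit_apply]

theorem coactionAlong_apply_of_comp (hπ : IsHopfQuotient B π) (hf : ∀ a, f (π a) = ρ a) (a : A) :
    coactionAlong f (π a) = π.toLinearMap.rTensor D (coactionAlong ρ a) := by
  rw [coactionAlong_apply, hπ.comul_apply, coactionAlong_apply]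
  generalize Coalgebra.comul (R := ℂ) a = t
  induction t with
  | zero => simp
  | add a b ha hb => simp only [map_add, ha, hb]
  | tmul a b => simp [hf]

/-- The quotient `C` of `A` as a Hopf module over the further quotient `D`. -/
def RelHopfModule.ofQuotient (hπ : IsHopfQuotient B π) (hρ : IsHopfQuotient P ρ)
    (hf : ∀ a, f (π a) = ρ a) : RelHopfModule ρ C where
  coact := (coactionAlong f).toLinearMap
  coassoc := coactionAlong_coassoc (comul_apply_of_comp hπ hρ hf)
  counit := coactionAlong_counit (counit_apply_of_comp hπ hρ hf)
  act := (LinearMap.mul ℂ C).flip ∘ₗ π.toLinearMap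
  act_one c := by simp
  act_mul a b c := by simp [mul_assoc]
  coact_act a c := by
    simp only [LinearMap.comp_apply, LinearMap.flip_apply, AlgHom.toLinearMap_apply,
      LinearMap.mul_apply', map_mul]
    rw [coactionAlong_apply_of_comp hπ hf]
    generalize coactionAlong ρ a = s
    generalize coactionAlong f c = t
    induction s with
    | zero => simp
    | add a b ha hb => simp only [map_add, mul_add, LinearMap.add_apply, ha, hb]
    | tmul a d =>
      induction t with
      | zero => simp
      | add a b ha hb => simp only [map_add, add_mul, ha, hb]
      | tmul c d => simp

/-- The coinvariants of `C` under `D` are the image of `P`. -/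
theorem mem_map_of_coactionAlong_eq [IsQuantumHomogeneousSpace P] (hπ : IsHopfQuotient B π)
    (hρ : IsHopfQuotient P ρ) (hf : ∀ a, f (π a) = ρ a) {c : C}
    (hc : coactionAlong f c = c ⊗ₜ 1) : c ∈ P.map π := by
  -- This is `π` read as a surjection of Hopf modules over `(A, D)`. The coinvariant `c` lifts to
  -- `A`, where the coinvariants are `P`.
  let g : ℂ ⊗[ℂ] A →ₗ[ℂ] C := π.toLinearMap ∘ₗ (TensorProduct.lid ℂ A).toLinearMap
  obtain ⟨m, hm, rfl⟩ := (RelHopfModule.free hρ ℂ).exists_coinvariant hρ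
    (RelHopfModule.ofQuotient hπ hρ hf) g
    (fun t => by
      induction t with
      | zero => simp
      | add a b ha hb => simp only [map_add, ha, hb]
      | tmul z a =>
        change coactionAlong f (π (z • a)) = _
        rw [coactionAlong_apply_of_comp hπ hf, RelHopfModule.free_coact_tmul, map_smul]
        generalize coactionAlong ρ a = s
        induction s with
        | zero => simp
        | add a b ha hb =>
          simp only [map_add, TensorProduct.tmul_add, smul_add, ha, hb]
        | tmul a d => simp [g, TensorProduct.smul_tmul'])
    (fun a t => by
      induction t with
      | zero => simp
      | add a b ha hb => simp only [map_add, ha, hb]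
      | tmul z b =>
        rw [RelHopfModule.free_act_tmul]
        simp [g, RelHopfModule.ofQuotient])
    (fun c => by
      obtain ⟨a, rfl⟩ := hπ.surjective c
      exact ⟨1 ⊗ₜ a, by simp [g]⟩)
    (m' := c) hc
  obtain ⟨s, rfl⟩ := RelHopfModule.exists_of_free_coact hρ hm
  refine ⟨TensorProduct.lid ℂ P s, (TensorProduct.lid ℂ P s).2, ?_⟩
  clear hm hc
  induction s with
  | zero => simp
  | add a b ha hb =>
    simp only [map_add, Subalgebra.coe_add] at ha hb ⊢
    rw [ha, hb]
  | tmul z p => simp [g]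

theorem apply_eq_of_mem_map (hρ : IsHopfQuotient P ρ) (hπ : IsHopfQuotient B π)
    (hf : ∀ a, f (π a) = ρ a) {h : C} (hh : h ∈ P.map π) :
    f h = algebraMap ℂ D (Coalgebra.counit (R := ℂ) h) := by
  obtain ⟨p, hp, rfl⟩ := hh
  change f (π p) = algebraMap ℂ D (Coalgebra.counit (R := ℂ) (π p))
  rw [hf, hρ.apply_eq hp, hπ.counit_apply]

/-- Left coinvariance of `π(P)`: the first leg of `Δ(h)` stays in the Hopf subalgebra, where `f` is
the counit. -/
theorem lTensor_comm_comul_of_mem_map (hπ : IsHopfQuotient B π) (hρ : IsHopfQuotient P ρ)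
    (hf : ∀ a, f (π a) = ρ a) [hH : (P.map π).IsHopfSubalgebra] {h : C} (hh : h ∈ P.map π) :
    f.toLinearMap.rTensor C (Coalgebra.comul (R := ℂ) h) = 1 ⊗ₜ h := by
  obtain ⟨t, ht⟩ := hH.comul_mem h hh
  have h1 : ∀ t : P.map π ⊗[ℂ] P.map π, f.toLinearMap.rTensor C
      (Algebra.TensorProduct.map (P.map π).val (P.map π).val t) =
      (Algebra.linearMap ℂ D).rTensor C ((Coalgebra.counit (R := ℂ) (A := C)).rTensor C
        (Algebra.TensorProduct.map (P.map π).val (P.map π).val t)) := by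
    intro t
    induction t with
    | zero => simp
    | add a b ha hb => simp only [map_add, ha, hb]
    | tmul a b => simp [apply_eq_of_mem_map hρ hπ hf a.2]
  have ht' : Algebra.TensorProduct.map (P.map π).val (P.map π).val t =
      Coalgebra.comul (R := ℂ) h := ht
  rw [← ht', h1, ht', Coalgebra.rTensor_counit_comul]
  simp

/-- The antipode reverses the coproduct, so left coinvariance of `S(x)` reads `S(x₁) ⊗ S(f(x₂)) =
S(x) ⊗ 1`. Injectivity of both antipodes gives right coinvariance of `x`, which characterises
`π(P)`. -/
theorem mem_map_of_antipode_mem (hπ : IsHopfQuotient B π) (hρ : IsHopfQuotient P ρ)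
    [IsQuantumHomogeneousSpace P] (hf : ∀ a, f (π a) = ρ a) [(P.map π).IsHopfSubalgebra]
    (hSC : Function.Injective (HopfAlgebra.antipode ℂ : C →ₗ[ℂ] C))
    (hSD : Function.Injective (HopfAlgebra.antipode ℂ : D →ₗ[ℂ] D))
    (hSf : ∀ c, HopfAlgebra.antipode ℂ (f c) = f (HopfAlgebra.antipode ℂ c)) {x : C}
    (hx : HopfAlgebra.antipode ℂ x ∈ P.map π) : x ∈ P.map π := by
  apply mem_map_of_coactionAlong_eq hπ hρ hf
  apply TensorProduct.map_injective_of_flat_flat _ _ hSC hSD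
  have h1 := congrArg (TensorProduct.comm ℂ D C) (lTensor_comm_comul_of_mem_map hπ hρ hf hx)
  rw [comul_antipode_eq] at h1
  rw [TensorProduct.map_tmul, HopfAlgebra.antipode_one]
  refine Eq.trans ?_ h1
  rw [coactionAlong_apply]
  generalize Coalgebra.comul (R := ℂ) x = t
  induction t with
  | zero => simp
  | add a b ha hb => simp only [map_add, ha, hb]
  | tmul a b => simp [hSf]

/-- The antipode of the Hopf subalgebra `π(P)` is bijective. -/
theorem antipode_map_bijective (hπ : IsHopfQuotient B π) (hρ : IsHopfQuotient P ρ)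
    [IsQuantumHomogeneousSpace P] (hf : ∀ a, f (π a) = ρ a) [(P.map π).IsHopfSubalgebra]
    (hSC : Function.Bijective (HopfAlgebra.antipode ℂ : C →ₗ[ℂ] C))
    (hSD : Function.Injective (HopfAlgebra.antipode ℂ : D →ₗ[ℂ] D))
    (hSf : ∀ c, HopfAlgebra.antipode ℂ (f c) = f (HopfAlgebra.antipode ℂ c)) :
    Function.Bijective (HopfAlgebra.antipode ℂ : P.map π →ₗ[ℂ] P.map π) := by
  constructor
  · intro x y hxy
    exact Subtype.ext (hSC.1 (congrArg Subtype.val hxy))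
  · rintro ⟨h, hh⟩
    obtain ⟨x, rfl⟩ := hSC.2 h
    exact ⟨⟨x, mem_map_of_antipode_mem hπ hρ hf hSC.1 hSD hSf hh⟩, rfl⟩

/-! ### The restricted coaction -/

variable (P π) in
/-- The restriction `P → π(P)` of `π`. -/
def mapRestrict : P →ₐ[ℂ] P.map π :=
  (π.comp P.val).codRestrict (P.map π) fun p => ⟨p, p.2, rfl⟩

theorem map_val_val_injective (H : Subalgebra ℂ C) :
    Function.Injective (Algebra.TensorProduct.map P.val H.val) :=
  TensorProduct.map_injective_of_flat_flat P.val.toLinearMap H.val.toLinearMap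
    Subtype.val_injective Subtype.val_injective

/-- The second leg is in `π(P)` because `Δ(p)` is in `A ⊗ P`. The first is in `P = A^{co D}`,
because left coinvariance of `π(P)` gives `p₁ ⊗ ρ(p₂) ⊗ π(p₃) = p₁ ⊗ 1 ⊗ π(p₂)`. -/
theorem coactionAlong_mem_range [hP : IsQuantumHomogeneousSpace P] (hπ : IsHopfQuotient B π)
    (hρ : IsHopfQuotient P ρ) (hf : ∀ a, f (π a) = ρ a) [(P.map π).IsHopfSubalgebra] (p : P) :
    coactionAlong π (p : A) ∈ (Algebra.TensorProduct.map P.val (P.map π).val).range := by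
  obtain ⟨t, ht⟩ := hP.comul_mem p p.2
  have ht' : Algebra.TensorProduct.map (AlgHom.id ℂ A) P.val t =
    Coalgebra.comul (R := ℂ) (p : A) := ht
  let d : A →ₗ[ℂ] A ⊗[ℂ] D := (coactionAlong ρ).toLinearMap - (TensorProduct.mk ℂ A D).flip 1
  let s := (mapRestrict P π).toLinearMap.lTensor A t
  have hs : (P.map π).val.toLinearMap.lTensor A s = coactionAlong π (p : A) := by
    rw [coactionAlong_apply, ← ht']
    simp only [s]
    clear ht ht' s
    induction t with
    | zero => simp
    | add a b ha hb => simp only [map_add, ha, hb]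
    | tmul a q => rfl
  have h1 : (coactionAlong ρ).toLinearMap.rTensor C (coactionAlong π (p : A)) =
      ((TensorProduct.mk ℂ A D).flip 1).rTensor C (coactionAlong π (p : A)) := by
    apply (TensorProduct.assoc ℂ A D C).injective
    have h2 : ∀ t : A ⊗[ℂ] A, TensorProduct.assoc ℂ A D C
        ((coactionAlong ρ).toLinearMap.rTensor C (π.toLinearMap.lTensor A t)) =
        (TensorProduct.map ρ.toLinearMap π.toLinearMap).lTensor A
          (TensorProduct.assoc ℂ A A A ((Coalgebra.comul (R := ℂ)).rTensor A t)) := by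
      intro t
      induction t with
      | zero => simp
      | add a b ha hb => simp only [map_add, ha, hb]
      | tmul a b =>
        simp only [LinearMap.lTensor_tmul, LinearMap.rTensor_tmul, AlgHom.toLinearMap_apply,
          coactionAlong_apply]
        generalize Coalgebra.comul (R := ℂ) a = s
        induction s with
        | zero => simp
        | add a b ha hb => simp only [map_add, TensorProduct.add_tmul, ha, hb]
        | tmul a b => simp
    have h3 : ∀ q : P, TensorProduct.map ρ.toLinearMap π.toLinearMap
        (Coalgebra.comul (R := ℂ) (q : A)) = 1 ⊗ₜ π q := by
      intro q
      rw [← lTensor_comm_comul_of_mem_map hπ hρ hf (h := π q) ⟨q, q.2, rfl⟩, hπ.comul_apply]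
      generalize Coalgebra.comul (R := ℂ) (q : A) = t
      induction t with
      | zero => simp
      | add a b ha hb => simp only [map_add, ha, hb]
      | tmul a b => simp [hf]
    rw [coactionAlong_apply, h2, Coalgebra.coassoc_apply, ← ht']
    clear ht ht' s hs
    induction t with
    | zero => simp
    | add a b ha hb => simp only [map_add, ha, hb]
    | tmul a q => simp [h3]
  -- The identity `h1` holds in `A ⊗ D ⊗ C`; injectivity of `π(P) → C` brings it back to `π(P)`, so
  -- both legs can be restricted at once.
  have h4 : d.rTensor (P.map π) s = 0 := by
    have hinj : Function.Injective ((P.map π).val.toLinearMap.lTensor (A ⊗[ℂ] D)) :=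
      Module.Flat.lTensor_preserves_injective_linearMap _ Subtype.val_injective
    apply hinj
    rw [lTensor_rTensor_apply, hs, map_zero]
    simp only [d]
    rw [LinearMap.rTensor_sub, LinearMap.sub_apply, h1, sub_self]
  have hex : Function.Exact P.val.toLinearMap d := by
    intro a
    constructor
    · intro h
      exact ⟨⟨a, mem_of_coactionAlong_eq hρ (sub_eq_zero.1 h)⟩, rfl⟩
    · rintro ⟨b, rfl⟩
      exact sub_eq_zero.2 (coactionAlong_eq_tmul hρ b.2)
  obtain ⟨r, hr⟩ := (Module.Flat.rTensor_exact (P.map π) hex s).1 h4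
  refine ⟨r, ?_⟩
  rw [← hs, ← hr]
  clear hr
  change Algebra.TensorProduct.map P.val (P.map π).val r = _
  induction r with
  | zero => simp
  | add a b ha hb => simp only [map_add, ha, hb]
  | tmul a q => rfl

/-- The restricted coaction `P → P ⊗ π(P)`. -/
def restrictedCoaction [(P.map π).IsHopfSubalgebra]
    (h : ∀ p : P, coactionAlong π (p : A) ∈
      (Algebra.TensorProduct.map P.val (P.map π).val).range) : P →ₐ[ℂ] P ⊗[ℂ] P.map π :=
  (AlgEquiv.ofInjective _ (map_val_val_injective (P.map π))).symm.toAlgHom.comp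
    (((coactionAlong π).comp P.val).codRestrict
      (Algebra.TensorProduct.map P.val (P.map π).val).range h)

theorem map_restrictedCoaction [(P.map π).IsHopfSubalgebra]
    (h : ∀ p : P, coactionAlong π (p : A) ∈
      (Algebra.TensorProduct.map P.val (P.map π).val).range) (p : P) :
    Algebra.TensorProduct.map P.val (P.map π).val (restrictedCoaction h p) =
      coactionAlong π (p : A) :=
  congrArg Subtype.val ((AlgEquiv.ofInjective _
    (map_val_val_injective (P.map π))).apply_symm_apply ⟨coactionAlong π (p : A), h p⟩)

theorem map_map_val_val_injective (H : Subalgebra ℂ C) :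
    Function.Injective (Algebra.TensorProduct.map P.val
      (Algebra.TensorProduct.map H.val H.val)) :=
  TensorProduct.map_injective_of_flat_flat P.val.toLinearMap
    (Algebra.TensorProduct.map H.val H.val).toLinearMap
    Subtype.val_injective (Subalgebra.IsHopfSubalgebra.map_val_injective H)

theorem map_map_assoc_rTensor {X Y Z W : Type*} [AddCommGroup X] [Module ℂ X] [AddCommGroup Y]
    [Module ℂ Y] [AddCommGroup Z] [Module ℂ Z] [AddCommGroup W] [Module ℂ W]
    (i : X →ₗ[ℂ] Z) (j : Y →ₗ[ℂ] W) (d : X →ₗ[ℂ] X ⊗[ℂ] Y) (e : Z →ₗ[ℂ] Z ⊗[ℂ] W)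
    (h : ∀ x, TensorProduct.map i j (d x) = e (i x)) (t : X ⊗[ℂ] Y) :
    TensorProduct.map i (TensorProduct.map j j) (TensorProduct.assoc ℂ X Y Y (d.rTensor Y t)) =
      TensorProduct.assoc ℂ Z W W (e.rTensor W (TensorProduct.map i j t)) := by
  induction t with
  | zero => simp
  | add a b ha hb => simp only [map_add, ha, hb]
  | tmul x y =>
    rw [LinearMap.rTensor_tmul, TensorProduct.map_tmul, LinearMap.rTensor_tmul, ← h]
    generalize d x = s
    induction s with
    | zero => simp
    | add a b ha hb => simp only [map_add, TensorProduct.add_tmul, ha, hb]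
    | tmul a b => simp

theorem map_map_lTensor {X Y Z W : Type*} [AddCommGroup X] [Module ℂ X] [AddCommGroup Y]
    [Module ℂ Y] [AddCommGroup Z] [Module ℂ Z] [AddCommGroup W] [Module ℂ W]
    (i : X →ₗ[ℂ] Z) (j : Y →ₗ[ℂ] W) (d : Y →ₗ[ℂ] Y ⊗[ℂ] Y) (e : W →ₗ[ℂ] W ⊗[ℂ] W)
    (h : ∀ y, TensorProduct.map j j (d y) = e (j y)) (t : X ⊗[ℂ] Y) :
    TensorProduct.map i (TensorProduct.map j j) (d.lTensor X t) =
      e.lTensor Z (TensorProduct.map i j t) := by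
  induction t with
  | zero => simp
  | add a b ha hb => simp only [map_add, ha, hb]
  | tmul x y => simp [h]

/-- The restricted coaction makes `P` a comodule algebra. -/
def restrictedComoduleAlgebra [(P.map π).IsHopfSubalgebra] (hπ : IsHopfQuotient B π)
    (h : ∀ p : P, coactionAlong π (p : A) ∈
      (Algebra.TensorProduct.map P.val (P.map π).val).range) :
    RightComoduleAlgebra P (P.map π) where
  coaction := restrictedCoaction h
  coassoc p := by
    apply map_map_val_val_injective (P.map π)
    have key := coactionAlong_coassoc hπ.comul_apply (p : A)
    rw [← map_restrictedCoaction h p] at key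
    refine (map_map_assoc_rTensor P.val.toLinearMap (P.map π).val.toLinearMap
      (restrictedCoaction h).toLinearMap (coactionAlong π).toLinearMap
      (fun p => map_restrictedCoaction h p) _).trans (key.trans ?_)
    exact (map_map_lTensor P.val.toLinearMap (P.map π).val.toLinearMap
      (Coalgebra.comul (R := ℂ)) (Coalgebra.comul (R := ℂ))
      (fun c => Subalgebra.IsHopfSubalgebra.map_comul (P.map π) c) _).symm
  counit p := by
    apply (Module.Flat.rTensor_preserves_injective_linearMap (M := ℂ) P.val.toLinearMap
      Subtype.val_injective)
    have key := coactionAlong_counit hπ.counit_apply (p : A)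
    rw [← map_restrictedCoaction h p] at key
    refine Eq.trans ?_ key
    generalize restrictedCoaction h p = t
    clear key
    induction t with
    | zero => simp
    | add a b ha hb => simp only [map_add, ha, hb]
    | tmul a b => rfl

end Pair

/-! ### The restricted coaction is principal -/

section Principal

variable {A C D : Type u} [Ring A] [HopfAlgebra ℂ A] [Ring C] [HopfAlgebra ℂ C]
  [Ring D] [HopfAlgebra ℂ D] {B P : Subalgebra ℂ A} {π : A →ₐ[ℂ] C} {ρ : A →ₐ[ℂ] D}
  [(P.map π).IsHopfSubalgebra] {δ : RightComoduleAlgebra P (P.map π)}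

theorem mem_coinvariants_iff [IsQuantumHomogeneousSpace B] (hπ : IsHopfQuotient B π)
    (hδ : ∀ p : P, Algebra.TensorProduct.map P.val (P.map π).val (δ.coaction p) =
      coactionAlong π (p : A)) (p : P) : p ∈ δ.coinvariants ↔ (p : A) ∈ B := by
  have h1 : p ∈ δ.coinvariants ↔ δ.coaction p = p ⊗ₜ[ℂ] (1 : P.map π) := Iff.rfl
  rw [h1, ← (map_val_val_injective (P := P) (P.map π)).eq_iff, hδ]
  exact ⟨fun h => mem_of_coactionAlong_eq hπ h, fun h => coactionAlong_eq_tmul hπ h⟩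

theorem map_preCan
    (hδ : ∀ p : P, Algebra.TensorProduct.map P.val (P.map π).val (δ.coaction p) =
      coactionAlong π (p : A)) (t : P ⊗[ℂ] P) :
    Algebra.TensorProduct.map P.val (P.map π).val (δ.preCan t) =
      galoisMap π (P.val.toLinearMap.lTensor A (P.val.toLinearMap.rTensor P t)) := by
  induction t with
  | zero => simp
  | add a b ha hb => simp only [map_add, ha, hb]
  | tmul p q =>
    rw [RightComoduleAlgebra.preCan_tmul, map_mul, hδ, LinearMap.rTensor_tmul,
      LinearMap.lTensor_tmul, galoisMap_tmul]
    rfl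

/-- The canonical map is the restriction of the injective Galois map on `A ⊗_B A`. The map `P ⊗_B P
→ A ⊗_B P → A ⊗_B A` is injective, by purity of `A` over `P` and then by flatness of `A` over `B`.
-/
theorem can_injective [hB : IsQuantumHomogeneousSpace B] [hP : IsQuantumHomogeneousSpace P]
    (hle : B ≤ P) (hπ : IsHopfQuotient B π)
    (hδ : ∀ p : P, Algebra.TensorProduct.map P.val (P.map π).val (δ.coaction p) =
      coactionAlong π (p : A)) : Function.Injective δ.can := by
  rw [← LinearMap.ker_eq_bot, LinearMap.ker_eq_bot']
  intro z hz
  obtain ⟨t, rfl⟩ := Submodule.Quotient.mk_surjective _ z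
  have h0 : δ.preCan t = 0 := hz
  have h1 := map_preCan hδ t
  rw [h0, map_zero] at h1
  have h2 := mem_balancedRelations_of_galoisMap hπ h1.symm
  let e : B →+* P := Subalgebra.inclusion hle
  let _ : Module B P := Module.compHom P e
  have : IsScalarTower ℂ B P := ⟨fun c b p => smul_assoc c (e b) p⟩
  let f : P →ₗ[B] A := { P.val.toLinearMap with map_smul' := fun _ _ => rfl }
  have h3 := hB.faithfullyFlat.isFlatRight P A f Subtype.val_injective _ h2
  exact (Submodule.Quotient.mk_eq_zero _).2 (mem_balancedRelations_of_rTensor_val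
    (mem_coinvariants_iff hπ hδ) hle hP.faithfullyFlat.isPureRight (fun _ _ => rfl) h3)

/-- The map `A ⊗ (P ⊗ V) → A ⊗ V`, `a ⊗ (p ⊗ v) ↦ a p ⊗ v`. -/
def subalgebraMulTensor (P : Subalgebra ℂ A) (V : Type*) [AddCommGroup V] [Module ℂ V] :
    A ⊗[ℂ] (P ⊗[ℂ] V) →ₗ[ℂ] A ⊗[ℂ] V :=
  (LinearMap.mul' ℂ A ∘ₗ P.val.toLinearMap.lTensor A).rTensor V ∘ₗ
    (TensorProduct.assoc ℂ A P V).symm.toLinearMap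

/-- Moving `p` across gives `a ⊗ (p ⊗ v) = a p ⊗ (1 ⊗ v)`, the concrete form of `A ⊗_P (P ⊗ V) ≅ A ⊗
V`. -/
theorem sub_subalgebraMulTensor_mem {V : Type*} [AddCommGroup V] [Module ℂ V]
    (w : A ⊗[ℂ] (P ⊗[ℂ] V)) :
    w - (TensorProduct.mk ℂ P V 1).lTensor A (subalgebraMulTensor P V w) ∈
      balancedRelations P A (P ⊗[ℂ] V) := by
  induction w with
  | zero => simp
  | add x y hx hy => rw [map_add, map_add, add_sub_add_comm]; exact add_mem hx hy
  | tmul a s =>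
    induction s with
    | zero => simp
    | add x y hx hy =>
      rw [TensorProduct.tmul_add, map_add, map_add, add_sub_add_comm]; exact add_mem hx hy
    | tmul p v =>
      have h := neg_mem (tmul_sub_tmul_mem_balancedRelations a p ((1 : P) ⊗ₜ[ℂ] v))
      rw [neg_sub, TensorProduct.smul_tmul', smul_eq_mul, mul_one] at h
      exact h

theorem lTensor_val_subalgebraMulTensor (H : Subalgebra ℂ C) (a : A) (s : P ⊗[ℂ] H) :
    H.val.toLinearMap.lTensor A (subalgebraMulTensor P H (a ⊗ₜ s)) =
      (a ⊗ₜ[ℂ] (1 : C)) * Algebra.TensorProduct.map P.val H.val s := by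
  induction s with
  | zero => simp
  | add x y hx hy => simp only [TensorProduct.tmul_add, map_add, mul_add, hx, hy]
  | tmul p v => simp [subalgebraMulTensor]

/-- The map `P ⊗ P → P ⊗ π(P)` is left `P`-linear, so surjectivity may be tested after `A ⊗_P -`.
There the antipode of `A` is available, although it need not preserve `P`. -/
theorem can_surjective [hP : IsQuantumHomogeneousSpace P]
    (hδ : ∀ p : P, Algebra.TensorProduct.map P.val (P.map π).val (δ.coaction p) =
      coactionAlong π (p : A)) : Function.Surjective δ.can := by
  let f : P ⊗[ℂ] P →ₗ[P] P ⊗[ℂ] P.map π :=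
    { δ.preCan with
      map_smul' := fun p t => by
        change δ.preCan (p • t) = p • δ.preCan t
        induction t with
        | zero => simp
        | add a b ha hb => simp only [smul_add, map_add, ha, hb]
        | tmul x y =>
          rw [TensorProduct.smul_tmul', smul_eq_mul, RightComoduleAlgebra.preCan_tmul,
            RightComoduleAlgebra.preCan_tmul]
          generalize δ.coaction y = s
          induction s with
          | zero => simp
          | add a b ha hb => simp only [mul_add, smul_add, ha, hb]
          | tmul a b => simp [TensorProduct.smul_tmul', mul_assoc] }
  suffices hf : Function.Surjective f by
    intro y
    obtain ⟨t, rfl⟩ := hf y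
    exact ⟨Submodule.Quotient.mk t, rfl⟩
  apply hP.faithfullyFlat.surjective f
  suffices h : ∀ (a : A) (h : P.map π), ∃ y : A ⊗[ℂ] (P ⊗[ℂ] P),
      (f.restrictScalars ℂ).lTensor A y - a ⊗ₜ[ℂ] ((1 : P) ⊗ₜ[ℂ] h) ∈
        balancedRelations P A (P ⊗[ℂ] P.map π) by
    intro z
    obtain ⟨w, rfl⟩ := Submodule.Quotient.mk_surjective _ z
    have hw : (Submodule.Quotient.mk w : BalancedTensor P A (P ⊗[ℂ] P.map π)) =
        Submodule.Quotient.mk ((TensorProduct.mk ℂ P (P.map π) 1).lTensor A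
          (subalgebraMulTensor P (P.map π) w)) :=
      (Submodule.Quotient.eq _).2 (sub_subalgebraMulTensor_mem w)
    rw [hw]
    generalize subalgebraMulTensor P (P.map π) w = v
    clear hw
    induction v with
    | zero => exact ⟨0, by simp⟩
    | add x y hx hy =>
      obtain ⟨x', hx⟩ := hx
      obtain ⟨y', hy⟩ := hy
      exact ⟨x' + y', by rw [map_add, hx, hy, map_add, Submodule.Quotient.mk_add]⟩
    | tmul a h' =>
      obtain ⟨y, hy⟩ := h a h'
      exact ⟨Submodule.Quotient.mk y, (Submodule.Quotient.eq _).2 hy⟩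
  rintro a ⟨_, q, hq, rfl⟩
  obtain ⟨t, ht⟩ := hP.comul_mem q hq
  have ht' : P.val.toLinearMap.lTensor A t = Coalgebra.comul (R := ℂ) q := ht
  -- The preimage of `a ⊗ π(q)` is `a S(q₁) ⊗ (1 ⊗ q₂)`, which makes sense because `q₂` lies in `P`.
  let V : A ⊗[ℂ] P →ₗ[ℂ] A ⊗[ℂ] (P ⊗[ℂ] P) :=
    TensorProduct.map (LinearMap.mulLeft ℂ a ∘ₗ HopfAlgebra.antipode ℂ) (TensorProduct.mk ℂ P P 1)
  have h1 : ∀ t : A ⊗[ℂ] P, (P.map π).val.toLinearMap.lTensor A (subalgebraMulTensor P (P.map π)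
      ((f.restrictScalars ℂ).lTensor A (V t))) = galoisMap π ((a ⊗ₜ[ℂ] (1 : A)) *
        (HopfAlgebra.antipode ℂ (A := A)).rTensor A (P.val.toLinearMap.lTensor A t)) := by
    intro t
    induction t with
    | zero => simp
    | add x y hx hy => simp only [map_add, mul_add, hx, hy]
    | tmul x z =>
      change (P.map π).val.toLinearMap.lTensor A (subalgebraMulTensor P (P.map π)
        ((a * HopfAlgebra.antipode ℂ x) ⊗ₜ δ.preCan (1 ⊗ₜ z))) = _
      rw [lTensor_val_subalgebraMulTensor, map_preCan hδ]
      simp [galoisMap_tmul, ← mul_assoc]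
  have h2 := h1 t
  rw [ht', galoisMap_mul, galoisMap_eq, galoisMap_antipode_comul] at h2
  have h3 : subalgebraMulTensor P (P.map π) ((f.restrictScalars ℂ).lTensor A (V t)) =
      a ⊗ₜ[ℂ] (⟨π q, q, hq, rfl⟩ : P.map π) := by
    apply Module.Flat.lTensor_preserves_injective_linearMap (M := A)
      (P.map π).val.toLinearMap Subtype.val_injective
    rw [h2]
    simp
  refine ⟨V t, ?_⟩
  have h4 := sub_subalgebraMulTensor_mem ((f.restrictScalars ℂ).lTensor A (V t))
  rw [h3] at h4
  exact h4

theorem isPrincipal_of_map_coaction [hB : IsQuantumHomogeneousSpace B]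
    [hP : IsQuantumHomogeneousSpace P] (hle : B ≤ P) (hπ : IsHopfQuotient B π)
    (hρ : IsHopfQuotient P ρ)
    (hδ : ∀ p : P, Algebra.TensorProduct.map P.val (P.map π).val (δ.coaction p) =
      coactionAlong π (p : A)) : δ.IsPrincipal where
  hopfGalois := ⟨can_injective hle hπ hδ, can_surjective hδ⟩
  faithfullyFlat_right := by
    have h := mem_coinvariants_iff hπ hδ
    exact isFaithfullyFlatRight_of_isFlatRight_of_isPureRight
      (IsFlatRight.of_intermediate h hle hB.faithfullyFlat.isFlatRight
        hP.faithfullyFlat.isPureRight)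
      (IsPureRight.of_intermediate h hle hB.faithfullyFlat.isPureRight)
  faithfullyFlat_left := by
    have h := mem_coinvariants_iff hπ hδ
    exact isFaithfullyFlatLeft_of_isFlatLeft_of_isPureLeft
      -- On the left neither flatness nor purity is assumed; both come from the Hopf module
      -- argument, used for `π` over `B` and for `ρ` over `P`.
      (IsFlatLeft.of_intermediate h hle (isFlatLeft_of_isHopfQuotient hπ)
        (isPureLeft_of_isHopfQuotient hρ))
      (IsPureLeft.of_intermediate h hle (isPureLeft_of_isHopfQuotient hπ))

end Principal

/-! ### The quotient Hopf algebra of a quantum homogeneous space -/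

section QuotientProj

variable {A : Type u} [Ring A] [HopfAlgebra ℂ A]

theorem isHopfQuotient_quotientProj (B : Subalgebra ℂ A) [hB : IsQuantumHomogeneousSpace B] :
    IsHopfQuotient B (quotientProj B) where
  surjective := Ideal.Quotient.mk_surjective
  comul_apply _ := rfl
  counit_apply _ := rfl
  ker_eq := by
    rw [hB.augmentation_mul, ← B.restrictScalars_augmentationIdeal]
    ext a
    exact Ideal.Quotient.eq_zero_iff_mem

theorem antipode_quotientProj (B : Subalgebra ℂ A) [IsQuantumHomogeneousSpace B] (a : A) :
    HopfAlgebra.antipode ℂ (quotientProj B a) = quotientProj B (HopfAlgebra.antipode ℂ a) := rfl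

end QuotientProj

theorem mainTheorem3 {A : Type u} [Ring A] [HopfAlgebra ℂ A]
    (hS : Function.Bijective (HopfAlgebra.antipode ℂ : A →ₗ[ℂ] A))
    (B P : Subalgebra ℂ A) [IsQuantumHomogeneousSpace B] [IsQuantumHomogeneousSpace P]
    [IsPrincipalPair B P] :
    Function.Bijective (HopfAlgebra.antipode ℂ :
      ↥(P.map (quotientProj B)) →ₗ[ℂ] ↥(P.map (quotientProj B))) ∧
    ∃ δ : RightComoduleAlgebra ↥P ↥(P.map (quotientProj B)),
      (∀ p : P, Algebra.TensorProduct.map P.val (P.map (quotientProj B)).val (δ.coaction p) =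
        quotientCoaction B (p : A)) ∧
      δ.coinvariants = B.comap P.val ∧
      δ.IsPrincipal := by
  have hle : B ≤ P := IsPrincipalPair.le
  have hπ := isHopfQuotient_quotientProj B
  have hρ := isHopfQuotient_quotientProj P
  let f : QuotientHopf B →ₐ[ℂ] QuotientHopf P := Ideal.Quotient.factorₐ ℂ
    (Ideal.span_mono fun _ hx => ⟨hle hx.1, hx.2⟩ : B.augmentationIdeal ≤ P.augmentationIdeal)
  have hf : ∀ a, f (quotientProj B a) = quotientProj P a := fun _ => rfl
  have hSf : ∀ c, HopfAlgebra.antipode ℂ (f c) = f (HopfAlgebra.antipode ℂ c) := fun c => by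
    obtain ⟨a, rfl⟩ := hπ.surjective c
    rw [antipode_quotientProj, hf, hf, antipode_quotientProj]
  refine ⟨antipode_map_bijective hπ hρ hf
    ⟨hπ.antipode_injective hS (antipode_quotientProj B),
      hπ.antipode_surjective hS (antipode_quotientProj B)⟩
    (hρ.antipode_injective hS (antipode_quotientProj P)) hSf, ?_⟩
  let δ := restrictedComoduleAlgebra hπ (coactionAlong_mem_range hπ hρ hf)
  have hδ : ∀ p : P, Algebra.TensorProduct.map P.val (P.map (quotientProj B)).val
      (δ.coaction p) = coactionAlong (quotientProj B) (p : A) := fun p =>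
    map_restrictedCoaction (coactionAlong_mem_range hπ hρ hf) p
  exact ⟨δ, hδ, Subalgebra.ext (mem_coinvariants_iff hπ hδ),
    isPrincipal_of_map_coaction hle hπ hρ hδ⟩
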